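/- **Polymetric rings.** A (not necessarily unital) commutative ring $\mathfrak A$ with a topology is a *polymetric ring* if its topology is induced by a given family of functions $p:\mathfrak A\to[0,\infty)$ with $p(0)=0$, $p(-X)=p(X)$, $p(X+Y)\le p(X)+p(Y)$, such that for each $p$ in the family there is $\tilde p$ in the family with $p(XY)\le\tilde p(X)\tilde p(Y)$. Let $\mathfrak A$ be a commutative, separated, sequentially complete polymetric ring, and let $\mathfrak A^+=\mathbb Z\oplus\mathfrak A$ be its unital extension, with the product topology. **Index sets.** A set of polynomial growth is a finite set, with all real functions on it, or a set with a class of real functions which some bijection to $\mathbb N$ identifies with the functions of at most polynomial growth on $\mathbb N$. Finite disjoint unions and products of such sets are again such sets. A *relabeling* $r:\Omega\to\Omega'$ is an injective map which is an isomorphism of sets of polynomial growth onto its image, and such that $\Omega'$ decomposes, as a set of polynomial growth, into $r(\Omega)$ and $\Omega'\setminus r(\Omega)$. Let $\hat r=\sum_\omega \mathbf e_{r(\omega),\omega}$ and $r_*A=\hat rA\hat r^\top$. **Matrices.** $\mathcal K_\Omega(\mathfrak A)$ is the set of $\Omega\times\Omega$ matrices over $\mathfrak A$ whose entries are rapidly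 decreasing with respect to each $p$ in the family, and $\mathcal K_\Omega(\mathfrak A)^\star$ is the group of invertible matrices $1_\Omega+A$, $A\in\mathcal K_\Omega(\mathfrak A)$. Write $\bar a=1-a$. For a pair $\langle b,a\rangle$ of $\Omega\times\Omega$ matrices over $\mathfrak A^+$ let $$\mathbf R\langle b,a\rangle=\left\langle \begin{bmatrix}\bar a&a\\a&\bar a\end{bmatrix}\begin{bmatrix}b&\\&\bar a\end{bmatrix}\begin{bmatrix}\bar a&a\\a&\bar a\end{bmatrix},\ \begin{bmatrix}0_\Omega&\\&1_\Omega\end{bmatrix}\right\rangle,\qquad \mathbf{R0}_\Omega=\langle 0_\Omega\oplus 1_\Omega,0_\Omega\oplus 1_\Omega\rangle,$$ over the index set $\{0,1\}\times\Omega$. Let $\langle b,a\rangle\oplus\langle d,c\rangle=\langle b\oplus d,a\oplus c\rangle$, $\langle b,a\rangle^{\mathrm{inv}}=\langle\bar b,\bar a\rangle$, and let $\langle b,a\rangle\otimes\langle d,c\rangle$ be one of the two products $$\langle b\otimes d+\bar b\otimes c,\ a\otimes d+\bar a\otimes c\rangle,\qquad \langle b\otimes d+a\otimes\bar d,\ b\otimes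 c+a\otimes\bar c\rangle$$ (the same one throughout). **Grassmannian and operations.** $\mathcal G_{\mathbb N}(\mathfrak A)$ is the set of pairs $x=\langle b,0_{\mathbb N}\oplus1_{\mathbb N}\rangle$ of $(\{0,1\}\times\mathbb N)\times(\{0,1\}\times\mathbb N)$ matrices over $\mathfrak A^+$ with $b^2=b$ and $b-(0_{\mathbb N}\oplus1_{\mathbb N})\in\mathcal K_{\{0,1\}\times\mathbb N}(\mathfrak A)$. Fix arbitrary relabelings $$\theta_1:(\{0,1\}\times\mathbb N)\,\dot\cup\,(\{0,1\}\times\mathbb N)\to\mathbb N,\quad \theta_2:\{0,1\}\times\mathbb N\to\mathbb N,\quad \theta_3:(\{0,1\}\times\mathbb N)\times(\{0,1\}\times\mathbb N)\to\mathbb N,\quad \theta_4:\{0\}\to\mathbb N,$$ and put $$x\,\tilde+\,y=\mathbf R\,\theta_{1*}(x\oplus y),\quad \tilde-x=\mathbf R\,\theta_{2*}(x^{\mathrm{inv}}),\quad \tilde0=\mathbf{R0}_{\mathbb N},\quad x\,\tilde\otimes\,y=\mathbf R\,\theta_{3*}(x\otimes y),$$ and, if $\mathfrak A$ has a unit element $e$,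 also $\tilde1=\mathbf R\,\theta_{4*}\langle e,0\rangle$, where $e$ and $0$ are $1\times1$ matrices. **Strong polynomial homotopy.** Maps $f_1,f_2:X\to\mathcal G_{\mathbb N}(\mathfrak A)$ are *strongly polynomially homotopic* with respect to given data (matrix valued maps on $X$, and constants from $\mathfrak A^+$) if there is a map $g:X\to\mathcal K_{\{0,1\}\times\{0,1\}\times\mathbb N}(\mathfrak A)^\star$ with $g\,(f_2\oplus\mathbf{R0}_{\mathbb N})\,g^{-1}=f_1\oplus\mathbf{R0}_{\mathbb N}$ such that $g$ and $g^{-1}$ are assembled polynomially, that is, are obtained in finitely many steps from the data and from constant relabeling matrices $\hat r$ and their transposes (over any sets of polynomial growth) by sums, differences, products and tensor products of matrices. **Theorem.** The operations $\tilde+,\tilde-,\tilde0,\tilde\otimes$ (and $\tilde1$, if $\mathfrak A$ is unital) map into $\mathcal G_{\mathbb N}(\mathfrak A)$, and with them $\mathcal G_{\mathbb N}(\mathfrak A)$ is a (unital) commutative strong polynomial algebraic $H$-ring: 1. The ring identities hold up to strong polynomial homotopy of maps $\mathcal G_{\mathbb N}(\mathfrak A)^n\to\mathcal G_{\mathbb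 N}(\mathfrak A)$, where the data are the $n$ variables (and the constant $e$, for the unit identities): associativity and commutativity of $\tilde+$, neutrality of $\tilde0$, $x\,\tilde+\,(\tilde-x)\simeq\tilde0\simeq(\tilde-x)\,\tilde+\,x$, associativity and commutativity of $\tilde\otimes$, both distributive laws, and, if $\mathfrak A$ is unital, neutrality of $\tilde1$ on both sides. 2. Each of $\tilde+$, $\tilde-$, $\tilde\otimes$ is compatible with homotopy: if $g_i\in\mathcal K_{\{0,1\}\times\{0,1\}\times\mathbb N}(\mathfrak A)^\star$ conjugates $x_i'\oplus\mathbf{R0}_{\mathbb N}$ into $x_i\oplus\mathbf{R0}_{\mathbb N}$ for each variable $i$, then $\mathrm{Op}(x_1,\dots)$ and $\mathrm{Op}(x_1',\dots)$, as maps of all the $(x_i,x_i',g_i)$, are strongly polynomially homotopic, where the data are all the $x_i$, $x_i'$, $g_i$, $g_i^{-1}$. -/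

import Mathlib

open Filter Topology

universe u v

namespace Polymetric

/-! ### Sets of polynomial growth -/

/-- `u` is bounded by a polynomial of `v`. -/
def PolyLE {Ω : Type} (u v : Ω → ℕ) : Prop :=
  ∃ k : ℕ, ∀ ω, u ω ≤ (v ω + 2) ^ k

/-- The functions on `Ω` of at most polynomial growth in `size` turn `Ω` into a set of polynomial
growth: either `Ω` is finite (then these are all the functions on `Ω`), or some bijection `Ω ≃ ℕ`
identifies them with the functions of at most polynomial growth on `ℕ`. -/
def IsSPG {Ω : Type} (size : Ω → ℕ) : Prop :=
  Finite Ω ∨ ∃ q : Ω ≃ ℕ, PolyLE (fun ω => q ω) size ∧ PolyLE size (fun ω => q ω)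

section PolyLE

variable {Ω Ξ : Type} {s t w : Ω → ℕ}

theorem PolyLE.of_le (h : ∀ ω, s ω ≤ t ω) : PolyLE s t :=
  ⟨1, fun ω => by have := h ω; simp only [pow_one]; omega⟩

theorem PolyLE.trans (h₁ : PolyLE s t) (h₂ : PolyLE t w) : PolyLE s w := by
  obtain ⟨k, hk⟩ := h₁
  obtain ⟨l, hl⟩ := h₂
  refine ⟨(l + 2) * k, fun ω => (hk ω).trans ?_⟩
  rw [pow_mul]
  refine Nat.pow_le_pow_left ?_ k
  have h1 : 1 ≤ (w ω + 2) ^ l := Nat.one_le_pow _ _ (by omega)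
  have h2 := hl ω
  rw [pow_add]
  nlinarith [Nat.zero_le (w ω), Nat.zero_le ((w ω + 2) ^ l * w ω)]

theorem PolyLE.add (h₁ : PolyLE s w) (h₂ : PolyLE t w) : PolyLE (fun ω => s ω + t ω) w := by
  obtain ⟨k, hk⟩ := h₁
  obtain ⟨l, hl⟩ := h₂
  refine ⟨k + l + 1, fun ω => ?_⟩
  have h1 : (w ω + 2) ^ k ≤ (w ω + 2) ^ (k + l) := Nat.pow_le_pow_right (by omega) (by omega)
  have h2 : (w ω + 2) ^ l ≤ (w ω + 2) ^ (k + l) := Nat.pow_le_pow_right (by omega) (by omega)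
  have := hk ω
  have := hl ω
  rw [pow_succ]
  nlinarith [Nat.zero_le ((w ω + 2) ^ (k + l) * w ω)]

theorem PolyLE.mul (h₁ : PolyLE s w) (h₂ : PolyLE t w) : PolyLE (fun ω => s ω * t ω) w := by
  obtain ⟨k, hk⟩ := h₁
  obtain ⟨l, hl⟩ := h₂
  exact ⟨k + l, fun ω => by rw [pow_add]; exact Nat.mul_le_mul (hk ω) (hl ω)⟩

theorem PolyLE.const (c : ℕ) : PolyLE (fun _ => c) t :=
  ⟨c, fun ω => (Nat.lt_two_pow_self).le.trans (Nat.pow_le_pow_left (by omega) c)⟩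

theorem PolyLE.of_finite [Finite Ω] (s t : Ω → ℕ) : PolyLE s t := by
  obtain ⟨c, hc⟩ := (Set.finite_range s).bddAbove
  exact (PolyLE.of_le fun ω => hc ⟨ω, rfl⟩).trans (PolyLE.const c)

theorem PolyLE.comp (h : PolyLE s t) (f : Ξ → Ω) : PolyLE (fun ξ => s (f ξ)) (fun ξ => t (f ξ)) :=
  h.imp fun _ hk ξ => hk (f ξ)

theorem IsSPG.comp_equiv (h : IsSPG s) (e : Ξ ≃ Ω) : IsSPG (fun ξ => s (e ξ)) := by
  rcases h with h | ⟨q, h₁, h₂⟩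
  · exact Or.inl (Finite.of_equiv _ e.symm)
  · exact Or.inr ⟨e.trans q, h₁.comp e, h₂.comp e⟩

end PolyLE

section Constructions

variable {Ω Ξ : Type} {s : Ω → ℕ} {t : Ξ → ℕ}

theorem isSPG_sum_aux [Finite Ω] (q : Ξ ≃ ℕ) (h₁ : PolyLE (fun ξ => q ξ) t)
    (h₂ : PolyLE t (fun ξ => q ξ)) : IsSPG (Sum.elim s t) := by
  obtain ⟨n, ⟨e⟩⟩ := Finite.exists_equiv_fin Ω
  let f : Fin n ⊕ ℕ ≃ ℕ :=
    { toFun := Sum.elim (fun i => (i : ℕ)) (fun m => m + n)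
      invFun := fun m => if h : m < n then Sum.inl ⟨m, h⟩ else Sum.inr (m - n)
      left_inv := by rintro (i | m) <;> simp
      right_inv := by
        intro m
        by_cases h : m < n
        · simp [h]
        · simp [h]; omega }
  refine Or.inr ⟨(Equiv.sumCongr e q).trans f, ?_, ?_⟩
  · obtain ⟨k, hk⟩ := h₁.add (PolyLE.const n)
    obtain ⟨l, hl⟩ := PolyLE.of_finite (fun ω => (e ω : ℕ)) s
    refine ⟨max k l, ?_⟩
    rintro (ω | ξ)
    · exact (hl ω).trans (Nat.pow_le_pow_right (by simp) (le_max_right _ _))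
    · exact (hk ξ).trans (Nat.pow_le_pow_right (by simp) (le_max_left _ _))
  · obtain ⟨k, hk⟩ := h₂.trans (PolyLE.of_le (t := fun ξ => q ξ + n) fun ξ => by simp)
    obtain ⟨l, hl⟩ := PolyLE.of_finite s (fun ω => (e ω : ℕ))
    refine ⟨max k l, ?_⟩
    rintro (ω | ξ)
    · exact (hl ω).trans (Nat.pow_le_pow_right (by simp) (le_max_right _ _))
    · exact (hk ξ).trans (Nat.pow_le_pow_right (by simp) (le_max_left _ _))

theorem IsSPG.sum (hs : IsSPG s) (ht : IsSPG t) : IsSPG (Sum.elim s t) := by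
  rcases hs with hs | ⟨p, p₁, p₂⟩
  · rcases ht with ht | ⟨q, q₁, q₂⟩
    · exact Or.inl inferInstance
    · exact isSPG_sum_aux q q₁ q₂
  · rcases ht with ht | ⟨q, q₁, q₂⟩
    · have h := (isSPG_sum_aux (s := t) p p₁ p₂).comp_equiv (Equiv.sumComm Ω Ξ)
      convert h using 1
      funext x
      rcases x with x | x <;> rfl
    · refine Or.inr ⟨(Equiv.sumCongr p q).trans Equiv.natSumNatEquivNat, ?_, ?_⟩
      · obtain ⟨k, hk⟩ := (PolyLE.const 2).mul p₁
        obtain ⟨l, hl⟩ := ((PolyLE.const 2).mul q₁).add (PolyLE.const 1)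
        refine ⟨max k l, ?_⟩
        rintro (ω | ξ)
        · exact (hk ω).trans (Nat.pow_le_pow_right (by simp) (le_max_left _ _))
        · exact (hl ξ).trans (Nat.pow_le_pow_right (by simp) (le_max_right _ _))
      · obtain ⟨k, hk⟩ := p₂.trans (PolyLE.of_le (t := fun ω => 2 * p ω) fun ω => by omega)
        obtain ⟨l, hl⟩ := q₂.trans (PolyLE.of_le (t := fun ω => 2 * q ω + 1) fun ω => by omega)
        refine ⟨max k l, ?_⟩
        rintro (ω | ξ)
        · exact (hk ω).trans (Nat.pow_le_pow_right (by simp) (le_max_left _ _))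
        · exact (hl ξ).trans (Nat.pow_le_pow_right (by simp) (le_max_right _ _))

theorem isSPG_prod_aux [Finite Ω] (q : Ξ ≃ ℕ) (h₁ : PolyLE (fun ξ => q ξ) t)
    (h₂ : PolyLE t (fun ξ => q ξ)) : IsSPG (fun x : Ω × Ξ => s x.1 + t x.2) := by
  rcases isEmpty_or_nonempty Ω with h | h
  · exact Or.inl inferInstance
  obtain ⟨n, ⟨e⟩⟩ := Finite.exists_equiv_fin Ω
  have hn : NeZero n := ⟨by rintro rfl; exact h.elim fun ω => (e ω).elim0⟩
  refine Or.inr ⟨((Equiv.prodComm Ω Ξ).trans (Equiv.prodCongr q e)).trans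
    (Nat.divModEquiv n).symm, ?_, ?_⟩
  · have h1 : PolyLE (fun x : Ω × Ξ => q x.2 * n + n) (fun x => s x.1 + t x.2) :=
      (((h₁.comp Prod.snd).mul (PolyLE.const n)).add (PolyLE.const n)).trans
        (PolyLE.of_le fun x => by simp)
    refine (PolyLE.of_le fun x => ?_).trans h1
    have := (e x.1).isLt
    simp [Nat.divModEquiv]
  · refine PolyLE.trans (t := fun x : Ω × Ξ => q x.2)
      (PolyLE.add ?_ (h₂.comp Prod.snd)) (PolyLE.of_le fun x => ?_)
    · obtain ⟨c, hc⟩ := (Set.finite_range s).bddAbove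
      exact (PolyLE.of_le (t := fun _ => c) fun x : Ω × Ξ => hc ⟨x.1, rfl⟩).trans (PolyLE.const c)
    · have : 1 ≤ n := Nat.one_le_iff_ne_zero.2 hn.out
      simp [Nat.divModEquiv]
      nlinarith [Nat.zero_le (q x.2), Nat.zero_le (e x.1 : ℕ)]

theorem IsSPG.prod (hs : IsSPG s) (ht : IsSPG t) : IsSPG (fun x : Ω × Ξ => s x.1 + t x.2) := by
  rcases hs with hs | ⟨p, p₁, p₂⟩
  · rcases ht with ht | ⟨q, q₁, q₂⟩
    · exact Or.inl inferInstance
    · exact isSPG_prod_aux q q₁ q₂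
  · rcases ht with ht | ⟨q, q₁, q₂⟩
    · have h := (isSPG_prod_aux (s := t) p p₁ p₂).comp_equiv (Equiv.prodComm Ω Ξ)
      convert h using 1
      funext x
      exact add_comm _ _
    · refine Or.inr ⟨(Equiv.prodCongr p q).trans Nat.pairEquiv, ?_, ?_⟩
      · have h1 : PolyLE (fun x : Ω × Ξ => p x.1 + q x.2 + 1) (fun x => s x.1 + t x.2) :=
          (((p₁.comp Prod.fst).trans (PolyLE.of_le fun x => by simp)).add
            ((q₁.comp Prod.snd).trans (PolyLE.of_le fun x => by simp))).add (PolyLE.const 1)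
        refine (PolyLE.of_le fun x => ?_).trans (h1.mul h1)
        refine (Nat.pair_lt_max_add_one_sq (p x.1) (q x.2)).le.trans ?_
        rw [sq]
        exact Nat.mul_self_le_mul_self (by omega)
      · exact PolyLE.add
          ((p₂.comp Prod.fst).trans (PolyLE.of_le fun x => Nat.left_le_pair _ _))
          ((q₂.comp Prod.snd).trans (PolyLE.of_le fun x => Nat.right_le_pair _ _))

end Constructions

/-- A (finite or infinite) set of polynomial growth. -/
class SPG (Ω : Type) where
  size : Ω → ℕ
  isSPG : IsSPG size

open SPG (size)

instance : SPG ℕ :=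
  ⟨id, Or.inr ⟨Equiv.refl ℕ, PolyLE.of_le fun _ => le_rfl, PolyLE.of_le fun _ => le_rfl⟩⟩

instance (n : ℕ) : SPG (Fin n) := ⟨fun _ => 0, Or.inl inferInstance⟩

instance : SPG Unit := ⟨fun _ => 0, Or.inl inferInstance⟩

instance {Ω Ξ : Type} [SPG Ω] [SPG Ξ] : SPG (Ω ⊕ Ξ) :=
  ⟨Sum.elim size size, SPG.isSPG.sum SPG.isSPG⟩

instance {Ω Ξ : Type} [SPG Ω] [SPG Ξ] : SPG (Ω × Ξ) :=
  ⟨fun x => size x.1 + size x.2, SPG.isSPG.prod SPG.isSPG⟩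

/-- The (not necessarily isomorphic) relabelings: `r` is an isomorphism of sets of polynomial growth
onto its image, and `Ω'` decomposes into this image and its complement. -/
structure IsRelabeling {Ω Ω' : Type} [SPG Ω] [SPG Ω'] (r : Ω → Ω') : Prop where
  injective : Function.Injective r
  size_le : PolyLE (fun ω => size (r ω)) size
  le_size : PolyLE size (fun ω => size (r ω))
  compl : IsSPG (fun x : {x : Ω' // x ∉ Set.range r} => size x.1)

/-! ### Polymetric rings -/

/-- A polymetric ring: the topology of the (not necessarily unital) ring `𝔄` is induced by the
family `seminorms` of functions `p` with `p 0 = 0`, `p (-x) = p x`, `p (x + y) ≤ p x + p y`, and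
every `p` in the family has some `q` in the family with `p (x * y) ≤ q x * q y`. -/
class PolymetricRing (𝔄 : Type u) [NonUnitalRing 𝔄] [TopologicalSpace 𝔄] where
  seminorms : Set (AddGroupSeminorm 𝔄)
  nhds_eq : ∀ x : 𝔄, 𝓝 x = ⨅ p ∈ seminorms, comap (fun y => p (y - x)) (𝓝 (0 : ℝ))
  mul_le : ∀ p ∈ seminorms, ∃ q ∈ seminorms, ∀ x y, p (x * y) ≤ q x * q y

open PolymetricRing (seminorms)

/-- Every Cauchy sequence of the polymetric ring `𝔄` converges. -/
def SeqComplete (𝔄 : Type u) [NonUnitalRing 𝔄] [TopologicalSpace 𝔄] [PolymetricRing 𝔄] : Prop :=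
  ∀ a : ℕ → 𝔄,
    (∀ p ∈ seminorms (𝔄 := 𝔄), ∀ ε : ℝ, 0 < ε → ∃ N, ∀ m ≥ N, ∀ n ≥ N, p (a m - a n) < ε) →
      ∃ x, Tendsto a atTop (𝓝 x)

/-- The unital extension `ℤ ⊕ 𝔄`. -/
abbrev Plus (𝔄 : Type u) : Type u := Unitization ℤ 𝔄

/-- The product topology on `ℤ ⊕ 𝔄`, where `ℤ` is discrete. -/
instance (𝔄 : Type u) [TopologicalSpace 𝔄] : TopologicalSpace (Plus 𝔄) :=
  TopologicalSpace.induced (fun x => (x.fst, x.snd)) inferInstance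

/-! ### Infinite matrices -/

section Matrices

variable {R : Type u} [Ring R] {Ω Ω' Ω'' Ξ Ξ' : Type}

/-- The product of possibly infinite matrices. -/
noncomputable def mmul [TopologicalSpace R] (M : Matrix Ω Ω' R) (N : Matrix Ω' Ω'' R) :
    Matrix Ω Ω'' R :=
  fun i j => ∑' k, M i k * N k j

infixl:70 " ⬝ₘ " => mmul

open Classical in
/-- The matrix `∑ ω, e_{r ω, ω}` of a map `r`. -/
noncomputable def hat (r : Ω → Ω') : Matrix Ω' Ω R :=
  fun i j => if i = r j then 1 else 0

/-- The unit matrix `1_Ω`. -/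
noncomputable def idm : Matrix Ω Ω R := hat id

/-- Relabeling by `r`: the entry of `M` at `(n, m)` is moved to `(r n, r m)`. -/
noncomputable def relabel [TopologicalSpace R] (r : Ω → Ω') (M : Matrix Ω Ω R) : Matrix Ω' Ω' R :=
  hat r ⬝ₘ M ⬝ₘ (hat r).transpose

/-- The `{0,1} × Ω` block matrix with diagonal blocks `M`, `N`. -/
def diag2 (M N : Matrix Ω Ω R) : Matrix (Fin 2 × Ω) (Fin 2 × Ω) R :=
  fun x y => if x.1 = y.1 then (if x.1 = 0 then M x.2 y.2 else N x.2 y.2) else 0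

/-- The partial switch `sw₀₁(a)`: the `{0,1} × Ω` block matrix with diagonal blocks `1 - a` and
off-diagonal blocks `a`. -/
noncomputable def sw (a : Matrix Ω Ω R) : Matrix (Fin 2 × Ω) (Fin 2 × Ω) R :=
  fun x y => if x.1 = y.1 then ((idm : Matrix Ω Ω R) - a) x.2 y.2 else a x.2 y.2

/-- The tensor product of matrices over `R`. -/
def tens (M : Matrix Ω Ω' R) (N : Matrix Ξ Ξ' R) : Matrix (Ω × Ξ) (Ω' × Ξ') R :=
  fun x y => M x.1 y.1 * N x.2 y.2

end Matrices

/-! ### Pairs of matrices and the natural operations on them -/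

/-- A pair `⟨b, a⟩` of `Ω × Ω` matrices, with leading term `b` and base term `a`. -/
@[ext]
structure MPair (Ω : Type) (R : Type u) where
  lead : Matrix Ω Ω R
  base : Matrix Ω Ω R

namespace MPair

variable {R : Type u} [Ring R] {Ω Ω' Ξ : Type}

/-- `⟨b, a⟩ ⊕ ⟨d, c⟩ = ⟨b ⊕ d, a ⊕ c⟩`. -/
def osum (x : MPair Ω R) (y : MPair Ξ R) : MPair (Ω ⊕ Ξ) R :=
  ⟨Matrix.fromBlocks x.lead 0 0 y.lead, Matrix.fromBlocks x.base 0 0 y.base⟩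

/-- `⟨b, a⟩ ↦ ⟨1 - b, 1 - a⟩`. -/
noncomputable def inv (x : MPair Ω R) : MPair Ω R :=
  ⟨idm - x.lead, idm - x.base⟩

/-- Which of the two products of pairs is used. -/
inductive Side
  | left
  | right

/-- The two products of the pairs `⟨b, a⟩` and `⟨d, c⟩`: the left one is
`⟨b ⊗ d + (1 - b) ⊗ c, a ⊗ d + (1 - a) ⊗ c⟩`, and the right one is
`⟨b ⊗ d + a ⊗ (1 - d), b ⊗ c + a ⊗ (1 - c)⟩`. -/
noncomputable def oprod : Side → MPair Ω R → MPair Ξ R → MPair (Ω × Ξ) R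
  | .left, x, y =>
    ⟨tens x.lead y.lead + tens (idm - x.lead) y.base,
      tens x.base y.lead + tens (idm - x.base) y.base⟩
  | .right, x, y =>
    ⟨tens x.lead y.lead + tens x.base (idm - y.lead),
      tens x.lead y.base + tens x.base (idm - y.base)⟩

/-- The trivial regular pair `R0_Ω = ⟨0 ⊕ 1, 0 ⊕ 1⟩`. -/
noncomputable def reg0 (Ω : Type) (R : Type u) [Ring R] : MPair (Fin 2 × Ω) R :=
  ⟨diag2 0 idm, diag2 0 idm⟩

/-- The regularization `⟨sw₀₁(a) (b ⊕ (1 - a)) sw₀₁(a), 0 ⊕ 1⟩` of `⟨b, a⟩`. -/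
noncomputable def reg [TopologicalSpace R] (x : MPair Ω R) : MPair (Fin 2 × Ω) R :=
  ⟨sw x.base ⬝ₘ diag2 x.lead (idm - x.base) ⬝ₘ sw x.base, (reg0 Ω R).base⟩

/-- Relabeling of both components. -/
noncomputable def relabelPair [TopologicalSpace R] (r : Ω → Ω') (x : MPair Ω R) : MPair Ω' R :=
  ⟨relabel r x.lead, relabel r x.base⟩

end MPair

/-! ### Rapidly decreasing matrices, the Grassmannian, and the unit group -/

section Spaces

variable (𝔄 : Type u) [NonUnitalCommRing 𝔄] [TopologicalSpace 𝔄] [PolymetricRing 𝔄]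

/-- The matrix `M` over `𝔄⁺` lies in `𝒦_{Ω',Ω}(𝔄)`: its entries lie in `𝔄`, and they are rapidly
decreasing with respect to each seminorm. -/
def IsRapid {Ω' Ω : Type} [SPG Ω'] [SPG Ω] (M : Matrix Ω' Ω (Plus 𝔄)) : Prop :=
  (∀ i j, (M i j).fst = 0) ∧
    ∀ p ∈ seminorms (𝔄 := 𝔄), ∀ k : ℕ, ∃ C : ℝ, ∀ i j,
      p (M i j).snd * (((size i : ℝ) + 1) * ((size j : ℝ) + 1)) ^ k ≤ C

/-- The index set `{0,1} × ℕ` of the Grassmannian. -/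
abbrev GIdx : Type := Fin 2 × ℕ

/-- The index set `{0,1} × {0,1} × ℕ` of the conjugating matrices. -/
abbrev SIdx : Type := Fin 2 × Fin 2 × ℕ

/-- The standard single-space Grassmannian `𝒢_ℕ(𝔄)`: the pairs `⟨b, R0_ℕ⟩` where `b` is idempotent
and `b - R0_ℕ` is rapidly decreasing. -/
structure IsGrass (x : MPair GIdx (Plus 𝔄)) : Prop where
  base_eq : x.base = (MPair.reg0 ℕ (Plus 𝔄)).base
  idem : x.lead ⬝ₘ x.lead = x.lead
  rapid : IsRapid 𝔄 (x.lead - x.base)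

/-- The Grassmannian as a type. -/
abbrev Grass : Type u := {x : MPair GIdx (Plus 𝔄) // IsGrass 𝔄 x}

/-- The unit group `𝒦_Ω(𝔄)^⋆`: the invertible matrices `1 + A` with `A ∈ 𝒦_Ω(𝔄)`, together with
their inverse. (The inverse `B` of `1 + A` has the same form, as `B = 1 - A + A * B * A`.) -/
structure KUnit (Ω : Type) [SPG Ω] where
  val : Matrix Ω Ω (Plus 𝔄)
  inv : Matrix Ω Ω (Plus 𝔄)
  val_rapid : IsRapid 𝔄 (val - idm)
  inv_rapid : IsRapid 𝔄 (inv - idm)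
  val_inv : val ⬝ₘ inv = idm
  inv_val : inv ⬝ₘ val = idm

variable {𝔄}

/-- The leading term of `x ⊕ R0_ℕ` as a `{0,1} × {0,1} × ℕ` matrix. -/
noncomputable def stab (x : MPair GIdx (Plus 𝔄)) : Matrix SIdx SIdx (Plus 𝔄) :=
  diag2 x.lead (MPair.reg0 ℕ (Plus 𝔄)).lead

/-- `g` conjugates `x ⊕ R0_ℕ` into `y ⊕ R0_ℕ` (the base terms are the same and are conjugated by the
unit matrix). -/
def Conjugates (g : KUnit 𝔄 SIdx) (x y : MPair GIdx (Plus 𝔄)) : Prop :=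
  g.val ⬝ₘ stab x ⬝ₘ g.inv = stab y

end Spaces

/-! ### Polynomial maps -/

/-- The initial data of a polynomial construction depending on a parameter in `X`: matrix valued
maps on `X` of the two relevant shapes, and constants from the ring. -/
structure PolyData (X : Type v) (R : Type u) where
  small : Set (X → Matrix GIdx GIdx R) := ∅
  big : Set (X → Matrix SIdx SIdx R) := ∅
  scalar : Set R := ∅

/-- The matrix valued maps on `X` which are assembled polynomially from the data `D`: they are
obtained in finitely many steps from the data and from constant relabeling matrices (and the
transposes of these) by sums, differences, products and tensor products of matrices. -/
inductive IsPoly {X : Type v} {R : Type u} [Ring R] [TopologicalSpace R] (D : PolyData X R) :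
    {Ω Ω' : Type} → [SPG Ω] → [SPG Ω'] → (X → Matrix Ω Ω' R) → Prop
  | small (f : X → Matrix GIdx GIdx R) (hf : f ∈ D.small) : IsPoly D f
  | big (f : X → Matrix SIdx SIdx R) (hf : f ∈ D.big) : IsPoly D f
  | scalar (c : R) (hc : c ∈ D.scalar) : IsPoly D (fun _ => fun (_ _ : Unit) => c)
  | relabeling {Ω Ω' : Type} [SPG Ω] [SPG Ω'] (r : Ω → Ω') (hr : IsRelabeling r) :
      IsPoly D (fun _ => (hat r : Matrix Ω' Ω R))
  | relabelingT {Ω Ω' : Type} [SPG Ω] [SPG Ω'] (r : Ω → Ω') (hr : IsRelabeling r) :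
      IsPoly D (fun _ => (hat r : Matrix Ω' Ω R).transpose)
  | add {Ω Ω' : Type} [SPG Ω] [SPG Ω'] {f g : X → Matrix Ω Ω' R} (hf : IsPoly D f)
      (hg : IsPoly D g) : IsPoly D (fun x => f x + g x)
  | sub {Ω Ω' : Type} [SPG Ω] [SPG Ω'] {f g : X → Matrix Ω Ω' R} (hf : IsPoly D f)
      (hg : IsPoly D g) : IsPoly D (fun x => f x - g x)
  | mul {Ω Ω' Ω'' : Type} [SPG Ω] [SPG Ω'] [SPG Ω''] {f : X → Matrix Ω Ω' R}
      {g : X → Matrix Ω' Ω'' R} (hf : IsPoly D f) (hg : IsPoly D g) :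
      IsPoly D (fun x => f x ⬝ₘ g x)
  | tens {Ω Ω' Ξ Ξ' : Type} [SPG Ω] [SPG Ω'] [SPG Ξ] [SPG Ξ'] {f : X → Matrix Ω Ω' R}
      {g : X → Matrix Ξ Ξ' R} (hf : IsPoly D f) (hg : IsPoly D g) :
      IsPoly D (fun x => tens (f x) (g x))

/-! ### Strong polynomial algebraic homotopies and H-rings -/

section HRing

variable {𝔄 : Type u} [NonUnitalCommRing 𝔄] [TopologicalSpace 𝔄] [PolymetricRing 𝔄]

/-- The maps `f₁`, `f₂` into the Grassmannian are algebraically homotopic through a map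
`g : X → 𝒦_{{0,1}×{0,1}×ℕ}(𝔄)^⋆` which conjugates `f₂ ⊕ R0_ℕ` into `f₁ ⊕ R0_ℕ` and which is, just as
its inverse, assembled polynomially from the data `D`. -/
def StrongHomotopic {X : Type u} (D : PolyData X (Plus 𝔄)) (f₁ f₂ : X → MPair GIdx (Plus 𝔄)) :
    Prop :=
  ∃ g : X → KUnit 𝔄 SIdx, IsPoly D (fun x => (g x).val) ∧ IsPoly D (fun x => (g x).inv) ∧
    ∀ x, Conjugates (g x) (f₂ x) (f₁ x)

variable (𝔄) in
/-- The data for identities in `n` variables: the `n` variables themselves. -/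
def varData (n : ℕ) : PolyData (Fin n → Grass 𝔄) (Plus 𝔄) where
  small := Set.range fun i x => (x i).1.lead

variable (𝔄) in
/-- The data for an identity in one variable and with a constant `e ∈ 𝔄`. -/
def varScalarData (e : 𝔄) : PolyData (Fin 1 → Grass 𝔄) (Plus 𝔄) where
  small := (varData 𝔄 1).small
  scalar := {(e : Plus 𝔄)}

variable (𝔄) in
/-- Two points of the Grassmannian with a conjugating unit that makes them homotopic. Two
homotopic maps `X → 𝒢_ℕ(𝔄)` with a homotopy between them are the same as a map from `X` to this
type. -/
structure HomotopicPair where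
  fst : Grass 𝔄
  snd : Grass 𝔄
  unit : KUnit 𝔄 SIdx
  conj : Conjugates unit snd.1 fst.1

variable (𝔄) in
/-- The data for compatibility in `n` variables: for each variable the two homotopic points, and
the conjugating unit with its inverse. -/
def compatData (n : ℕ) : PolyData (Fin n → HomotopicPair 𝔄) (Plus 𝔄) where
  small := (Set.range fun i x => (x i).fst.1.lead) ∪ (Set.range fun i x => (x i).snd.1.lead)
  big := (Set.range fun i x => (x i).unit.val) ∪ (Set.range fun i x => (x i).unit.inv)

variable (𝔄) in
/-- `𝒢_ℕ(𝔄)` with the given operations is a commutative strong polynomial algebraic H-ring: it is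
closed under the operations, the identities of a commutative ring hold up to strong polynomial
algebraic homotopy, and so does the compatibility of the operations with homotopy. -/
structure IsStrongPolyHRing (add : MPair GIdx (Plus 𝔄) → MPair GIdx (Plus 𝔄) → MPair GIdx (Plus 𝔄))
    (neg : MPair GIdx (Plus 𝔄) → MPair GIdx (Plus 𝔄)) (zero : MPair GIdx (Plus 𝔄))
    (mul : MPair GIdx (Plus 𝔄) → MPair GIdx (Plus 𝔄) → MPair GIdx (Plus 𝔄)) : Prop where
  add_mem : ∀ x y, IsGrass 𝔄 x → IsGrass 𝔄 y → IsGrass 𝔄 (add x y)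
  neg_mem : ∀ x, IsGrass 𝔄 x → IsGrass 𝔄 (neg x)
  zero_mem : IsGrass 𝔄 zero
  mul_mem : ∀ x y, IsGrass 𝔄 x → IsGrass 𝔄 y → IsGrass 𝔄 (mul x y)
  add_assoc : StrongHomotopic (varData 𝔄 3)
    (fun x => add (add (x 0).1 (x 1).1) (x 2).1) (fun x => add (x 0).1 (add (x 1).1 (x 2).1))
  add_comm : StrongHomotopic (varData 𝔄 2)
    (fun x => add (x 0).1 (x 1).1) (fun x => add (x 1).1 (x 0).1)
  add_zero : StrongHomotopic (varData 𝔄 1) (fun x => add (x 0).1 zero) (fun x => (x 0).1)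
  zero_add : StrongHomotopic (varData 𝔄 1) (fun x => add zero (x 0).1) (fun x => (x 0).1)
  add_neg : StrongHomotopic (varData 𝔄 1) (fun x => add (x 0).1 (neg (x 0).1)) (fun _ => zero)
  neg_add : StrongHomotopic (varData 𝔄 1) (fun x => add (neg (x 0).1) (x 0).1) (fun _ => zero)
  mul_assoc : StrongHomotopic (varData 𝔄 3)
    (fun x => mul (mul (x 0).1 (x 1).1) (x 2).1) (fun x => mul (x 0).1 (mul (x 1).1 (x 2).1))
  mul_comm : StrongHomotopic (varData 𝔄 2)
    (fun x => mul (x 0).1 (x 1).1) (fun x => mul (x 1).1 (x 0).1)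
  mul_add : StrongHomotopic (varData 𝔄 3)
    (fun x => mul (x 0).1 (add (x 1).1 (x 2).1))
    (fun x => add (mul (x 0).1 (x 1).1) (mul (x 0).1 (x 2).1))
  add_mul : StrongHomotopic (varData 𝔄 3)
    (fun x => mul (add (x 0).1 (x 1).1) (x 2).1)
    (fun x => add (mul (x 0).1 (x 2).1) (mul (x 1).1 (x 2).1))
  add_compat : StrongHomotopic (compatData 𝔄 2)
    (fun x => add (x 0).fst.1 (x 1).fst.1) (fun x => add (x 0).snd.1 (x 1).snd.1)
  neg_compat : StrongHomotopic (compatData 𝔄 1)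
    (fun x => neg (x 0).fst.1) (fun x => neg (x 0).snd.1)
  mul_compat : StrongHomotopic (compatData 𝔄 2)
    (fun x => mul (x 0).fst.1 (x 1).fst.1) (fun x => mul (x 0).snd.1 (x 1).snd.1)

/-- `one` is a unit element, up to strong polynomial algebraic homotopy, for `mul` on `𝒢_ℕ(𝔄)`,
where `e` is the unit element of `𝔄`. -/
structure IsStrongPolyUnit (e : 𝔄)
    (mul : MPair GIdx (Plus 𝔄) → MPair GIdx (Plus 𝔄) → MPair GIdx (Plus 𝔄))
    (one : MPair GIdx (Plus 𝔄)) : Prop where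
  one_mem : IsGrass 𝔄 one
  mul_one : StrongHomotopic (varScalarData 𝔄 e) (fun x => mul (x 0).1 one) (fun x => (x 0).1)
  one_mul : StrongHomotopic (varScalarData 𝔄 e) (fun x => mul one (x 0).1) (fun x => (x 0).1)

/-! The operations of the single-space Grassmannian, for fixed relabelings. -/

/-- `x + y := R θ_*(x ⊕ y)`. -/
noncomputable def gAdd (θ : GIdx ⊕ GIdx → ℕ) (x y : MPair GIdx (Plus 𝔄)) : MPair GIdx (Plus 𝔄) :=
  ((x.osum y).relabelPair θ).reg

/-- `-x := R θ_*(x^inv)`. -/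
noncomputable def gNeg (θ : GIdx → ℕ) (x : MPair GIdx (Plus 𝔄)) : MPair GIdx (Plus 𝔄) :=
  (x.inv.relabelPair θ).reg

variable (𝔄) in
/-- `0 := R0_ℕ`. -/
noncomputable def gZero : MPair GIdx (Plus 𝔄) :=
  MPair.reg0 ℕ (Plus 𝔄)

/-- `x * y := R θ_*(x ⊗ y)`. -/
noncomputable def gMul (s : MPair.Side) (θ : GIdx × GIdx → ℕ) (x y : MPair GIdx (Plus 𝔄)) :
    MPair GIdx (Plus 𝔄) :=
  ((MPair.oprod s x y).relabelPair θ).reg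

/-- `1 := R θ_*⟨e, 0⟩`, for `1 × 1` matrices, where `e` is the unit element of `𝔄`. -/
noncomputable def gOne (θ : Unit → ℕ) (e : 𝔄) : MPair GIdx (Plus 𝔄) :=
  ((⟨fun _ _ => (e : Plus 𝔄), 0⟩ : MPair Unit (Plus 𝔄)).relabelPair θ).reg

end HRing

end Polymetric

open Polymetric

set_option linter.unusedSectionVars false

/-! A pair `⟨b, a⟩` of idempotents with `b - a` rapidly decreasing stands for the virtual class `[b]
- [a]`. Such pairs, over arbitrary index sets, carry a coarse stable equivalence `Eqv`. It is
generated by conjugating the leading term by a unit in `1 + 𝒦` with the base fixed, and by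
extensions: embedding isometrically and adding one idempotent to both terms. Relabeling and
regularization are extensions (`Eqv.relabel`, `Eqv.reg`), so the operations of the Grassmannian may
be replaced by the bare `⊕`, `inv` and `⊗`, and the choice of relabelings becomes irrelevant.

For the bare operations most identities are permutations of blocks. The others need an argument. `x
⊕ x.inv` is trivial because the partial switch of an idempotent `c` conjugates `c ⊕ (1 - c)` into `0
⊕ 1` (`Eqv.osum_inv`). The two products agree because, after adding trivial pairs, their terms are
Murray–von Neumann equivalent through partial isometries that agree modulo rapidly decreasing
matrices (`Eqv.prodL_prodR`). The swap of factors exchanges the two products, so this also gives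
commutativity. Neutrality of `⟨e, 0⟩` rests on the vanishing of `1 - e` against `𝔄`
(`Eqv.prodL_scalar`).

The bridge back to strong homotopy is `Eqv.hom`. Every pair in a chain of equivalences is carried by
an isometry `u`, `v` to `gBase + u (b - a) v`, over the fixed base term `gBase`. Two such isometries
give results conjugate after a single stabilization (`Hom.of_isIso`). This follows from
`Hom.of_partial`: a product of elementary matrices performs the conjugation, but is not of the form
`1 + 𝒦`; it is corrected by a second product of elementary matrices, which agrees with the first
modulo rapidly decreasing matrices and commutes with the matrix to be conjugated.

The analysis is confined to the fact that tame matrices, which have polynomially controlled rows and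
columns, compose associatively, with the rapidly decreasing ones as an ideal. Sequential
completeness makes the products converge. Polynomiality costs nothing, since all constructions take
place in `PMat`, whose elements carry a proof of being assembled polynomially. -/

namespace Polymetric

open _root_.Polymetric.SPG (size)
open _root_.Polymetric.PolymetricRing (seminorms)

/-! ### Seminorms, convergence and summability in the unital extension. -/

section Gauge

variable {𝔄 : Type u} [NonUnitalCommRing 𝔄] [TopologicalSpace 𝔄] [PolymetricRing 𝔄]

theorem plus_fst_sub (x y : Plus 𝔄) : (x - y).fst = x.fst - y.fst := rfl

theorem plus_snd_sub (x y : Plus 𝔄) : (x - y).snd = x.snd - y.snd := rfl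

/-- The extension of a finite sum of seminorms of the family to `ℤ ⊕ 𝔄`. -/
noncomputable def gauge (L : List (seminorms (𝔄 := 𝔄))) (x : Plus 𝔄) : ℝ :=
  |(x.fst : ℝ)| + (L.map fun p => p.1 x.snd).sum

theorem listSum_nonneg (L : List (seminorms (𝔄 := 𝔄))) (x : 𝔄) :
    0 ≤ (L.map fun p => p.1 x).sum :=
  List.sum_nonneg (by
    intro y hy
    obtain ⟨p, -, rfl⟩ := List.mem_map.1 hy
    exact apply_nonneg p.1 x)

theorem gauge_nonneg (L : List (seminorms (𝔄 := 𝔄))) (x : Plus 𝔄) : 0 ≤ gauge L x :=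
  add_nonneg (abs_nonneg _) (listSum_nonneg L _)

theorem gauge_zero (L : List (seminorms (𝔄 := 𝔄))) : gauge L 0 = 0 := by
  induction L with
  | nil => simp [gauge]
  | cons p L ih => simp [gauge]

theorem gauge_one (L : List (seminorms (𝔄 := 𝔄))) : gauge L 1 = 1 := by
  induction L with
  | nil => simp [gauge]
  | cons p L ih => simp [gauge]

theorem gauge_neg (L : List (seminorms (𝔄 := 𝔄))) (x : Plus 𝔄) : gauge L (-x) = gauge L x := by
  simp [gauge]

theorem gauge_cons (p : seminorms (𝔄 := 𝔄)) (L : List (seminorms (𝔄 := 𝔄))) (x : Plus 𝔄) :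
    gauge (p :: L) x = gauge L x + p.1 x.snd := by
  simp [gauge]; ring

theorem gauge_add_le (L : List (seminorms (𝔄 := 𝔄))) (x y : Plus 𝔄) :
    gauge L (x + y) ≤ gauge L x + gauge L y := by
  induction L with
  | nil =>
    have := abs_add_le (x.fst : ℝ) y.fst
    simpa [gauge] using this
  | cons p L ih =>
    have := map_add_le_add p.1 x.snd y.snd
    rw [gauge_cons, gauge_cons, gauge_cons, Unitization.snd_add]
    linarith

theorem gauge_sub_le (L : List (seminorms (𝔄 := 𝔄))) (x y : Plus 𝔄) :
    gauge L (x - y) ≤ gauge L x + gauge L y := by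
  simpa [sub_eq_add_neg, gauge_neg] using gauge_add_le L x (-y)

theorem gauge_sum_le {ι : Type*} (L : List (seminorms (𝔄 := 𝔄))) (s : Finset ι)
    (f : ι → Plus 𝔄) : gauge L (∑ i ∈ s, f i) ≤ ∑ i ∈ s, gauge L (f i) := by
  classical
  induction s using Finset.induction_on with
  | empty => simp [gauge_zero]
  | insert a s ha ih =>
    rw [Finset.sum_insert ha, Finset.sum_insert ha]
    exact (gauge_add_le L _ _).trans (by linarith)

theorem seminorm_zsmul_le (p : AddGroupSeminorm 𝔄) (n : ℤ) (x : 𝔄) :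
    p (n • x) ≤ |(n : ℝ)| * p x := by
  have key : ∀ k : ℕ, p (k • x) ≤ k * p x := by
    intro k
    induction k with
    | zero => simp
    | succ k ih =>
      rw [succ_nsmul]
      have := map_add_le_add p (k • x) x
      push_cast
      linarith
  rcases Int.natAbs_eq n with h | h
  · rw [h, natCast_zsmul]
    simpa using key n.natAbs
  · rw [h, neg_zsmul, map_neg_eq_map, natCast_zsmul]
    simpa using key n.natAbs

theorem gauge_mul_le (L : List (seminorms (𝔄 := 𝔄))) :
    ∃ M, ∀ x y : Plus 𝔄, gauge L (x * y) ≤ gauge M x * gauge M y := by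
  induction L with
  | nil => exact ⟨[], fun x y => by simp [gauge, abs_mul]⟩
  | cons p L ih =>
    obtain ⟨M, hM⟩ := ih
    obtain ⟨q, hq, hpq⟩ := PolymetricRing.mul_le p.1 p.2
    -- The mixed terms, integer times element of `𝔄`, are bounded with `p` itself; only the product
    -- inside `𝔄` needs `q`.
    refine ⟨p :: ⟨q, hq⟩ :: M, fun x y => ?_⟩
    have h1 := hM x y
    have h2 : p.1 (x * y).snd ≤
        |(x.fst : ℝ)| * p.1 y.snd + |(y.fst : ℝ)| * p.1 x.snd + q x.snd * q y.snd := by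
      rw [Unitization.snd_mul]
      refine (map_add_le_add p.1 _ _).trans (add_le_add ((map_add_le_add p.1 _ _).trans
        (add_le_add (seminorm_zsmul_le _ _ _) (seminorm_zsmul_le _ _ _))) (hpq _ _))
    rw [gauge_cons, gauge_cons, gauge_cons, gauge_cons, gauge_cons]
    have hx := listSum_nonneg M x.snd
    have hy := listSum_nonneg M y.snd
    have a1 := apply_nonneg p.1 x.snd
    have a2 := apply_nonneg p.1 y.snd
    have a3 := apply_nonneg q x.snd
    have a4 := apply_nonneg q y.snd
    have a5 := abs_nonneg (x.fst : ℝ)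
    have a6 := abs_nonneg (y.fst : ℝ)
    simp only [gauge] at h1 ⊢
    generalize (M.map fun p => p.1 x.snd).sum = A at *
    generalize (M.map fun p => p.1 y.snd).sum = B at *
    generalize |(x.fst : ℝ)| = n at *
    generalize |(y.fst : ℝ)| = m at *
    generalize (p.1 x.snd) = p1 at *
    generalize (p.1 y.snd) = p2 at *
    generalize q x.snd = q1 at *
    generalize q y.snd = q2 at *
    have : 0 ≤ p1 * p2 + p1 * q2 + q1 * p2 + n * q2 + m * q1 + A * p2 + A * q2 + B * p1 + B * q1 := by
      positivity
    nlinarith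

theorem seminorm_le_gauge (p : seminorms (𝔄 := 𝔄)) (x : Plus 𝔄) : p.1 x.snd ≤ gauge [p] x := by
  have := abs_nonneg (x.fst : ℝ)
  simp only [gauge, List.map_cons, List.map_nil, List.sum_cons, List.sum_nil]
  linarith

/-- The gauge of the empty list detects the discrete component, and singletons detect the seminorms
of the family. -/
theorem tendsto_iff_gauge {ι : Type*} {l : Filter ι} {f : ι → Plus 𝔄} {x : Plus 𝔄} :
    Tendsto f l (𝓝 x) ↔ ∀ L : List (seminorms (𝔄 := 𝔄)),
      Tendsto (fun i => gauge L (f i - x)) l (𝓝 0) := by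
  have h0 : Tendsto f l (𝓝 x) ↔ Tendsto (fun i => (f i).fst) l (𝓝 x.fst) ∧
      Tendsto (fun i => (f i).snd) l (𝓝 x.snd) := by
    rw [nhds_induced, tendsto_comap_iff, nhds_prod_eq, tendsto_prod_iff']
    rfl
  have h1 : Tendsto (fun i => (f i).fst) l (𝓝 x.fst) ↔
      Tendsto (fun i => |(((f i).fst - x.fst : ℤ) : ℝ)|) l (𝓝 0) := by
    rw [tendsto_iff_dist_tendsto_zero]
    simp only [Int.dist_eq, Int.cast_sub]
  have h2 : Tendsto (fun i => (f i).snd) l (𝓝 x.snd) ↔ ∀ p : seminorms (𝔄 := 𝔄),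
      Tendsto (fun i => p.1 ((f i).snd - x.snd)) l (𝓝 0) := by
    rw [PolymetricRing.nhds_eq]
    simp only [tendsto_iInf, tendsto_comap_iff, Subtype.forall]
    rfl
  rw [h0, h1, h2]
  constructor
  · rintro ⟨h, h'⟩ L
    induction L with
    | nil => simpa [gauge, plus_fst_sub] using h
    | cons p L ih => simpa [gauge_cons, plus_snd_sub] using ih.add (h' p)
  · intro h
    refine ⟨by simpa [gauge, plus_fst_sub] using h [], fun p => ?_⟩
    exact squeeze_zero (fun i => apply_nonneg _ _)
      (fun i => seminorm_le_gauge p (f i - x)) (h [p])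

theorem tendsto_gauge {ι : Type*} {l : Filter ι} {f : ι → Plus 𝔄} {x : Plus 𝔄}
    (h : Tendsto f l (𝓝 x)) (L : List (seminorms (𝔄 := 𝔄))) :
    Tendsto (fun i => gauge L (f i)) l (𝓝 (gauge L x)) := by
  rw [tendsto_iff_dist_tendsto_zero]
  refine squeeze_zero (fun _ => dist_nonneg) (fun i => ?_) (tendsto_iff_gauge.1 h L)
  rw [Real.dist_eq, abs_sub_le_iff]
  have h1 := gauge_add_le L (f i - x) x
  have h2 := gauge_sub_le L (f i) (f i - x)
  simp only [sub_add_cancel, sub_sub_cancel] at h1 h2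
  constructor <;> linarith

instance : IsTopologicalRing (Plus 𝔄) where
  continuous_add := continuous_iff_continuousAt.2 fun ⟨x, y⟩ => by
    refine tendsto_iff_gauge.2 fun L => ?_
    have hx := tendsto_iff_gauge.1 (tendsto_fst (f := 𝓝 x) (g := 𝓝 y)) L
    have hy := tendsto_iff_gauge.1 (tendsto_snd (f := 𝓝 x) (g := 𝓝 y)) L
    rw [nhds_prod_eq]
    refine squeeze_zero (fun _ => gauge_nonneg _ _) (fun i => ?_) (by simpa using hx.add hy)
    have := gauge_add_le L (i.1 - x) (i.2 - y)
    rwa [sub_add_sub_comm] at this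
  continuous_mul := continuous_iff_continuousAt.2 fun ⟨x, y⟩ => by
    refine tendsto_iff_gauge.2 fun L => ?_
    obtain ⟨M, hM⟩ := gauge_mul_le L
    have hx := tendsto_iff_gauge.1 (tendsto_fst (f := 𝓝 x) (g := 𝓝 y)) M
    have hy := tendsto_iff_gauge.1 (tendsto_snd (f := 𝓝 x) (g := 𝓝 y)) M
    rw [nhds_prod_eq]
    have h := ((hx.mul hy).add (hx.mul_const (gauge M y))).add (hy.const_mul (gauge M x))
    refine squeeze_zero (fun _ => gauge_nonneg _ _) (fun i => ?_) (by simpa using h)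
    have e : i.1 * i.2 - x * y = (i.1 - x) * (i.2 - y) + (i.1 - x) * y + x * (i.2 - y) := by ring
    change gauge L (i.1 * i.2 - x * y) ≤ _
    rw [e]
    refine (gauge_add_le L _ _).trans (add_le_add ((gauge_add_le L _ _).trans
      (add_le_add (hM _ _) (hM _ _))) (hM _ _))
  continuous_neg := continuous_iff_continuousAt.2 fun x => by
    refine tendsto_iff_gauge.2 fun L => ?_
    have hx := tendsto_iff_gauge.1 (tendsto_id (x := 𝓝 x)) L
    refine hx.congr fun i => ?_
    rw [← gauge_neg L (-i - -x)]
    congr 1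
    simp; ring

instance [T2Space 𝔄] : T2Space (Plus 𝔄) :=
  T2Space.of_injective_continuous (f := fun x : Plus 𝔄 => (x.fst, x.snd))
    (fun _ _ h => Unitization.ext (congrArg Prod.fst h) (congrArg Prod.snd h))
    continuous_induced_dom

theorem continuous_plus_fst : Continuous (fun x : Plus 𝔄 => x.fst) :=
  continuous_fst.comp (continuous_induced_dom (f := fun x : Plus 𝔄 => (x.fst, x.snd)))

/-- Sequential completeness as a class. -/
class IsSeqComplete (𝔄 : Type u) [NonUnitalCommRing 𝔄] [TopologicalSpace 𝔄] [PolymetricRing 𝔄] :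
    Prop where
  out : SeqComplete 𝔄

theorem exists_tendsto_of_cauchy [IsSeqComplete 𝔄] (a : ℕ → Plus 𝔄)
    (ha : ∀ L : List (seminorms (𝔄 := 𝔄)), ∀ ε : ℝ, 0 < ε →
      ∃ N, ∀ m ≥ N, ∀ n ≥ N, gauge L (a m - a n) < ε) : ∃ x, Tendsto a atTop (𝓝 x) := by
  obtain ⟨x, hx⟩ := IsSeqComplete.out (𝔄 := 𝔄) (fun n => (a n).snd) (by
    intro p hp ε hε
    obtain ⟨N, hN⟩ := ha [⟨p, hp⟩] ε hε
    exact ⟨N, fun m hm n hn => lt_of_le_of_lt (seminorm_le_gauge ⟨p, hp⟩ (a m - a n))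
      (hN m hm n hn)⟩)
  -- For the empty list the gauge is the absolute value of the integer component, which is therefore
  -- constant from `N` on.
  obtain ⟨N, hN⟩ := ha [] 1 one_pos
  refine ⟨Unitization.inl (a N).fst + (x : Plus 𝔄), ?_⟩
  rw [nhds_induced, tendsto_comap_iff, nhds_prod_eq, tendsto_prod_iff']
  constructor
  · refine tendsto_const_nhds.congr' ?_
    filter_upwards [eventually_ge_atTop N] with m hm
    have := hN N le_rfl m hm
    simp only [gauge, List.map_nil, List.sum_nil, add_zero, plus_fst_sub] at this
    have h2 : |(a N).fst - (a m).fst| < 1 := by exact_mod_cast this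
    rw [Int.abs_lt_one_iff] at h2
    simp; omega
  · simpa using hx

/-- Only sequences are known to converge. Countability provides a cofinal sequence of finite sets;
the partial sums along it converge, and the Cauchy property of the whole net forces the same limit.
-/
theorem summable_of_gauge [IsSeqComplete 𝔄] {ι : Type*} [Countable ι] (f : ι → Plus 𝔄)
    (hf : ∀ L : List (seminorms (𝔄 := 𝔄)), Summable fun i => gauge L (f i)) : Summable f := by
  classical
  have hsmall : ∀ L : List (seminorms (𝔄 := 𝔄)), ∀ ε : ℝ, 0 < ε → ∃ s : Finset ι,
      ∀ t, Disjoint t s → gauge L (∑ i ∈ t, f i) < ε := by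
    intro L ε hε
    obtain ⟨s, hs⟩ := summable_iff_vanishing_norm.1 (hf L) ε hε
    refine ⟨s, fun t ht => ?_⟩
    have := hs t ht
    rw [Real.norm_of_nonneg (Finset.sum_nonneg fun i _ => gauge_nonneg _ _)] at this
    exact (gauge_sum_le L t f).trans_lt this
  obtain ⟨φ, hmono, hφ⟩ : ∃ φ : ℕ → Finset ι, Monotone φ ∧ Tendsto φ atTop atTop :=
    exists_seq_monotone_tendsto_atTop_atTop (Finset ι)
  have hdiff : ∀ L : List (seminorms (𝔄 := 𝔄)), ∀ ε : ℝ, 0 < ε → ∃ s : Finset ι,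
      ∀ t t', s ⊆ t → t ⊆ t' → gauge L (∑ i ∈ t', f i - ∑ i ∈ t, f i) < ε := by
    intro L ε hε
    obtain ⟨s, hs⟩ := hsmall L ε hε
    refine ⟨s, fun t t' h1 h2 => ?_⟩
    rw [← Finset.sum_sdiff h2, add_sub_cancel_right]
    exact hs _ (Finset.disjoint_of_subset_right h1 Finset.sdiff_disjoint)
  obtain ⟨x, hx⟩ := exists_tendsto_of_cauchy (fun n => ∑ i ∈ φ n, f i) (by
    intro L ε hε
    obtain ⟨s, hs⟩ := hdiff L ε hε
    obtain ⟨N, hN⟩ := eventually_atTop.1 (hφ.eventually_ge_atTop s)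
    refine ⟨N, fun m hm n hn => ?_⟩
    rcases le_total m n with h | h
    · rw [← gauge_neg, neg_sub]
      exact hs _ _ (hN m hm) (hmono h)
    · exact hs _ _ (hN n hn) (hmono h))
  refine ⟨x, ?_⟩
  change Tendsto _ _ _
  rw [SummationFilter.unconditional_filter]
  refine tendsto_iff_gauge.2 fun L => ?_
  rw [Metric.tendsto_nhds]
  intro ε hε
  obtain ⟨s, hs⟩ := hdiff L (ε / 2) (by linarith)
  filter_upwards [eventually_ge_atTop s] with t ht
  rw [Real.dist_eq, sub_zero, abs_of_nonneg (gauge_nonneg _ _)]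
  have h1 : gauge L (∑ i ∈ t, f i - x) ≤ ε / 2 := by
    have h2 := tendsto_gauge (hx.const_sub (∑ i ∈ t, f i)) L
    refine le_of_tendsto h2 ?_
    filter_upwards [hφ.eventually_ge_atTop t] with n hn
    rw [← gauge_neg, neg_sub]
    exact (hs _ _ ht hn).le
  linarith

theorem gauge_tsum_le {ι : Type*} {f : ι → Plus 𝔄} (hs : Summable f)
    (L : List (seminorms (𝔄 := 𝔄))) {g : ι → ℝ} (hfg : ∀ i, gauge L (f i) ≤ g i)
    (hg : Summable g) : gauge L (∑' i, f i) ≤ ∑' i, g i := by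
  have h := tendsto_gauge hs.hasSum L
  rw [SummationFilter.unconditional_filter] at h
  refine le_of_tendsto h (Eventually.of_forall fun s => ?_)
  exact (gauge_sum_le L s f).trans ((Finset.sum_le_sum fun i _ => hfg i).trans
    (hg.sum_le_tsum s fun i _ => (gauge_nonneg _ _).trans (hfg i)))

end Gauge

/-! ### Weights on sets of polynomial growth. -/

section Weights

variable {Ω Ξ : Type} [SPG Ω] [SPG Ξ]

/-- The weight of a point of a set of polynomial growth. -/
noncomputable def wt (i : Ω) : ℝ := (size i : ℝ) + 1

theorem one_le_wt (i : Ω) : 1 ≤ wt i := by simp [wt]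

theorem wt_pos (i : Ω) : 0 < wt i := zero_lt_one.trans_le (one_le_wt i)

theorem one_le_wt_pow (i : Ω) (k : ℕ) : 1 ≤ wt i ^ k := one_le_pow₀ (one_le_wt i)

theorem wt_pow_le (i : Ω) {k l : ℕ} (h : k ≤ l) : wt i ^ k ≤ wt i ^ l :=
  pow_le_pow_right₀ (one_le_wt i) h

theorem wt_prod_le (i : Ω) (j : Ξ) : wt (i, j) ≤ wt i * wt j := by
  have h : wt (i, j) = (size i : ℝ) + size j + 1 := by simp [wt, size]
  rw [h, wt, wt]
  nlinarith [Nat.cast_nonneg (α := ℝ) (size i), Nat.cast_nonneg (α := ℝ) (size j),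
    mul_nonneg (Nat.cast_nonneg (α := ℝ) (size i)) (Nat.cast_nonneg (α := ℝ) (size j))]

theorem wt_le_prod_left (i : Ω) (j : Ξ) : wt i ≤ wt (i, j) := by
  simp [wt, size]

theorem wt_le_prod_right (i : Ω) (j : Ξ) : wt j ≤ wt (i, j) := by
  simp [wt, size]

variable (Ω) in
-- The enumeration by `ℕ` is polynomially bounded by the size, so a high power of the weight
-- dominates the square of the enumeration.
theorem exists_summable_wt : ∃ m : ℕ, Summable fun j : Ω => (wt j ^ m)⁻¹ := by
  rcases SPG.isSPG (Ω := Ω) with h | ⟨q, ⟨k, hk⟩, -⟩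
  · exact ⟨0, Summable.of_finite⟩
  -- One extra factor turns the bound on `q j` into one on `q j + 1`; squaring it allows comparison
  -- with `∑ (n + 1)⁻²`.
  · refine ⟨2 * (k + 1), ?_⟩
    have h2 : Summable fun n : ℕ => (2 : ℝ) ^ (2 * (k + 1)) * (((n : ℝ) + 1) ^ 2)⁻¹ := by
      refine Summable.mul_left _ ?_
      have := (summable_nat_add_iff 1).2 (Real.summable_nat_pow_inv.2 one_lt_two)
      simpa using this
    refine Summable.of_nonneg_of_le (fun j => inv_nonneg.2 (pow_nonneg (wt_pos j).le _))
      (fun j => ?_) (h2.comp_injective q.injective)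
    have h3 : q j + 1 ≤ (size j + 2) ^ (k + 1) := by
      have := hk j
      have h1 : 1 ≤ (size j + 2) ^ k := Nat.one_le_pow _ _ (by omega)
      rw [pow_succ]
      dsimp only at this
      nlinarith
    have h4 : ((q j : ℝ) + 1) ≤ (2 * wt j) ^ (k + 1) := by
      have : ((q j : ℝ) + 1) ≤ ((size j : ℝ) + 2) ^ (k + 1) := by exact_mod_cast h3
      refine this.trans (pow_le_pow_left₀ (by positivity) ?_ _)
      simp only [wt]
      have := Nat.cast_nonneg (α := ℝ) (size j)
      linarith
    have h5 : ((q j : ℝ) + 1) ^ 2 ≤ 2 ^ (2 * (k + 1)) * wt j ^ (2 * (k + 1)) := by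
      rw [← mul_pow, mul_comm 2 (k + 1), pow_mul]
      exact pow_le_pow_left₀ (by positivity) h4 2
    have := wt_pos j
    have h6 : 0 < wt j ^ (2 * (k + 1)) := by positivity
    simp only [Function.comp]
    rw [← div_eq_mul_inv, inv_eq_one_div, div_le_div_iff₀ h6 (by positivity), one_mul]
    exact h5

theorem SPG.countable : Countable Ω := by
  rcases SPG.isSPG (Ω := Ω) with h | ⟨q, -⟩
  · exact Finite.to_countable
  · exact q.injective.countable

omit [SPG Ω] in
theorem PolyLE.exists_real_le {s t : Ω → ℕ} (h : PolyLE s t) :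
    ∃ k : ℕ, ∃ C : ℝ, 0 ≤ C ∧ ∀ i, (s i : ℝ) + 1 ≤ C * ((t i : ℝ) + 1) ^ k := by
  obtain ⟨k, hk⟩ := h
  refine ⟨k, 2 ^ k + 1, by positivity, fun i => ?_⟩
  have h1 : (s i : ℝ) ≤ ((t i : ℝ) + 2) ^ k := by exact_mod_cast hk i
  have h2 : ((t i : ℝ) + 2) ^ k ≤ (2 * ((t i : ℝ) + 1)) ^ k := by
    refine pow_le_pow_left₀ (by positivity) ?_ _
    have := Nat.cast_nonneg (α := ℝ) (t i)
    linarith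
  rw [mul_pow] at h2
  have : 1 ≤ ((t i : ℝ) + 1) ^ k := one_le_pow₀ (by simp)
  linarith

end Weights

/-! ### Tame matrices and the ideal of rapidly decreasing matrices. -/

section Tame

variable {𝔄 : Type u} [NonUnitalCommRing 𝔄] [TopologicalSpace 𝔄] [PolymetricRing 𝔄]
variable {Ω Ω' Ω'' Ω₃ Ξ Ξ' Ξ'' : Type} [SPG Ω] [SPG Ω'] [SPG Ω''] [SPG Ω₃] [SPG Ξ] [SPG Ξ'] [SPG Ξ'']

/-- The rows of the matrix are rapidly decreasing, polynomially in the row index. -/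
def RowTame (M : Matrix Ω Ω' (Plus 𝔄)) : Prop :=
  ∀ (L : List (seminorms (𝔄 := 𝔄))) (k : ℕ), ∃ l : ℕ, ∃ C : ℝ, 0 ≤ C ∧
    ∀ i j, gauge L (M i j) * wt j ^ k ≤ C * wt i ^ l

/-- Matrices which act on rapidly decreasing sequences from both sides. -/
structure IsTame (M : Matrix Ω Ω' (Plus 𝔄)) : Prop where
  row : RowTame M
  col : RowTame M.transpose

theorem RowTame.add {M N : Matrix Ω Ω' (Plus 𝔄)} (hM : RowTame M) (hN : RowTame N) :
    RowTame (M + N) := by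
  intro L k
  obtain ⟨l, C, hC, h⟩ := hM L k
  obtain ⟨l', C', hC', h'⟩ := hN L k
  refine ⟨l + l', C + C', add_nonneg hC hC', fun i j => ?_⟩
  have h1 := mul_le_mul_of_nonneg_right (gauge_add_le L (M i j) (N i j)) (pow_pos (wt_pos j) k).le
  have h2 := mul_le_mul_of_nonneg_left (wt_pow_le i (Nat.le_add_right l l')) hC
  have h3 := mul_le_mul_of_nonneg_left (wt_pow_le i (Nat.le_add_left l' l)) hC'
  have := h i j
  have := h' i j
  rw [Matrix.add_apply]
  linarith

theorem RowTame.neg {M : Matrix Ω Ω' (Plus 𝔄)} (hM : RowTame M) : RowTame (-M) := by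
  intro L k
  obtain ⟨l, C, hC, h⟩ := hM L k
  exact ⟨l, C, hC, fun i j => by rw [Matrix.neg_apply, gauge_neg]; exact h i j⟩

theorem IsTame.add {M N : Matrix Ω Ω' (Plus 𝔄)} (hM : IsTame M) (hN : IsTame N) :
    IsTame (M + N) := ⟨hM.row.add hN.row, hM.col.add hN.col⟩

theorem IsTame.neg {M : Matrix Ω Ω' (Plus 𝔄)} (hM : IsTame M) : IsTame (-M) :=
  ⟨hM.row.neg, hM.col.neg⟩

theorem IsTame.sub {M N : Matrix Ω Ω' (Plus 𝔄)} (hM : IsTame M) (hN : IsTame N) :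
    IsTame (M - N) := by
  rw [sub_eq_add_neg]; exact hM.add hN.neg

theorem IsTame.transpose {M : Matrix Ω Ω' (Plus 𝔄)} (hM : IsTame M) : IsTame M.transpose :=
  ⟨hM.col, hM.row⟩

/-- The bound behind all convergence statements for products. -/
theorem RowTame.mul_bound {M : Matrix Ω Ω' (Plus 𝔄)} {N : Matrix Ω' Ω'' (Plus 𝔄)}
    (hM : RowTame M) (hN : RowTame N) (L : List (seminorms (𝔄 := 𝔄))) (k : ℕ) :
    ∃ l : ℕ, ∃ C : ℝ, 0 ≤ C ∧ ∃ g : Ω' → ℝ, Summable g ∧ (∀ x, 0 ≤ g x) ∧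
      ∀ i x j, gauge L (M i x * N x j) * wt j ^ k ≤ C * wt i ^ l * g x := by
  obtain ⟨Q, hQ⟩ := gauge_mul_le L
  obtain ⟨m, hm⟩ := exists_summable_wt Ω'
  obtain ⟨l', C', hC', h'⟩ := hN Q k
  -- The decay demanded of the rows of `M` has two uses: `l'` absorbs the growth of the rows of `N`,
  -- and `m` buys summability.
  obtain ⟨l, C, hC, h⟩ := hM Q (l' + m)
  refine ⟨l, C * C', mul_nonneg hC hC', _, hm, fun x => inv_nonneg.2 (pow_pos (wt_pos x) m).le,
    fun i x j => ?_⟩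
  have hx := pow_pos (wt_pos x) m
  rw [← div_eq_mul_inv, le_div_iff₀ hx]
  have h1 := h i x
  have h2 := h' x j
  calc gauge L (M i x * N x j) * wt j ^ k * wt x ^ m
      ≤ gauge Q (M i x) * gauge Q (N x j) * wt j ^ k * wt x ^ m := by
        have := (pow_pos (wt_pos j) k).le
        gcongr
        exact hQ _ _
    _ = gauge Q (M i x) * wt x ^ m * (gauge Q (N x j) * wt j ^ k) := by ring
    _ ≤ gauge Q (M i x) * wt x ^ m * (C' * wt x ^ l') := by
        have := gauge_nonneg Q (M i x)
        gcongr
    _ = C' * (gauge Q (M i x) * wt x ^ (l' + m)) := by ring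
    _ ≤ C' * (C * wt i ^ l) := by gcongr
    _ = _ := by ring

theorem RowTame.summable_gauge {M : Matrix Ω Ω' (Plus 𝔄)} {N : Matrix Ω' Ω'' (Plus 𝔄)}
    (hM : RowTame M) (hN : RowTame N) (i : Ω) (j : Ω'') (L : List (seminorms (𝔄 := 𝔄))) :
    Summable fun x => gauge L (M i x * N x j) := by
  obtain ⟨l, C, hC, g, hg, -, h⟩ := hM.mul_bound hN L 0
  exact Summable.of_nonneg_of_le (fun x => gauge_nonneg _ _)
    (fun x => by simpa using h i x j) (hg.mul_left (C * wt i ^ l))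

theorem summable_of_gauge' [IsSeqComplete 𝔄] (f : Ω → Plus 𝔄)
    (hf : ∀ L : List (seminorms (𝔄 := 𝔄)), Summable fun i => gauge L (f i)) : Summable f :=
  have := SPG.countable (Ω := Ω)
  summable_of_gauge f hf

variable [IsSeqComplete 𝔄]

theorem RowTame.summable {M : Matrix Ω Ω' (Plus 𝔄)} {N : Matrix Ω' Ω'' (Plus 𝔄)}
    (hM : RowTame M) (hN : RowTame N) (i : Ω) (j : Ω'') :
    Summable fun x => M i x * N x j :=
  summable_of_gauge' _ (hM.summable_gauge hN i j)

theorem RowTame.mul {M : Matrix Ω Ω' (Plus 𝔄)} {N : Matrix Ω' Ω'' (Plus 𝔄)}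
    (hM : RowTame M) (hN : RowTame N) : RowTame (M ⬝ₘ N) := by
  intro L k
  obtain ⟨l, C, hC, g, hg, hg0, h⟩ := hM.mul_bound hN L k
  refine ⟨l, C * ∑' x, g x, mul_nonneg hC (tsum_nonneg hg0), fun i j => ?_⟩
  have hj := pow_pos (wt_pos j) k
  rw [← le_div_iff₀ hj]
  have h1 := gauge_tsum_le (hM.summable hN i j) L (g := fun x => C * wt i ^ l / wt j ^ k * g x)
    (fun x => by
      rw [div_mul_eq_mul_div, le_div_iff₀ hj]
      exact h i x j) (hg.mul_left _)
  rw [tsum_mul_left] at h1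
  refine h1.trans (le_of_eq ?_)
  field_simp

/-- This is where commutativity of `𝔄` enters; through it, column estimates for products reduce to
row estimates. -/
theorem transpose_mmul (M : Matrix Ω Ω' (Plus 𝔄)) (N : Matrix Ω' Ω'' (Plus 𝔄)) :
    (M ⬝ₘ N).transpose = N.transpose ⬝ₘ M.transpose := by
  funext i j
  exact tsum_congr fun x => mul_comm (M j x) (N x i)

theorem IsTame.mul {M : Matrix Ω Ω' (Plus 𝔄)} {N : Matrix Ω' Ω'' (Plus 𝔄)}
    (hM : IsTame M) (hN : IsTame N) : IsTame (M ⬝ₘ N) :=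
  ⟨hM.row.mul hN.row, by rw [transpose_mmul]; exact hN.col.mul hM.col⟩

theorem IsTame.mmul_add [T2Space 𝔄] {M : Matrix Ω Ω' (Plus 𝔄)} {N P : Matrix Ω' Ω'' (Plus 𝔄)}
    (hM : IsTame M) (hN : IsTame N) (hP : IsTame P) : M ⬝ₘ (N + P) = M ⬝ₘ N + M ⬝ₘ P := by
  funext i j
  rw [Matrix.add_apply]
  refine Eq.trans ?_ ((hM.row.summable hN.row i j).tsum_add (hM.row.summable hP.row i j))
  exact tsum_congr fun x => mul_add _ _ _

theorem IsTame.add_mmul [T2Space 𝔄] {M N : Matrix Ω Ω' (Plus 𝔄)} {P : Matrix Ω' Ω'' (Plus 𝔄)}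
    (hM : IsTame M) (hN : IsTame N) (hP : IsTame P) : (M + N) ⬝ₘ P = M ⬝ₘ P + N ⬝ₘ P := by
  funext i j
  rw [Matrix.add_apply]
  refine Eq.trans ?_ ((hM.row.summable hP.row i j).tsum_add (hN.row.summable hP.row i j))
  exact tsum_congr fun x => add_mul _ _ _

/-- A Fubini argument: the triple products are summable over both inner indices together, so the
iterated sums may be exchanged. -/
theorem IsTame.mmul_assoc [T2Space 𝔄] {M : Matrix Ω Ω' (Plus 𝔄)} {N : Matrix Ω' Ω'' (Plus 𝔄)}
    {P : Matrix Ω'' Ω₃ (Plus 𝔄)} (hM : IsTame M) (hN : IsTame N) (hP : IsTame P) :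
    M ⬝ₘ N ⬝ₘ P = M ⬝ₘ (N ⬝ₘ P) := by
  funext i j
  have hs : ∀ L : List (seminorms (𝔄 := 𝔄)),
      Summable fun z : Ω' × Ω'' => gauge L (M i z.1 * (N z.1 z.2 * P z.2 j)) := by
    intro L
    obtain ⟨Q, hQ⟩ := gauge_mul_le L
    obtain ⟨m, hm⟩ := exists_summable_wt Ω'
    obtain ⟨l, C, hC, g, hg, hg0, h⟩ := hN.row.mul_bound hP.row Q 0
    obtain ⟨l', C', hC', h'⟩ := hM.row Q (l + m)
    have hsum := (hm.mul_of_nonneg hg (fun x => inv_nonneg.2 (pow_pos (wt_pos x) m).le) hg0).mul_left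
      (C * (C' * wt i ^ l'))
    refine Summable.of_nonneg_of_le (fun x => gauge_nonneg _ _) (fun ⟨x, y⟩ => ?_) hsum
    have h1 := h' i x
    have h2 := h x y j
    have hx := pow_pos (wt_pos x) m
    have hy := hg0 y
    simp only [pow_zero, mul_one] at h2
    calc gauge L (M i x * (N x y * P y j))
        ≤ gauge Q (M i x) * gauge Q (N x y * P y j) := hQ _ _
      _ ≤ gauge Q (M i x) * (C * wt x ^ l * g y) := by
          have := gauge_nonneg Q (M i x)
          gcongr
      _ = C * (gauge Q (M i x) * wt x ^ (l + m)) * ((wt x ^ m)⁻¹ * g y) := by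
          field_simp; ring
      _ ≤ C * (C' * wt i ^ l') * ((wt x ^ m)⁻¹ * g y) := by gcongr
  let f : Ω' → Ω'' → Plus 𝔄 := fun x y => M i x * (N x y * P y j)
  have e1 : (M ⬝ₘ N ⬝ₘ P) i j = ∑' y, ∑' x, f x y := by
    refine tsum_congr fun y => ?_
    refine ((hM.row.summable hN.row i y).tsum_mul_right (P y j)).symm.trans ?_
    exact tsum_congr fun x => mul_assoc (M i x) (N x y) (P y j)
  have e2 : (M ⬝ₘ (N ⬝ₘ P)) i j = ∑' x, ∑' y, f x y := by
    refine tsum_congr fun x => ?_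
    exact ((hN.row.summable hP.row x j).tsum_mul_left (M i x)).symm
  rw [e1, e2]
  refine Summable.tsum_comm' (f := f) (summable_of_gauge' _ hs) (fun x => ?_) (fun y => ?_)
  · exact summable_of_gauge' _ fun L =>
      (hs L).comp_injective (i := fun y => (x, y)) fun _ _ h => (Prod.ext_iff.1 h).2
  · exact summable_of_gauge' _ fun L =>
      (hs L).comp_injective (i := fun x => (x, y)) fun _ _ h => (Prod.ext_iff.1 h).1

omit [IsSeqComplete 𝔄] in
theorem RowTame.tens {M : Matrix Ω Ω' (Plus 𝔄)} {N : Matrix Ξ Ξ' (Plus 𝔄)}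
    (hM : RowTame M) (hN : RowTame N) : RowTame (tens M N) := by
  intro L k
  obtain ⟨Q, hQ⟩ := gauge_mul_le L
  obtain ⟨l, C, hC, h⟩ := hM Q k
  obtain ⟨l', C', hC', h'⟩ := hN Q k
  refine ⟨l + l', C * C', mul_nonneg hC hC', fun i j => ?_⟩
  have h1 := h i.1 j.1
  have h2 := h' i.2 j.2
  have g1 := gauge_nonneg Q (M i.1 j.1)
  have g2 := gauge_nonneg Q (N i.2 j.2)
  have p1 := pow_pos (wt_pos j.1) k
  have p2 := pow_pos (wt_pos j.2) k
  have p3 := pow_pos (wt_pos i.1) l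
  calc gauge L (M i.1 j.1 * N i.2 j.2) * wt j ^ k
      ≤ (gauge Q (M i.1 j.1) * gauge Q (N i.2 j.2)) * (wt j.1 * wt j.2) ^ k := by
        have := (wt_pos j).le
        gcongr
        · exact hQ _ _
        · exact wt_prod_le j.1 j.2
    _ = (gauge Q (M i.1 j.1) * wt j.1 ^ k) * (gauge Q (N i.2 j.2) * wt j.2 ^ k) := by
        rw [mul_pow]; ring
    _ ≤ (C * wt i.1 ^ l) * (C' * wt i.2 ^ l') := by gcongr
    _ = (C * C') * (wt i.1 ^ l * wt i.2 ^ l') := by ring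
    _ ≤ (C * C') * (wt i ^ l * wt i ^ l') := by
        have q1 := (wt_pos i.1).le
        have q2 := (wt_pos i.2).le
        have q3 := (wt_pos i).le
        gcongr
        · exact wt_le_prod_left i.1 i.2
        · exact wt_le_prod_right i.1 i.2
    _ = _ := by rw [← pow_add]

omit [IsSeqComplete 𝔄] in
theorem IsTame.tens {M : Matrix Ω Ω' (Plus 𝔄)} {N : Matrix Ξ Ξ' (Plus 𝔄)}
    (hM : IsTame M) (hN : IsTame N) : IsTame (tens M N) :=
  ⟨hM.row.tens hN.row, by
    have e : (Polymetric.tens M N).transpose = Polymetric.tens M.transpose N.transpose := by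
      funext i j
      simp only [Polymetric.tens, Matrix.transpose_apply]
    rw [e]
    exact hM.col.tens hN.col⟩

theorem IsTame.tens_mmul_tens [T2Space 𝔄] {M : Matrix Ω Ω' (Plus 𝔄)} {M' : Matrix Ω' Ω'' (Plus 𝔄)}
    {N : Matrix Ξ Ξ' (Plus 𝔄)} {N' : Matrix Ξ' Ξ'' (Plus 𝔄)}
    (hM : IsTame M) (hM' : IsTame M') (hN : IsTame N) (hN' : IsTame N') :
    Polymetric.tens M N ⬝ₘ Polymetric.tens M' N' = Polymetric.tens (M ⬝ₘ M') (N ⬝ₘ N') := by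
  funext i j
  have h1 := hM.row.summable hM'.row i.1 j.1
  have h2 := hN.row.summable hN'.row i.2 j.2
  have h3 : Summable fun x : Ω' × Ξ' =>
      (M i.1 x.1 * M' x.1 j.1) * (N i.2 x.2 * N' x.2 j.2) := by
    refine summable_of_gauge' _ fun L => ?_
    obtain ⟨Q, hQ⟩ := gauge_mul_le L
    exact Summable.of_nonneg_of_le (fun x => gauge_nonneg _ _) (fun x => hQ _ _)
      ((hM.row.summable_gauge hM'.row i.1 j.1 Q).mul_of_nonneg
        (hN.row.summable_gauge hN'.row i.2 j.2 Q) (fun _ => gauge_nonneg _ _)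
        (fun _ => gauge_nonneg _ _))
  have h4 : (∑' x, M i.1 x * M' x j.1) * (∑' x, N i.2 x * N' x j.2) =
      ∑' x : Ω' × Ξ', (M i.1 x.1 * M' x.1 j.1) * (N i.2 x.2 * N' x.2 j.2) :=
    Summable.tsum_mul_tsum h1 h2 h3
  have h5 : ∀ x : Ω' × Ξ', (M i.1 x.1 * N i.2 x.2) * (M' x.1 j.1 * N' x.2 j.2) =
      (M i.1 x.1 * M' x.1 j.1) * (N i.2 x.2 * N' x.2 j.2) := fun x =>
    mul_mul_mul_comm (M i.1 x.1) (N i.2 x.2) (M' x.1 j.1) (N' x.2 j.2)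
  simp only [mmul, Polymetric.tens]
  rw [h4]
  exact tsum_congr h5

/-! Rapidly decreasing matrices -/

omit [IsSeqComplete 𝔄] in
theorem IsRapid.bound {M : Matrix Ω Ω' (Plus 𝔄)} (hM : IsRapid 𝔄 M)
    (L : List (seminorms (𝔄 := 𝔄))) (k : ℕ) :
    ∃ C : ℝ, 0 ≤ C ∧ ∀ i j, gauge L (M i j) * (wt i * wt j) ^ k ≤ C := by
  induction L with
  | nil => exact ⟨0, le_rfl, fun i j => by simp [gauge, hM.1 i j]⟩
  | cons p L ih =>
    obtain ⟨C, hC, h⟩ := ih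
    obtain ⟨C', h'⟩ := hM.2 p.1 p.2 k
    refine ⟨C + |C'|, by positivity, fun i j => ?_⟩
    rw [gauge_cons, add_mul]
    exact add_le_add (h i j) ((h' i j).trans (le_abs_self _))

omit [IsSeqComplete 𝔄] in
theorem IsRapid.of_bound {M : Matrix Ω Ω' (Plus 𝔄)} (h0 : ∀ i j, (M i j).fst = 0)
    (h : ∀ (L : List (seminorms (𝔄 := 𝔄))) (k : ℕ), ∃ C : ℝ, ∀ i j,
      gauge L (M i j) * (wt i * wt j) ^ k ≤ C) : IsRapid 𝔄 M := by
  refine ⟨h0, fun p hp k => ?_⟩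
  obtain ⟨C, hC⟩ := h [⟨p, hp⟩] k
  refine ⟨C, fun i j => le_trans ?_ (hC i j)⟩
  exact mul_le_mul_of_nonneg_right (seminorm_le_gauge ⟨p, hp⟩ (M i j))
    (pow_nonneg (mul_nonneg (wt_pos i).le (wt_pos j).le) k)

omit [IsSeqComplete 𝔄] in
theorem IsRapid.transpose {M : Matrix Ω Ω' (Plus 𝔄)} (hM : IsRapid 𝔄 M) :
    IsRapid 𝔄 M.transpose :=
  ⟨fun i j => hM.1 j i, fun p hp k => (hM.2 p hp k).imp fun C h i j => by
    rw [mul_comm ((size i : ℝ) + 1)]; exact h j i⟩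

omit [IsSeqComplete 𝔄] in
theorem IsRapid.row {M : Matrix Ω Ω' (Plus 𝔄)} (hM : IsRapid 𝔄 M) : RowTame M := by
  intro L k
  obtain ⟨C, hC, h⟩ := hM.bound L k
  refine ⟨0, C, hC, fun i j => le_trans ?_ ((h i j).trans (by simp))⟩
  have h1 := one_le_wt_pow i k
  have h2 := pow_pos (wt_pos j) k
  rw [mul_pow]
  have := gauge_nonneg L (M i j)
  gcongr
  nlinarith

omit [IsSeqComplete 𝔄] in
theorem IsRapid.tame {M : Matrix Ω Ω' (Plus 𝔄)} (hM : IsRapid 𝔄 M) : IsTame M :=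
  ⟨hM.row, hM.transpose.row⟩

omit [IsSeqComplete 𝔄] in
theorem IsRapid.add {M N : Matrix Ω Ω' (Plus 𝔄)} (hM : IsRapid 𝔄 M) (hN : IsRapid 𝔄 N) :
    IsRapid 𝔄 (M + N) := by
  refine IsRapid.of_bound (fun i j => by simp [hM.1 i j, hN.1 i j]) fun L k => ?_
  obtain ⟨C, -, h⟩ := hM.bound L k
  obtain ⟨C', -, h'⟩ := hN.bound L k
  refine ⟨C + C', fun i j => ?_⟩
  have h1 := mul_le_mul_of_nonneg_right (gauge_add_le L (M i j) (N i j))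
    (pow_nonneg (mul_nonneg (wt_pos i).le (wt_pos j).le) k)
  have := h i j
  have := h' i j
  rw [Matrix.add_apply]
  linarith

omit [IsSeqComplete 𝔄] in
theorem IsRapid.neg {M : Matrix Ω Ω' (Plus 𝔄)} (hM : IsRapid 𝔄 M) : IsRapid 𝔄 (-M) :=
  ⟨fun i j => by simp [hM.1 i j], fun p hp k => (hM.2 p hp k).imp fun C h i j => by
    simpa using h i j⟩

theorem IsRapid.mul {M : Matrix Ω Ω' (Plus 𝔄)} {N : Matrix Ω' Ω'' (Plus 𝔄)} [T2Space 𝔄]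
    (hM : IsRapid 𝔄 M) (hN : IsTame N) : IsRapid 𝔄 (M ⬝ₘ N) := by
  refine IsRapid.of_bound (fun i j => ?_) fun L k => ?_
  · have hs := hM.row.summable hN.row i j
    -- The integer component is a continuous homomorphism, so the sum stays inside `𝔄`.
    have h1 : (∑' x, M i x * N x j).fst = ∑' x, (M i x * N x j).fst :=
      hs.map_tsum (Unitization.fstHom ℤ 𝔄) continuous_plus_fst
    refine h1.trans ?_
    simp [hM.1]
  · obtain ⟨Q, hQ⟩ := gauge_mul_le L
    obtain ⟨m, hm⟩ := exists_summable_wt Ω'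
    obtain ⟨l, C, hC, h⟩ := hN.row Q k
    -- Here `k` pays for the row weight of the product, `l` for the growth of `N`, and `m` for
    -- summability.
    obtain ⟨C', hC', h'⟩ := hM.bound Q (k + l + m)
    refine ⟨C' * C * ∑' x : Ω', (wt x ^ m)⁻¹, fun i j => ?_⟩
    have hi := pow_pos (wt_pos i) k
    have hj := pow_pos (wt_pos j) k
    rw [mul_pow, ← le_div_iff₀ (by positivity)]
    have h1 := gauge_tsum_le (hM.row.summable hN.row i j) L
      (g := fun x => C' * C / (wt i ^ k * wt j ^ k) * (wt x ^ m)⁻¹)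
      (fun x => by
        have hx := pow_pos (wt_pos x) m
        have hx' := pow_pos (wt_pos x) l
        have g1 := gauge_nonneg Q (M i x)
        have g2 := gauge_nonneg Q (N x j)
        rw [← div_eq_mul_inv, div_div, le_div_iff₀ (by positivity)]
        have e1 := h x j
        have e2 := h' i x
        have e3 : wt i ^ k * wt x ^ (l + m) ≤ (wt i * wt x) ^ (k + l + m) := by
          rw [mul_pow]
          have := (wt_pos x).le
          have := (wt_pos i).le
          gcongr
          · exact one_le_wt i
          · omega
          · exact one_le_wt x
          · omega
        calc gauge L (M i x * N x j) * (wt i ^ k * wt j ^ k * wt x ^ m)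
            ≤ (gauge Q (M i x) * gauge Q (N x j)) * (wt i ^ k * wt j ^ k * wt x ^ m) := by
              gcongr
              exact hQ _ _
          _ = gauge Q (M i x) * wt i ^ k * wt x ^ m * (gauge Q (N x j) * wt j ^ k) := by ring
          _ ≤ gauge Q (M i x) * wt i ^ k * wt x ^ m * (C * wt x ^ l) := by gcongr
          _ = gauge Q (M i x) * (wt i ^ k * wt x ^ (l + m)) * C := by ring
          _ ≤ gauge Q (M i x) * (wt i * wt x) ^ (k + l + m) * C := by gcongr
          _ ≤ C' * C := by gcongr) (hm.mul_left _)
    rw [tsum_mul_left] at h1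
    refine h1.trans (le_of_eq ?_)
    field_simp

theorem IsTame.mul_rapid {M : Matrix Ω Ω' (Plus 𝔄)} {N : Matrix Ω' Ω'' (Plus 𝔄)} [T2Space 𝔄]
    (hM : IsTame M) (hN : IsRapid 𝔄 N) : IsRapid 𝔄 (M ⬝ₘ N) := by
  have := (hN.transpose.mul hM.transpose).transpose
  rwa [← transpose_mmul] at this

omit [IsSeqComplete 𝔄] in
theorem IsRapid.tens {M : Matrix Ω Ω' (Plus 𝔄)} {N : Matrix Ξ Ξ' (Plus 𝔄)}
    (hM : IsRapid 𝔄 M) (hN : IsRapid 𝔄 N) : IsRapid 𝔄 (tens M N) := by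
  refine IsRapid.of_bound (fun i j => by simp [Polymetric.tens, hM.1]) fun L k => ?_
  obtain ⟨Q, hQ⟩ := gauge_mul_le L
  obtain ⟨C, hC, h⟩ := hM.bound Q k
  obtain ⟨C', hC', h'⟩ := hN.bound Q k
  refine ⟨C * C', fun i j => ?_⟩
  have g1 := gauge_nonneg Q (M i.1 j.1)
  have g2 := gauge_nonneg Q (N i.2 j.2)
  have w1 := (wt_pos i.1).le
  have w2 := (wt_pos i.2).le
  have w3 := (wt_pos j.1).le
  have w4 := (wt_pos j.2).le
  have w5 := (wt_pos i).le
  have w6 := (wt_pos j).le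
  calc gauge L (M i.1 j.1 * N i.2 j.2) * (wt i * wt j) ^ k
      ≤ (gauge Q (M i.1 j.1) * gauge Q (N i.2 j.2)) *
          ((wt i.1 * wt i.2) * (wt j.1 * wt j.2)) ^ k := by
        gcongr
        · exact hQ _ _
        · exact wt_prod_le i.1 i.2
        · exact wt_prod_le j.1 j.2
    _ = (gauge Q (M i.1 j.1) * (wt i.1 * wt j.1) ^ k) *
          (gauge Q (N i.2 j.2) * (wt i.2 * wt j.2) ^ k) := by ring
    _ ≤ C * C' := by
        gcongr
        · exact h _ _
        · exact h' _ _

/-! Relabeling matrices -/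

omit [IsSeqComplete 𝔄] in
-- A nonzero entry sits at `(r j, j)`, so the two estimates are exactly the two polynomial
-- comparisons between the sizes of `j` and `r j`.
theorem hat_tame {r : Ω → Ω'} (hr : IsRelabeling r) :
    IsTame (hat r : Matrix Ω' Ω (Plus 𝔄)) := by
  constructor
  · intro L k
    obtain ⟨l, C, hC, h⟩ := hr.le_size.exists_real_le
    refine ⟨l * k, C ^ k, by positivity, fun i j => ?_⟩
    by_cases e : i = r j
    · have := pow_le_pow_left₀ (wt_pos j).le (h j) k
      rw [mul_pow, ← pow_mul] at this
      simpa [hat, e, gauge_one, wt] using this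
    · have := wt_pos i
      simp only [hat, e, if_false, gauge_zero, zero_mul]
      positivity
  · intro L k
    obtain ⟨l, C, hC, h⟩ := hr.size_le.exists_real_le
    refine ⟨l * k, C ^ k, by positivity, fun i j => ?_⟩
    by_cases e : j = r i
    · have := pow_le_pow_left₀ (wt_pos (r i)).le (h i) k
      rw [mul_pow, ← pow_mul] at this
      simpa [hat, e, gauge_one, wt] using this
    · have := wt_pos i
      simp only [hat, Matrix.transpose_apply, e, if_false, gauge_zero, zero_mul]
      positivity

end Tame

/-! ### Relabelings given by the structural maps. -/

section Relabelings

variable {Ω Ξ Θ : Type} [SPG Ω] [SPG Ξ] [SPG Θ]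

/-- A map whose image has a complement parametrized by another set of polynomial growth. -/
theorem IsRelabeling.of_cover (r : Ω → Θ) (s : Ξ → Θ) (hr : r.Injective) (hs : s.Injective)
    (hrs : ∀ ω ξ, r ω ≠ s ξ) (hcov : ∀ x, (∃ ω, r ω = x) ∨ ∃ ξ, s ξ = x)
    (h₁ : PolyLE (fun ω => size (r ω)) size) (h₂ : PolyLE size (fun ω => size (r ω)))
    (hsize : ∀ ξ, size (s ξ) = size ξ) : IsRelabeling r := by
  refine ⟨hr, h₁, h₂, ?_⟩
  have hmem : ∀ ξ, s ξ ∉ Set.range r := by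
    rintro ξ ⟨ω, h⟩
    exact hrs ω ξ h
  have hbij : Function.Bijective (fun ξ => (⟨s ξ, hmem ξ⟩ : {x : Θ // x ∉ Set.range r})) := by
    constructor
    · intro ξ η h
      exact hs (congrArg Subtype.val h)
    · rintro ⟨x, hx⟩
      rcases hcov x with ⟨ω, h⟩ | ⟨ξ, h⟩
      · exact absurd ⟨ω, h⟩ hx
      · exact ⟨ξ, Subtype.ext h⟩
  have h := (SPG.isSPG (Ω := Ξ)).comp_equiv (Equiv.ofBijective _ hbij).symm
  convert h using 1
  funext x
  obtain ⟨ξ, rfl⟩ := hbij.2 x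
  rw [← hsize]
  have h2 : (Equiv.ofBijective _ hbij).symm ⟨s ξ, hmem ξ⟩ = ξ :=
    Equiv.ofBijective_symm_apply_apply _ hbij ξ
  exact congrArg (fun η => size (s η)) h2.symm

theorem polyLE_of_eq {s t : Ω → ℕ} (h : ∀ ω, s ω = t ω) : PolyLE s t :=
  PolyLE.of_le fun ω => (h ω).le

theorem IsRelabeling.of_equiv (e : Ω ≃ Θ) (h₁ : PolyLE (fun ω => size (e ω)) size)
    (h₂ : PolyLE size (fun ω => size (e ω))) : IsRelabeling e :=
  IsRelabeling.of_cover (Ξ := Fin 0) e (fun i => i.elim0) e.injective (fun i => i.elim0)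
    (fun _ i => i.elim0) (fun x => Or.inl ⟨e.symm x, by simp⟩) h₁ h₂ (fun i => i.elim0)

theorem IsRelabeling.of_equiv_size (e : Ω ≃ Θ) (h : ∀ ω, size (e ω) = size ω) : IsRelabeling e :=
  IsRelabeling.of_equiv e (polyLE_of_eq h) (polyLE_of_eq fun ω => (h ω).symm)

theorem isRelabeling_id : IsRelabeling (id : Ω → Ω) :=
  IsRelabeling.of_equiv_size (Equiv.refl Ω) fun _ => rfl

theorem isRelabeling_elim0 : IsRelabeling (fun i : Fin 0 => (i.elim0 : Ω)) :=
  IsRelabeling.of_cover _ (id : Ω → Ω) (fun i => i.elim0) Function.injective_id (fun i => i.elim0)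
    (fun x => Or.inr ⟨x, rfl⟩) (PolyLE.of_finite _ _) (PolyLE.of_finite _ _) fun _ => rfl

theorem isRelabeling_inl : IsRelabeling (Sum.inl : Ω → Ω ⊕ Ξ) :=
  IsRelabeling.of_cover _ (Sum.inr : Ξ → Ω ⊕ Ξ) Sum.inl_injective Sum.inr_injective (by simp)
    (by rintro (x | x) <;> simp) (polyLE_of_eq fun _ => rfl) (polyLE_of_eq fun _ => rfl)
    fun _ => rfl

theorem isRelabeling_inr : IsRelabeling (Sum.inr : Ξ → Ω ⊕ Ξ) :=
  IsRelabeling.of_cover _ (Sum.inl : Ω → Ω ⊕ Ξ) Sum.inr_injective Sum.inl_injective (by simp)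
    (by rintro (x | x) <;> simp) (polyLE_of_eq fun _ => rfl) (polyLE_of_eq fun _ => rfl)
    fun _ => rfl

theorem size_fin_prod {n : ℕ} (i : Fin n) (ω : Ω) : size (i, ω) = size ω := Nat.zero_add _

theorem fin_two_cover (x : Fin 2 × Ω) : (∃ ω, ((0 : Fin 2), ω) = x) ∨ ∃ ω, ((1 : Fin 2), ω) = x := by
  obtain ⟨i, ω⟩ := x
  fin_cases i
  · exact Or.inl ⟨ω, rfl⟩
  · exact Or.inr ⟨ω, rfl⟩

theorem isRelabeling_zero : IsRelabeling (fun ω : Ω => ((0 : Fin 2), ω)) :=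
  IsRelabeling.of_cover _ (fun ω : Ω => ((1 : Fin 2), ω)) (Prod.mk_right_injective _)
    (Prod.mk_right_injective _) (by simp) fin_two_cover (polyLE_of_eq fun _ => size_fin_prod _ _)
    (polyLE_of_eq fun _ => (size_fin_prod _ _).symm) fun _ => size_fin_prod _ _

theorem isRelabeling_one : IsRelabeling (fun ω : Ω => ((1 : Fin 2), ω)) :=
  IsRelabeling.of_cover _ (fun ω : Ω => ((0 : Fin 2), ω)) (Prod.mk_right_injective _)
    (Prod.mk_right_injective _) (by simp) (fun x => (fin_two_cover x).symm)
    (polyLE_of_eq fun _ => size_fin_prod _ _)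
    (polyLE_of_eq fun _ => (size_fin_prod _ _).symm) fun _ => size_fin_prod _ _

end Relabelings

/-! ### Products with relabeling matrices, entry by entry. -/

section Hat

variable {R : Type u} [Ring R] [TopologicalSpace R] {Ω Ω' Ω'' Ξ : Type}

theorem hat_mmul {r : Ω → Ω'} (hr : r.Injective) (M : Matrix Ω Ω'' R) (i : Ω) (j : Ω'') :
    (hat r ⬝ₘ M) (r i) j = M i j := by
  refine (tsum_eq_single i fun k hk => ?_).trans ?_
  · simp [hat, hr.ne hk.symm]
  · simp [hat]

theorem hat_mmul_of_notMem {r : Ω → Ω'} (M : Matrix Ω Ω'' R) {i : Ω'} (hi : i ∉ Set.range r)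
    (j : Ω'') : (hat r ⬝ₘ M) i j = 0 := by
  refine (tsum_congr fun k => ?_).trans tsum_zero
  have : i ≠ r k := fun h => hi ⟨k, h.symm⟩
  simp [hat, this]

theorem hatT_mmul (r : Ω → Ω') (M : Matrix Ω' Ω'' R) (i : Ω) (j : Ω'') :
    ((hat r).transpose ⬝ₘ M) i j = M (r i) j := by
  refine (tsum_eq_single (r i) fun k hk => ?_).trans ?_
  · simp [hat, hk]
  · simp [hat]

theorem mmul_hat (r : Ω → Ω') (M : Matrix Ω'' Ω' R) (i : Ω'') (j : Ω) :
    (M ⬝ₘ hat r) i j = M i (r j) := by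
  refine (tsum_eq_single (r j) fun k hk => ?_).trans ?_
  · simp [hat, hk]
  · simp [hat]

theorem mmul_hatT {r : Ω → Ω'} (hr : r.Injective) (M : Matrix Ω'' Ω R) (i : Ω'') (j : Ω) :
    (M ⬝ₘ (hat r).transpose) i (r j) = M i j := by
  refine (tsum_eq_single j fun k hk => ?_).trans ?_
  · simp [hat, hr.ne hk.symm]
  · simp [hat]

theorem mmul_hatT_of_notMem {r : Ω → Ω'} (M : Matrix Ω'' Ω R) (i : Ω'') {j : Ω'}
    (hj : j ∉ Set.range r) : (M ⬝ₘ (hat r).transpose) i j = 0 := by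
  refine (tsum_congr fun k => ?_).trans tsum_zero
  have : j ≠ r k := fun h => hj ⟨k, h.symm⟩
  simp [hat, this]

theorem idm_mmul (M : Matrix Ω Ω' R) : idm ⬝ₘ M = M := by
  funext i j
  exact hat_mmul Function.injective_id M i j

theorem mmul_idm (M : Matrix Ω Ω' R) : M ⬝ₘ idm = M := by
  funext i j
  exact mmul_hat id M i j

theorem hatT_mmul_hat {r : Ω → Ω'} (hr : r.Injective) :
    (hat r).transpose ⬝ₘ (hat r : Matrix Ω' Ω R) = idm := by
  funext i j
  rw [hatT_mmul]
  by_cases h : i = j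
  · simp [hat, idm, h]
  · simp [hat, idm, h, hr.ne h]

theorem hatT_mmul_hat_of_ne {r : Ω → Ω'} {s : Ξ → Ω'} (h : ∀ i j, r i ≠ s j) :
    (hat r).transpose ⬝ₘ (hat s : Matrix Ω' Ξ R) = 0 := by
  funext i j
  rw [hatT_mmul]
  simp [hat, h]

theorem hat_mmul_hatT_add {r : Ω → Ω'} {s : Ξ → Ω'} (hr : r.Injective) (hs : s.Injective)
    (h : ∀ i j, r i ≠ s j) (hcov : ∀ x, (∃ ω, r ω = x) ∨ ∃ ξ, s ξ = x) :
    hat r ⬝ₘ (hat r).transpose + hat s ⬝ₘ (hat s).transpose = (idm : Matrix Ω' Ω' R) := by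
  funext i j
  rw [Matrix.add_apply]
  rcases hcov i with ⟨k, rfl⟩ | ⟨k, rfl⟩
  · rw [hat_mmul hr, hat_mmul_of_notMem _ (by rintro ⟨l, hl⟩; exact h _ _ hl.symm), add_zero]
    by_cases e : j = r k
    · simp [hat, idm, e]
    · simp [hat, idm, e, Ne.symm e]
  · rw [hat_mmul hs, hat_mmul_of_notMem _ (by rintro ⟨l, hl⟩; exact h _ _ hl), zero_add]
    by_cases e : j = s k
    · simp [hat, idm, e]
    · simp [hat, idm, e, Ne.symm e]

end Hat

/-! ### The calculus of polynomially assembled tame matrices. -/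

section PMat

variable {𝔄 : Type u} [NonUnitalCommRing 𝔄] [TopologicalSpace 𝔄] [PolymetricRing 𝔄]
variable {X : Type v}

/-- Matrix valued maps which are assembled polynomially from the data `D`, with tame values. -/
@[ext]
structure PMat (D : PolyData X (Plus 𝔄)) (Ω Ω' : Type) [SPG Ω] [SPG Ω'] where
  val : X → Matrix Ω Ω' (Plus 𝔄)
  poly : IsPoly D val
  tame : ∀ x, IsTame (val x)

variable {D : PolyData X (Plus 𝔄)}
variable {Ω Ω' Ω'' Ω₃ Ξ Ξ' Ξ'' Θ Θ' Θ'' : Type} [SPG Ω] [SPG Ω'] [SPG Ω''] [SPG Ω₃] [SPG Ξ] [SPG Ξ']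
  [SPG Ξ''] [SPG Θ] [SPG Θ'] [SPG Θ'']

namespace PMat

/-- The constant map with value a relabeling matrix. -/
noncomputable def hat (r : Ω → Ω') (hr : IsRelabeling r) : PMat D Ω' Ω :=
  ⟨fun _ => Polymetric.hat r, .relabeling r hr, fun _ => hat_tame hr⟩

/-- The constant map with value the transpose of a relabeling matrix. -/
noncomputable def hatT (r : Ω → Ω') (hr : IsRelabeling r) : PMat D Ω Ω' :=
  ⟨fun _ => (Polymetric.hat r).transpose, .relabelingT r hr, fun _ => (hat_tame hr).transpose⟩

noncomputable instance : One (PMat D Ω Ω) := ⟨hat id isRelabeling_id⟩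

instance : Add (PMat D Ω Ω') :=
  ⟨fun A B => ⟨fun x => A.val x + B.val x, A.poly.add B.poly, fun x => (A.tame x).add (B.tame x)⟩⟩

instance : Sub (PMat D Ω Ω') :=
  ⟨fun A B => ⟨fun x => A.val x - B.val x, A.poly.sub B.poly, fun x => (A.tame x).sub (B.tame x)⟩⟩

/-- Zero is the difference of a map with itself. Factoring through an empty index set yields such a
map of any shape, even when no relabeling between `Ω` and `Ω'` is at hand. -/
theorem zero_poly : IsPoly D (fun _ => (0 : Matrix Ω Ω' (Plus 𝔄))) := by
  have h : IsPoly D (fun _ : X =>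
      (Polymetric.hat (fun i : Fin 0 => (i.elim0 : Ω)) : Matrix Ω (Fin 0) (Plus 𝔄)) ⬝ₘ
      (Polymetric.hat (fun i : Fin 0 => (i.elim0 : Ω'))).transpose) :=
    .mul (.relabeling _ isRelabeling_elim0) (.relabelingT _ isRelabeling_elim0)
  simpa using h.sub h

instance : Zero (PMat D Ω Ω') :=
  ⟨⟨fun _ => 0, zero_poly, fun _ => ⟨fun L _ => ⟨0, 0, le_rfl, fun _ _ => by simp [gauge_zero]⟩,
    fun L _ => ⟨0, 0, le_rfl, fun _ _ => by simp [gauge_zero]⟩⟩⟩⟩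

instance : Neg (PMat D Ω Ω') :=
  ⟨fun A => ⟨fun x => -A.val x, by simpa using zero_poly.sub A.poly, fun x => (A.tame x).neg⟩⟩

theorem val_add (A B : PMat D Ω Ω') (x : X) : (A + B).val x = A.val x + B.val x := rfl
theorem val_sub (A B : PMat D Ω Ω') (x : X) : (A - B).val x = A.val x - B.val x := rfl
theorem val_zero (x : X) : (0 : PMat D Ω Ω').val x = 0 := rfl
theorem val_one (x : X) : (1 : PMat D Ω Ω).val x = idm := rfl

theorem ext' {A B : PMat D Ω Ω'} (h : ∀ x, A.val x = B.val x) : A = B :=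
  PMat.ext (funext h)

instance : AddCommGroup (PMat D Ω Ω') where
  add_assoc A B C := ext' fun x => add_assoc (A.val x) (B.val x) (C.val x)
  zero_add A := ext' fun x => zero_add (A.val x)
  add_zero A := ext' fun x => add_zero (A.val x)
  nsmul := nsmulRec
  zsmul := zsmulRec
  neg_add_cancel A := ext' fun x => neg_add_cancel (A.val x)
  add_comm A B := ext' fun x => add_comm (A.val x) (B.val x)
  sub_eq_add_neg A B := ext' fun x => sub_eq_add_neg (A.val x) (B.val x)

/-- The matrix is rapidly decreasing at each point. -/
def Rapid (A : PMat D Ω Ω') : Prop := ∀ x, IsRapid 𝔄 (A.val x)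

/-- Equality modulo rapidly decreasing matrices. -/
def Cong (A B : PMat D Ω Ω') : Prop := (A - B).Rapid

/-- The tensor product of matrix valued maps. -/
def ten (A : PMat D Ω Ω') (B : PMat D Ξ Ξ') : PMat D (Ω × Ξ) (Ω' × Ξ') :=
  ⟨fun x => Polymetric.tens (A.val x) (B.val x), A.poly.tens B.poly,
    fun x => (A.tame x).tens (B.tame x)⟩

variable [IsSeqComplete 𝔄]

noncomputable instance : HMul (PMat D Ω Ω') (PMat D Ω' Ω'') (PMat D Ω Ω'') :=
  ⟨fun A B => ⟨fun x => A.val x ⬝ₘ B.val x, A.poly.mul B.poly, fun x => (A.tame x).mul (B.tame x)⟩⟩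

theorem val_mul (A : PMat D Ω Ω') (B : PMat D Ω' Ω'') (x : X) :
    (A * B).val x = A.val x ⬝ₘ B.val x := rfl

@[simp] theorem one_mul (A : PMat D Ω Ω') : (1 : PMat D Ω Ω) * A = A :=
  ext' fun x => idm_mmul (A.val x)

@[simp] theorem mul_one (A : PMat D Ω Ω') : A * (1 : PMat D Ω' Ω') = A :=
  ext' fun x => mmul_idm (A.val x)

variable [T2Space 𝔄]

@[simp] theorem mul_assoc (A : PMat D Ω Ω') (B : PMat D Ω' Ω'') (C : PMat D Ω'' Ω₃) :
    A * B * C = A * (B * C) :=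
  ext' fun x => (A.tame x).mmul_assoc (B.tame x) (C.tame x)

@[simp] theorem mul_add (A : PMat D Ω Ω') (B C : PMat D Ω' Ω'') : A * (B + C) = A * B + A * C :=
  ext' fun x => (A.tame x).mmul_add (B.tame x) (C.tame x)

@[simp] theorem add_mul (A B : PMat D Ω Ω') (C : PMat D Ω' Ω'') : (A + B) * C = A * C + B * C :=
  ext' fun x => (A.tame x).add_mmul (B.tame x) (C.tame x)

@[simp] theorem mul_zero (A : PMat D Ω Ω') : A * (0 : PMat D Ω' Ω'') = 0 := by
  have h := A.mul_add (0 : PMat D Ω' Ω'') 0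
  rwa [add_zero, left_eq_add] at h

@[simp] theorem zero_mul (A : PMat D Ω' Ω'') : (0 : PMat D Ω Ω') * A = 0 := by
  have h := (0 : PMat D Ω Ω').add_mul 0 A
  rwa [add_zero, left_eq_add] at h

@[simp] theorem mul_neg (A : PMat D Ω Ω') (B : PMat D Ω' Ω'') : A * -B = -(A * B) := by
  rw [eq_neg_iff_add_eq_zero, ← mul_add, neg_add_cancel, mul_zero]

@[simp] theorem neg_mul (A : PMat D Ω Ω') (B : PMat D Ω' Ω'') : -A * B = -(A * B) := by
  rw [eq_neg_iff_add_eq_zero, ← add_mul, neg_add_cancel, zero_mul]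

@[simp] theorem mul_sub (A : PMat D Ω Ω') (B C : PMat D Ω' Ω'') : A * (B - C) = A * B - A * C := by
  rw [sub_eq_add_neg, mul_add, mul_neg, ← sub_eq_add_neg]

@[simp] theorem sub_mul (A B : PMat D Ω Ω') (C : PMat D Ω' Ω'') : (A - B) * C = A * C - B * C := by
  rw [sub_eq_add_neg, add_mul, neg_mul, ← sub_eq_add_neg]

/-- Products are normalized by associating to the right, where an identity for `A * B` applies only
in front of a tail `E`. -/
theorem mul_mul_of_eq {A : PMat D Ω Ω'} {B : PMat D Ω' Ω''} {C : PMat D Ω Ω''} (h : A * B = C)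
    (E : PMat D Ω'' Ω₃) : A * (B * E) = C * E := by
  rw [← mul_assoc, h]

/-! Tensor products -/

omit [IsSeqComplete 𝔄] [T2Space 𝔄] in
@[simp] theorem tens_add (A : PMat D Ω Ω') (B C : PMat D Ξ Ξ') :
    ten A (B + C) = ten A B + ten A C :=
  ext' fun x => by
    funext i j
    exact _root_.mul_add (A.val x i.1 j.1) (B.val x i.2 j.2) (C.val x i.2 j.2)

omit [IsSeqComplete 𝔄] [T2Space 𝔄] in
@[simp] theorem add_tens (A B : PMat D Ω Ω') (C : PMat D Ξ Ξ') :
    ten (A + B) C = ten A C + ten B C :=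
  ext' fun x => by
    funext i j
    exact _root_.add_mul (A.val x i.1 j.1) (B.val x i.1 j.1) (C.val x i.2 j.2)

omit [IsSeqComplete 𝔄] [T2Space 𝔄] in
@[simp] theorem tens_sub (A : PMat D Ω Ω') (B C : PMat D Ξ Ξ') :
    ten A (B - C) = ten A B - ten A C := by
  rw [eq_sub_iff_add_eq, ← tens_add, sub_add_cancel]

omit [IsSeqComplete 𝔄] [T2Space 𝔄] in
@[simp] theorem sub_tens (A B : PMat D Ω Ω') (C : PMat D Ξ Ξ') :
    ten (A - B) C = ten A C - ten B C := by
  rw [eq_sub_iff_add_eq, ← add_tens, sub_add_cancel]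

omit [IsSeqComplete 𝔄] [T2Space 𝔄] in
@[simp] theorem tens_zero (A : PMat D Ω Ω') : ten A (0 : PMat D Ξ Ξ') = 0 := by
  have h := tens_sub A (0 : PMat D Ξ Ξ') 0
  rwa [sub_self, sub_self] at h

omit [IsSeqComplete 𝔄] [T2Space 𝔄] in
@[simp] theorem zero_tens (A : PMat D Ξ Ξ') : ten (0 : PMat D Ω Ω') A = 0 := by
  have h := sub_tens (0 : PMat D Ω Ω') 0 A
  rwa [sub_self, sub_self] at h

@[simp] theorem tens_mul_tens (A : PMat D Ω Ω') (B : PMat D Ω' Ω'') (A' : PMat D Ξ Ξ')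
    (B' : PMat D Ξ' Ξ'') : ten A A' * ten B B' = ten (A * B) (A' * B') :=
  ext' fun x => (A.tame x).tens_mmul_tens (B.tame x) (A'.tame x) (B'.tame x)

@[simp] theorem tens_mul_tens_mul (A : PMat D Ω Ω') (B : PMat D Ω' Ω'') (A' : PMat D Ξ Ξ')
    (B' : PMat D Ξ' Ξ'') (E : PMat D (Ω'' × Ξ'') Θ) :
    ten A A' * (ten B B' * E) = ten (A * B) (A' * B') * E :=
  mul_mul_of_eq (tens_mul_tens A B A' B') E

omit [IsSeqComplete 𝔄] [T2Space 𝔄] in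
@[simp] theorem tens_one_one : ten (1 : PMat D Ω Ω) (1 : PMat D Ξ Ξ) = 1 :=
  ext' fun x => by
    funext i j
    by_cases h1 : i.1 = j.1 <;> by_cases h2 : i.2 = j.2 <;>
      simp [val_one, idm, Polymetric.hat, ten, Polymetric.tens, Prod.ext_iff, h1, h2]

/-! Rapidly decreasing matrices -/

omit [IsSeqComplete 𝔄] [T2Space 𝔄]

theorem Rapid.add {A B : PMat D Ω Ω'} (hA : A.Rapid) (hB : B.Rapid) : (A + B).Rapid :=
  fun x => (hA x).add (hB x)

theorem Rapid.neg {A : PMat D Ω Ω'} (hA : A.Rapid) : (-A).Rapid := fun x => (hA x).neg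

theorem Rapid.sub {A B : PMat D Ω Ω'} (hA : A.Rapid) (hB : B.Rapid) : (A - B).Rapid := by
  rw [sub_eq_add_neg]; exact hA.add hB.neg

theorem rapid_zero : (0 : PMat D Ω Ω').Rapid := fun _ =>
  ⟨fun _ _ => rfl, fun p _ k => ⟨0, fun _ _ => by simp [val_zero]⟩⟩

theorem Rapid.tens {A : PMat D Ω Ω'} {B : PMat D Ξ Ξ'} (hA : A.Rapid) (hB : B.Rapid) :
    (ten A B).Rapid := fun x => (hA x).tens (hB x)

theorem Rapid.mul [IsSeqComplete 𝔄] [T2Space 𝔄] {A : PMat D Ω Ω'} (hA : A.Rapid)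
    (B : PMat D Ω' Ω'') : (A * B).Rapid := fun x => (hA x).mul (B.tame x)

theorem Rapid.mul_left [IsSeqComplete 𝔄] [T2Space 𝔄] (A : PMat D Ω Ω') {B : PMat D Ω' Ω''}
    (hB : B.Rapid) : (A * B).Rapid := fun x => (A.tame x).mul_rapid (hB x)

@[refl] theorem Cong.refl (A : PMat D Ω Ω') : Cong A A := by
  rw [Cong, sub_self]; exact rapid_zero

theorem Cong.symm {A B : PMat D Ω Ω'} (h : Cong A B) : Cong B A := by
  have := h.neg
  rwa [neg_sub] at this

theorem Cong.trans {A B C : PMat D Ω Ω'} (h : Cong A B) (h' : Cong B C) : Cong A C := by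
  have := Rapid.add h h'
  rwa [sub_add_sub_cancel] at this

theorem Cong.add {A B A' B' : PMat D Ω Ω'} (h : Cong A A') (h' : Cong B B') :
    Cong (A + B) (A' + B') := by
  have := Rapid.add h h'
  rwa [sub_add_sub_comm] at this

theorem Cong.sub {A B A' B' : PMat D Ω Ω'} (h : Cong A A') (h' : Cong B B') :
    Cong (A - B) (A' - B') := by
  have := Rapid.sub h h'
  rwa [sub_sub_sub_comm] at this

theorem Cong.neg {A A' : PMat D Ω Ω'} (h : Cong A A') : Cong (-A) (-A') := by
  have := (Cong.refl 0).sub h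
  rwa [zero_sub, zero_sub] at this

/-- Rapidly decreasing matrices form a two-sided ideal among tame ones. -/
theorem Cong.mul [IsSeqComplete 𝔄] [T2Space 𝔄] {A A' : PMat D Ω Ω'} {B B' : PMat D Ω' Ω''}
    (h : Cong A A') (h' : Cong B B') : Cong (A * B) (A' * B') := by
  have := (Rapid.mul h B).add (Rapid.mul_left A' h')
  rwa [sub_mul, mul_sub, sub_add_sub_cancel] at this

theorem Cong.of_eq {A B : PMat D Ω Ω'} (h : A = B) : Cong A B := h ▸ Cong.refl A

/-! Relabeling matrices -/

variable [IsSeqComplete 𝔄]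

@[simp] theorem hatT_mul_hat (r : Ω → Ω') (hr : IsRelabeling r) :
    (hatT r hr : PMat D Ω Ω') * (hat r hr : PMat D Ω' Ω) = 1 :=
  ext' fun _ => hatT_mmul_hat hr.injective

theorem hat_mul_hatT (e : Ω ≃ Ω') (he : IsRelabeling e) :
    (hat e he : PMat D Ω' Ω) * (hatT e he : PMat D Ω Ω') = 1 :=
  ext' fun _ => by
    funext i j
    obtain ⟨i, rfl⟩ := e.surjective i
    change (Polymetric.hat e ⬝ₘ _) _ _ = _
    rw [hat_mmul e.injective]
    by_cases h : j = e i
    · simp [hatT, Polymetric.hat, val_one, idm, h]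
    · simp [hatT, Polymetric.hat, val_one, idm, h, Ne.symm h]

end PMat

/-- `Θ` as a disjoint union of `Ω` and `Ξ`, at the level of matrices. -/
structure Biprod [IsSeqComplete 𝔄] (D : PolyData X (Plus 𝔄)) (Ω Ξ Θ : Type) [SPG Ω] [SPG Ξ]
    [SPG Θ] where
  i0 : PMat D Θ Ω
  i1 : PMat D Θ Ξ
  p0 : PMat D Ω Θ
  p1 : PMat D Ξ Θ
  p0_i0 : p0 * i0 = 1
  p1_i1 : p1 * i1 = 1
  p0_i1 : p0 * i1 = 0
  p1_i0 : p1 * i0 = 0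
  total : i0 * p0 + i1 * p1 = 1

attribute [simp] Biprod.p0_i0 Biprod.p1_i1 Biprod.p0_i1 Biprod.p1_i0

/-! ### Block matrices, uniformly for `Ω ⊕ Ξ` and `{0,1} × Ω`. -/

section Blocks

variable [IsSeqComplete 𝔄]

/-- The decomposition of `Ω ⊕ Ξ`. -/
noncomputable def sumBiprod (D : PolyData X (Plus 𝔄)) (Ω Ξ : Type) [SPG Ω] [SPG Ξ] :
    Biprod D Ω Ξ (Ω ⊕ Ξ) where
  i0 := .hat Sum.inl isRelabeling_inl
  i1 := .hat Sum.inr isRelabeling_inr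
  p0 := .hatT Sum.inl isRelabeling_inl
  p1 := .hatT Sum.inr isRelabeling_inr
  p0_i0 := PMat.hatT_mul_hat _ _
  p1_i1 := PMat.hatT_mul_hat _ _
  p0_i1 := PMat.ext' fun _ => hatT_mmul_hat_of_ne (by simp)
  p1_i0 := PMat.ext' fun _ => hatT_mmul_hat_of_ne (by simp)
  total := PMat.ext' fun _ => hat_mmul_hatT_add Sum.inl_injective Sum.inr_injective (by simp)
    (by rintro (x | x) <;> simp)

/-- The decomposition of `{0,1} × Ω`. -/
noncomputable def finBiprod (D : PolyData X (Plus 𝔄)) (Ω : Type) [SPG Ω] :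
    Biprod D Ω Ω (Fin 2 × Ω) where
  i0 := .hat _ isRelabeling_zero
  i1 := .hat _ isRelabeling_one
  p0 := .hatT _ isRelabeling_zero
  p1 := .hatT _ isRelabeling_one
  p0_i0 := PMat.hatT_mul_hat _ _
  p1_i1 := PMat.hatT_mul_hat _ _
  p0_i1 := PMat.ext' fun _ => hatT_mmul_hat_of_ne (by simp)
  p1_i0 := PMat.ext' fun _ => hatT_mmul_hat_of_ne (by simp)
  total := PMat.ext' fun _ => hat_mmul_hatT_add (Prod.mk_right_injective _)
    (Prod.mk_right_injective _) (by simp) fin_two_cover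

namespace Biprod

/-- Block matrices. -/
noncomputable def blk (β : Biprod D Ω Ξ Θ) (β' : Biprod D Ω' Ξ' Θ') (A : PMat D Ω Ω')
    (B : PMat D Ω Ξ') (C : PMat D Ξ Ω') (E : PMat D Ξ Ξ') : PMat D Θ Θ' :=
  β.i0 * A * β'.p0 + β.i0 * B * β'.p1 + β.i1 * C * β'.p0 + β.i1 * E * β'.p1

variable [T2Space 𝔄] {β : Biprod D Ω Ξ Θ} {β' : Biprod D Ω' Ξ' Θ'} {β'' : Biprod D Ω'' Ξ'' Θ''}

@[simp] theorem p0_i0_mul (β : Biprod D Ω Ξ Θ) (A : PMat D Ω Ω') : β.p0 * (β.i0 * A) = A := by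
  rw [PMat.mul_mul_of_eq β.p0_i0, PMat.one_mul]

@[simp] theorem p1_i1_mul (β : Biprod D Ω Ξ Θ) (A : PMat D Ξ Ω') : β.p1 * (β.i1 * A) = A := by
  rw [PMat.mul_mul_of_eq β.p1_i1, PMat.one_mul]

@[simp] theorem p0_i1_mul (β : Biprod D Ω Ξ Θ) (A : PMat D Ξ Ω') : β.p0 * (β.i1 * A) = 0 := by
  rw [PMat.mul_mul_of_eq β.p0_i1, PMat.zero_mul]

@[simp] theorem p1_i0_mul (β : Biprod D Ω Ξ Θ) (A : PMat D Ω Ω') : β.p1 * (β.i0 * A) = 0 := by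
  rw [PMat.mul_mul_of_eq β.p1_i0, PMat.zero_mul]

theorem blk_mul (A : PMat D Ω Ω') (B : PMat D Ω Ξ') (C : PMat D Ξ Ω') (E : PMat D Ξ Ξ')
    (A' : PMat D Ω' Ω'') (B' : PMat D Ω' Ξ'') (C' : PMat D Ξ' Ω'') (E' : PMat D Ξ' Ξ'') :
    blk β β' A B C E * blk β' β'' A' B' C' E' =
      blk β β'' (A * A' + B * C') (A * B' + B * E') (C * A' + E * C') (C * B' + E * E') := by
  simp only [blk, PMat.mul_add, PMat.add_mul, PMat.mul_assoc, p0_i0_mul, p1_i1_mul, p0_i1_mul,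
    p1_i0_mul, PMat.mul_zero]
  abel

theorem blk_add (A A' : PMat D Ω Ω') (B B' : PMat D Ω Ξ') (C C' : PMat D Ξ Ω')
    (E E' : PMat D Ξ Ξ') : blk β β' A B C E + blk β β' A' B' C' E' =
      blk β β' (A + A') (B + B') (C + C') (E + E') := by
  simp only [blk, PMat.mul_add, PMat.add_mul]
  abel

theorem blk_sub (A A' : PMat D Ω Ω') (B B' : PMat D Ω Ξ') (C C' : PMat D Ξ Ω')
    (E E' : PMat D Ξ Ξ') : blk β β' A B C E - blk β β' A' B' C' E' =
      blk β β' (A - A') (B - B') (C - C') (E - E') := by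
  simp only [blk, PMat.mul_sub, PMat.sub_mul]
  abel

theorem blk_one : blk β β 1 0 0 1 = 1 := by
  simp [blk, β.total]

theorem blk_cong {A A' : PMat D Ω Ω'} {B B' : PMat D Ω Ξ'} {C C' : PMat D Ξ Ω'}
    {E E' : PMat D Ξ Ξ'} (hA : A.Cong A') (hB : B.Cong B') (hC : C.Cong C') (hE : E.Cong E') :
    (blk β β' A B C E).Cong (blk β β' A' B' C' E') :=
  ((((PMat.Cong.refl _).mul hA).mul (.refl _)).add (((PMat.Cong.refl _).mul hB).mul (.refl _))
    |>.add (((PMat.Cong.refl _).mul hC).mul (.refl _))).add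
    (((PMat.Cong.refl _).mul hE).mul (.refl _))

end Biprod

end Blocks

end PMat

/-! ### Conjugation by units in `1 + 𝒦` after stabilization. -/

section Homotopy

variable {𝔄 : Type u} [NonUnitalCommRing 𝔄] [TopologicalSpace 𝔄] [PolymetricRing 𝔄]
  [IsSeqComplete 𝔄] [T2Space 𝔄] {X : Type v} {D : PolyData X (Plus 𝔄)}
  {Ω Ω' Ω'' Ξ Ξ' Θ Θ' : Type} [SPG Ω] [SPG Ω'] [SPG Ω''] [SPG Ξ] [SPG Ξ'] [SPG Θ] [SPG Θ']

/-- `g` and `g'` are inverse to each other, and of the form `1 + A` with `A` rapidly decreasing. -/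
structure IsKUnit (g g' : PMat D Ω Ω) : Prop where
  mul_inv : g * g' = 1
  inv_mul : g' * g = 1
  cong : g.Cong 1
  cong_inv : g'.Cong 1

theorem IsKUnit.one : IsKUnit (1 : PMat D Ω Ω) 1 := ⟨by simp, by simp, .refl _, .refl _⟩

theorem IsKUnit.symm {g g' : PMat D Ω Ω} (h : IsKUnit g g') : IsKUnit g' g :=
  ⟨h.inv_mul, h.mul_inv, h.cong_inv, h.cong⟩

theorem IsKUnit.mul {g g' h h' : PMat D Ω Ω} (hg : IsKUnit g g') (hh : IsKUnit h h') :
    IsKUnit (g * h) (h' * g') where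
  mul_inv := by rw [PMat.mul_assoc, PMat.mul_mul_of_eq hh.mul_inv, PMat.one_mul, hg.mul_inv]
  inv_mul := by rw [PMat.mul_assoc, PMat.mul_mul_of_eq hg.inv_mul, PMat.one_mul, hh.inv_mul]
  cong := by simpa using hg.cong.mul hh.cong
  cong_inv := by simpa using hh.cong_inv.mul hg.cong_inv

/-- Two units which agree modulo rapidly decreasing matrices. -/
theorem IsKUnit.of_cong {g g' h h' : PMat D Ω Ω} (hg : g * g' = 1) (hg' : g' * g = 1)
    (hh : h * h' = 1) (hh' : h' * h = 1) (hc : g.Cong h) : IsKUnit (g * h') (h * g') where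
  mul_inv := by rw [PMat.mul_assoc, PMat.mul_mul_of_eq hh', PMat.one_mul, hg]
  inv_mul := by rw [PMat.mul_assoc, PMat.mul_mul_of_eq hg', PMat.one_mul, hh]
  cong := by simpa [hh] using hc.mul (.refl h')
  cong_inv := by simpa [hg] using hc.symm.mul (.refl g')

/-- `b` and `b'` become conjugate by a unit of the form `1 + A`, with `A` rapidly decreasing, after
stabilization by `e`. -/
def Hom (β : Biprod D Ω Ω Θ) (e b b' : PMat D Ω Ω) : Prop :=
  ∃ g g' : PMat D Θ Θ, IsKUnit g g' ∧
    g * Biprod.blk β β b 0 0 e = Biprod.blk β β b' 0 0 e * g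

variable {β : Biprod D Ω Ω Θ} {e : PMat D Ω Ω}

theorem Hom.refl (b : PMat D Ω Ω) : Hom β e b b := ⟨1, 1, .one, by simp⟩

theorem Hom.symm {b b' : PMat D Ω Ω} (h : Hom β e b b') : Hom β e b' b := by
  obtain ⟨g, g', hg, h⟩ := h
  refine ⟨g', g, hg.symm, ?_⟩
  calc g' * Biprod.blk β β b' 0 0 e = g' * (Biprod.blk β β b' 0 0 e * g) * g' := by
        simp [hg.mul_inv]
    _ = Biprod.blk β β b 0 0 e * g' := by
        rw [← h, PMat.mul_mul_of_eq hg.inv_mul, PMat.one_mul]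

theorem Hom.trans {b b' b'' : PMat D Ω Ω} (h : Hom β e b b') (h' : Hom β e b' b'') :
    Hom β e b b'' := by
  obtain ⟨g, g', hg, h⟩ := h
  obtain ⟨k, k', hk, h'⟩ := h'
  refine ⟨k * g, g' * k', hk.mul hg, ?_⟩
  rw [PMat.mul_assoc, h, ← PMat.mul_assoc, h', PMat.mul_assoc]

open Biprod

/-- Upper triangular elementary block matrices. -/
noncomputable def upper (β : Biprod D Ω Ξ Θ) (N : PMat D Ω Ξ) : PMat D Θ Θ := blk β β 1 N 0 1

/-- Lower triangular elementary block matrices. -/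
noncomputable def lower (β : Biprod D Ω Ξ Θ) (N : PMat D Ξ Ω) : PMat D Θ Θ := blk β β 1 0 N 1

section

variable {β : Biprod D Ω Ξ Θ}

theorem upper_mul_neg (N : PMat D Ω Ξ) : upper β N * upper β (-N) = 1 := by
  simp [upper, blk_mul, blk_one]

theorem lower_mul_neg (N : PMat D Ξ Ω) : lower β N * lower β (-N) = 1 := by
  simp [lower, blk_mul, blk_one]

/-- A product of elementary block matrices. -/
noncomputable def elem (β : Biprod D Ω Ξ Θ) (N₁ : PMat D Ω Ξ) (N₂ : PMat D Ξ Ω) (N₃ : PMat D Ω Ξ)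
    (N₄ : PMat D Ξ Ω) : PMat D Θ Θ :=
  upper β N₁ * (lower β (-N₂) * (upper β N₁ * (upper β (-N₃) * (lower β N₄ * upper β (-N₃)))))

/-- The inverse of the product `elem` of elementary block matrices. -/
noncomputable def elemInv (β : Biprod D Ω Ξ Θ) (N₁ : PMat D Ω Ξ) (N₂ : PMat D Ξ Ω)
    (N₃ : PMat D Ω Ξ) (N₄ : PMat D Ξ Ω) : PMat D Θ Θ :=
  upper β N₃ * (lower β (-N₄) * (upper β N₃ * (upper β (-N₁) * (lower β N₂ * upper β (-N₁)))))

theorem elem_mul_elemInv (N₁ : PMat D Ω Ξ) (N₂ : PMat D Ξ Ω) (N₃ : PMat D Ω Ξ)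
    (N₄ : PMat D Ξ Ω) : elem β N₁ N₂ N₃ N₄ * elemInv β N₁ N₂ N₃ N₄ = 1 := by
  have h3 : upper β (-N₃) * upper β N₃ = 1 := by simpa using upper_mul_neg (β := β) (-N₃)
  have h2 : lower β (-N₂) * lower β N₂ = 1 := by simpa using lower_mul_neg (β := β) (-N₂)
  simp only [elem, elemInv, PMat.mul_assoc, PMat.mul_mul_of_eq h3, PMat.one_mul,
    PMat.mul_mul_of_eq (lower_mul_neg N₄), PMat.mul_mul_of_eq (upper_mul_neg N₁),
    PMat.mul_mul_of_eq h2, upper_mul_neg]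

/-- `elemInv` is `elem` with the pairs `(N₁, N₂)` and `(N₃, N₄)` exchanged. -/
theorem elemInv_mul_elem (N₁ : PMat D Ω Ξ) (N₂ : PMat D Ξ Ω) (N₃ : PMat D Ω Ξ)
    (N₄ : PMat D Ξ Ω) : elemInv β N₁ N₂ N₃ N₄ * elem β N₁ N₂ N₃ N₄ = 1 :=
  elem_mul_elemInv N₃ N₄ N₁ N₂

theorem elem_cong {N₁ M₁ : PMat D Ω Ξ} {N₂ M₂ : PMat D Ξ Ω} {N₃ M₃ : PMat D Ω Ξ}
    {N₄ M₄ : PMat D Ξ Ω} (h₁ : N₁.Cong M₁) (h₂ : N₂.Cong M₂) (h₃ : N₃.Cong M₃) (h₄ : N₄.Cong M₄) :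
    (elem β N₁ N₂ N₃ N₄).Cong (elem β M₁ M₂ M₃ M₄) := by
  have hu : ∀ {N M : PMat D Ω Ξ}, N.Cong M → (upper β N).Cong (upper β M) := fun h =>
    blk_cong (.refl _) h (.refl _) (.refl _)
  have hl : ∀ {N M : PMat D Ξ Ω}, N.Cong M → (lower β N).Cong (lower β M) := fun h =>
    blk_cong (.refl _) (.refl _) h (.refl _)
  exact (hu h₁).mul ((hl h₂.neg).mul ((hu h₁).mul ((hu h₃.neg).mul ((hl h₄).mul (hu h₃.neg)))))

/-- An elementary matrix commutes with `b ⊕ e` as soon as its off-diagonal entry intertwines `b` and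
`e`. -/
theorem elem_commute {N₁ : PMat D Ω Ξ} {N₂ : PMat D Ξ Ω} {N₃ : PMat D Ω Ξ}
    {N₄ : PMat D Ξ Ω} {b : PMat D Ω Ω} {e : PMat D Ξ Ξ} (h₁ : N₁ * e = b * N₁)
    (h₂ : N₂ * b = e * N₂) (h₃ : N₃ * e = b * N₃) (h₄ : N₄ * b = e * N₄) :
    elem β N₁ N₂ N₃ N₄ * blk β β b 0 0 e = blk β β b 0 0 e * elem β N₁ N₂ N₃ N₄ := by
  have hu : ∀ {N : PMat D Ω Ξ}, N * e = b * N →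
      upper β N * blk β β b 0 0 e = blk β β b 0 0 e * upper β N := fun h => by
    simp [upper, blk_mul, h]
  have hl : ∀ {N : PMat D Ξ Ω}, N * b = e * N →
      lower β N * blk β β b 0 0 e = blk β β b 0 0 e * lower β N := fun h => by
    simp [lower, blk_mul, h]
  have hun : ∀ {N : PMat D Ω Ξ}, N * e = b * N →
      upper β (-N) * blk β β b 0 0 e = blk β β b 0 0 e * upper β (-N) := fun h =>
    hu (by simp [h])
  have hln : ∀ {N : PMat D Ξ Ω}, N * b = e * N →
      lower β (-N) * blk β β b 0 0 e = blk β β b 0 0 e * lower β (-N) := fun h =>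
    hl (by simp [h])
  simp only [elem, PMat.mul_assoc, hun h₃]
  rw [PMat.mul_mul_of_eq (hl h₄), PMat.mul_assoc, PMat.mul_mul_of_eq (hun h₃), PMat.mul_assoc,
    PMat.mul_mul_of_eq (hu h₁), PMat.mul_assoc, PMat.mul_mul_of_eq (hln h₂), PMat.mul_assoc,
    PMat.mul_mul_of_eq (hu h₁), PMat.mul_assoc]

end

/-- The second triple of factors is a quarter turn that undoes the first one at `p = q = 1`. What
remains is the invertible dilation of the partial isometry `p`. -/
theorem elem_eq {p q : PMat D Ω Ω} (h : p * (q * p) = p) :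
    elem β p q 1 1 = blk β β p (p * q - 1) (1 - q * p) q := by
  simp only [elem, upper, lower, blk_mul, PMat.mul_one, PMat.one_mul, PMat.zero_mul, PMat.mul_zero,
    PMat.mul_neg, PMat.neg_mul, PMat.mul_add, h, neg_neg]
  congr 1 <;> abel

/-- Moving the difference term by a partial isometry which commutes with the base term. -/
theorem Hom.of_partial {b p q : PMat D Ω Ω} (he : e * e = e) (hb : b * b = b) (hc : b.Cong e)
    (hp : p * e = e * p) (hq : q * e = e * q) (hpq : p * (q * p) = p)
    (h₁ : q * (p * (b - e)) = b - e) (h₂ : (b - e) * (q * p) = b - e) :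
    Hom β e b (e + p * (b - e) * q) := by
  have hee := PMat.mul_mul_of_eq he (Ω₃ := Ω)
  have hbb := PMat.mul_mul_of_eq hb (Ω₃ := Ω)
  -- A matrix commuting with `e` is the sum of its two diagonal corners. Replacing `e` by the nearby
  -- idempotents `c` and `d` changes it only by a rapidly decreasing matrix, and by `comm` the
  -- result intertwines `c` and `d`.
  have lift : ∀ {c d N : PMat D Ω Ω}, c * c = c → d * d = d → c.Cong e → d.Cong e →
      N * e = e * N → N.Cong (c * N * d + (1 - c) * N * (1 - d)) := by
    intro c d N _ _ hce hde hN
    have h3 : e * N * e + (1 - e) * N * (1 - e) = N := by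
      simp [hN, PMat.mul_mul_of_eq he]
    refine (PMat.Cong.of_eq h3.symm).trans ?_
    exact ((hce.symm.mul (.refl _)).mul hde.symm).add
      ((((PMat.Cong.refl _).sub hce.symm).mul (.refl _)).mul ((PMat.Cong.refl _).sub hde.symm))
  have comm : ∀ {c d N : PMat D Ω Ω}, c * c = c → d * d = d →
      (c * N * d + (1 - c) * N * (1 - d)) * d = c * (c * N * d + (1 - c) * N * (1 - d)) := by
    intro c d N h3 h4
    simp [h4, PMat.mul_mul_of_eq h3]
  have h1e : (1 : PMat D Ω Ω) * e = e * 1 := by simp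
  have hcong := elem_cong (β := β) (lift hb he hc (.refl e) hp) (lift he hb (.refl e) hc hq)
    (lift hb he hc (.refl e) h1e) (lift he hb (.refl e) hc h1e)
  have hcomm := elem_commute (β := β) (comm (N := p) hb he) (comm (N := q) he hb)
    (comm (N := 1) hb he) (comm (N := 1) he hb)
  revert hcong hcomm
  generalize b * p * e + (1 - b) * p * (1 - e) = N₁
  generalize e * q * b + (1 - e) * q * (1 - b) = N₂
  generalize b * 1 * e + (1 - b) * 1 * (1 - e) = N₃
  generalize e * 1 * b + (1 - e) * 1 * (1 - b) = N₄
  intro hcong hcomm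
  -- The conjugating unit is `elem p q 1 1 * elemInv N₁ N₂ N₃ N₄`. It lies in `1 + 𝒦` since `Nᵢ`
  -- agree with `p`, `q`, `1`, `1` modulo rapidly decreasing matrices, and its second factor does
  -- not move `b ⊕ e`.
  refine ⟨_, _, IsKUnit.of_cong (elem_mul_elemInv p q 1 1) (elemInv_mul_elem p q 1 1)
    (elem_mul_elemInv N₁ N₂ N₃ N₄) (elemInv_mul_elem N₁ N₂ N₃ N₄) hcong, ?_⟩
  have hinv : elemInv β N₁ N₂ N₃ N₄ * blk β β b 0 0 e =
      blk β β b 0 0 e * elemInv β N₁ N₂ N₃ N₄ := by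
    calc elemInv β N₁ N₂ N₃ N₄ * blk β β b 0 0 e
        = elemInv β N₁ N₂ N₃ N₄ * (blk β β b 0 0 e * elem β N₁ N₂ N₃ N₄) *
          elemInv β N₁ N₂ N₃ N₄ := by simp [elem_mul_elemInv]
      _ = _ := by
        rw [← hcomm, PMat.mul_mul_of_eq (elemInv_mul_elem N₁ N₂ N₃ N₄), PMat.one_mul]
  -- The off-diagonal blocks match because `q * p` fixes `b - e` from both sides, so the defects `1
  -- - q * p` and `p * q - 1` see only `e`.
  have hmain : elem β p q 1 1 * blk β β b 0 0 e =
      blk β β (e + p * (b - e) * q) 0 0 e * elem β p q 1 1 := by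
    obtain ⟨Y, rfl⟩ : ∃ Y, b = e + Y := ⟨b - e, by abel⟩
    simp only [add_sub_cancel_left] at h₁ h₂ ⊢
    have hq' := fun N : PMat D Ω Ω => PMat.mul_mul_of_eq hq N
    have h₂' := fun N : PMat D Ω Ω => PMat.mul_mul_of_eq h₂ N
    simp only [PMat.mul_assoc] at hq' h₂'
    have hpe := PMat.mul_mul_of_eq hp q
    simp only [PMat.mul_assoc] at hpe
    rw [elem_eq hpq, blk_mul, blk_mul]
    congr 1 <;> simp [hp, hq, hpe, hq', h₁, h₂, h₂']
  rw [PMat.mul_assoc, hinv, ← PMat.mul_assoc, hmain, PMat.mul_assoc]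

/-- `u`, `v` is an isometry which carries the idempotent `a` to a part of `e`. -/
structure IsIso (e : PMat D Θ Θ) (a : PMat D Ω Ω) (u : PMat D Θ Ω) (v : PMat D Ω Θ) : Prop where
  inv_mul : v * u = 1
  mul_eq : e * u = u * a
  eq_mul : v * e = a * v

theorem IsIso.one : IsIso e e 1 1 := ⟨by simp, by simp, by simp⟩

theorem IsIso.trans {a : PMat D Ξ Ξ} {c : PMat D Ξ' Ξ'} {u : PMat D Ω Ξ} {v : PMat D Ξ Ω}
    {w : PMat D Ξ Ξ'} {z : PMat D Ξ' Ξ} (h : IsIso e a u v) (h' : IsIso a c w z) :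
    IsIso e c (u * w) (z * v) where
  inv_mul := by simp [PMat.mul_mul_of_eq h.inv_mul, h'.inv_mul]
  mul_eq := by rw [← PMat.mul_assoc, h.mul_eq, PMat.mul_assoc, h'.mul_eq, PMat.mul_assoc]
  eq_mul := by rw [PMat.mul_assoc, h.eq_mul, ← PMat.mul_assoc, h'.eq_mul, PMat.mul_assoc]

/-- The realization of a pair over a fixed base does not depend on the isometry: `u' * v` is a
partial isometry that commutes with `e` and carries one copy to the other. -/
theorem Hom.of_isIso {a b : PMat D Ξ Ξ} {u u' : PMat D Ω Ξ} {v v' : PMat D Ξ Ω} (he : e * e = e)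
    (hb : b * b = b) (ha : a * a = a) (hc : b.Cong a) (h : IsIso e a u v) (h' : IsIso e a u' v') :
    Hom β e (e + u * (b - a) * v) (e + u' * (b - a) * v') := by
  have r1 := h.inv_mul
  have r2 := h.mul_eq
  have r3 := h.eq_mul
  have r4 := h'.inv_mul
  have r5 := h'.mul_eq
  have r6 := h'.eq_mul
  have q1 := fun N : PMat D Ξ Ω => PMat.mul_mul_of_eq r1 N
  have q2 := fun N : PMat D Ξ Ω => PMat.mul_mul_of_eq r2 N
  have q4 := fun N : PMat D Ξ Ω => PMat.mul_mul_of_eq r4 N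
  have q5 := fun N : PMat D Ξ Ω => PMat.mul_mul_of_eq r5 N
  have qa := fun N : PMat D Ξ Ω => PMat.mul_mul_of_eq ha N
  have qb := fun N : PMat D Ξ Ω => PMat.mul_mul_of_eq hb N
  simp only [PMat.one_mul, PMat.mul_assoc] at q1 q2 q4 q5 qa qb
  have key := Hom.of_partial (β := β) (b := e + u * (b - a) * v) (p := u' * v) (q := u * v') he
    (by simp [he, q1, q2, r3, qb, qa]; abel)
    (by
      have := (PMat.Cong.refl e).add (((PMat.Cong.refl u).mul
        (hc.sub (PMat.Cong.refl a))).mul (.refl v))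
      simpa using this)
    (by simp [r3, q5]) (by simp [r6, q2]) (by simp [q1, q4])
    (by simp [q1, q4]) (by simp [q1, q4])
  refine key.trans ?_
  have : u' * v * (e + u * (b - a) * v - e) * (u * v') = u' * (b - a) * v' := by
    simp [q1]
  rw [this]
  exact .refl _

/-- Extend `g` by the identity outside the image of `u`, as `1 + u * (g - 1) * v`. No commutation of
`g` with `a` is needed, since the contributions of `a` cancel. -/
theorem Hom.of_unit {a b b' g g' : PMat D Ξ Ξ} {u : PMat D Ω Ξ} {v : PMat D Ξ Ω}
    (hg : IsKUnit g g') (hgb : g * b = b' * g) (h : IsIso e a u v) :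
    Hom β e (e + u * (b - a) * v) (e + u * (b' - a) * v) := by
  have r1 := h.inv_mul
  have r2 := h.mul_eq
  have r3 := h.eq_mul
  have q1 := fun N : PMat D Ξ Ω => PMat.mul_mul_of_eq r1 N
  have q2 := fun N : PMat D Ξ Ω => PMat.mul_mul_of_eq r2 N
  have qg := fun N : PMat D Ξ Ω => PMat.mul_mul_of_eq hg.mul_inv N
  have qg' := fun N : PMat D Ξ Ω => PMat.mul_mul_of_eq hg.inv_mul N
  have qgb := fun N : PMat D Ξ Ω => PMat.mul_mul_of_eq hgb N
  simp only [PMat.one_mul, PMat.mul_assoc] at q1 q2 qg qg' qgb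
  have hcong : ∀ {k : PMat D Ξ Ξ}, k.Cong 1 → (1 + u * (k - 1) * v).Cong 1 := fun hk => by
    have := (PMat.Cong.refl (1 : PMat D Ω Ω)).add (((PMat.Cong.refl u).mul
      (hk.sub (PMat.Cong.refl 1))).mul (.refl v))
    simpa using this
  refine ⟨blk β β (1 + u * (g - 1) * v) 0 0 1, blk β β (1 + u * (g' - 1) * v) 0 0 1,
    ⟨?_, ?_, ?_, ?_⟩, ?_⟩
  · rw [blk_mul, ← blk_one (β := β)]
    congr 1
    · simp [q1, qg]
      abel
    all_goals simp
  · rw [blk_mul, ← blk_one (β := β)]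
    congr 1
    · simp [q1, qg']
      abel
    all_goals simp
  · rw [← blk_one (β := β)]
    exact blk_cong (hcong hg.cong) (.refl _) (.refl _) (.refl _)
  · rw [← blk_one (β := β)]
    exact blk_cong (hcong hg.cong_inv) (.refl _) (.refl _) (.refl _)
  · rw [blk_mul, blk_mul]
    congr 1
    · simp [q1, q2, r3, qgb]
      abel
    all_goals simp

end Homotopy

/-! ### Pairs of idempotents, stable equivalence, and its passage to homotopy. -/

section Pairs

variable {𝔄 : Type u} [NonUnitalCommRing 𝔄] [TopologicalSpace 𝔄] [PolymetricRing 𝔄]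
  [IsSeqComplete 𝔄] [T2Space 𝔄] {X : Type v}

/-- Pairs of idempotents with rapidly decreasing difference, assembled polynomially. -/
structure PPair (D : PolyData X (Plus 𝔄)) (Ω : Type) [SPG Ω] where
  b : PMat D Ω Ω
  a : PMat D Ω Ω
  bb : b * b = b
  aa : a * a = a
  cong : b.Cong a

attribute [simp] PPair.bb PPair.aa

variable {D : PolyData X (Plus 𝔄)} {Ω Ω' Ω'' Ξ Ξ' Θ Θ' : Type} [SPG Ω] [SPG Ω'] [SPG Ω''] [SPG Ξ]
  [SPG Ξ'] [SPG Θ] [SPG Θ']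

/-- `y` arises from `x` by an isometric embedding and by adding the same idempotent to both
terms. -/
structure IsExt (x : PPair D Ω) (y : PPair D Θ) (u : PMat D Θ Ω) (v : PMat D Ω Θ) : Prop where
  iso : IsIso y.a x.a u v
  eq : y.b = y.a + u * (x.b - x.a) * v

/-- The stable equivalence of pairs. -/
inductive Eqv : {Ω Ω' : Type} → [SPG Ω] → [SPG Ω'] → PPair D Ω → PPair D Ω' → Prop
  | symm {Ω Ω' : Type} [SPG Ω] [SPG Ω'] {x : PPair D Ω} {y : PPair D Ω'} (h : Eqv x y) : Eqv y x
  | trans {Ω Ω' Ω'' : Type} [SPG Ω] [SPG Ω'] [SPG Ω''] {x : PPair D Ω} {y : PPair D Ω'}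
      {z : PPair D Ω''} (h : Eqv x y) (h' : Eqv y z) : Eqv x z
  | ext {Ω Ω' : Type} [SPG Ω] [SPG Ω'] {x : PPair D Ω} {y : PPair D Ω'} {u : PMat D Ω' Ω}
      {v : PMat D Ω Ω'} (h : IsExt x y u v) : Eqv x y
  | unit {Ω : Type} [SPG Ω] {x y : PPair D Ω} {g g' : PMat D Ω Ω} (hg : IsKUnit g g')
      (ha : x.a = y.a) (hb : g * x.b = y.b * g) : Eqv x y

theorem Eqv.refl (x : PPair D Ω) : Eqv x x :=
  .ext (u := 1) (v := 1) ⟨.one, by simp⟩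

/-- The base term of the Grassmannian. -/
noncomputable def gBase (D : PolyData X (Plus 𝔄)) : PMat D GIdx GIdx :=
  Biprod.blk (finBiprod D ℕ) (finBiprod D ℕ) 0 0 0 1

theorem gBase_mul_self : gBase D * gBase D = gBase D := by
  simp [gBase, Biprod.blk_mul]

/-- The embedding of `⟨b, a⟩` into its regularization. -/
noncomputable def regIn (β : Biprod D Ω Ω Θ) (a : PMat D Ω Ω) : PMat D Θ Ω :=
  β.i0 * (1 - a) + β.i1 * a

/-- The left inverse of `regIn`. -/
noncomputable def regOut (β : Biprod D Ω Ω Θ) (a : PMat D Ω Ω) : PMat D Ω Θ :=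
  (1 - a) * β.p0 + a * β.p1

/-- The embedding puts the range of `a` into the second copy and its complement into the first, so
`0 ⊕ 1` restricts to `a`. -/
theorem isIso_reg {β : Biprod D Ω Ω Θ} {a : PMat D Ω Ω} (ha : a * a = a) :
    IsIso (Biprod.blk β β 0 0 0 1) a (regIn β a) (regOut β a) where
  inv_mul := by simp [regIn, regOut, ha]
  mul_eq := by simp [regIn, Biprod.blk, ha]
  eq_mul := by simp [regOut, Biprod.blk, PMat.mul_mul_of_eq ha]

variable (D Ω) in
-- Adjoining `ℕ` makes the index set infinite, hence identified with `ℕ`; finite and infinite `Ω`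
-- are thus treated alike.
theorem exists_isometry : ∃ (s : PMat D ℕ Ω) (t : PMat D Ω ℕ), t * s = 1 := by
  rcases SPG.isSPG (Ω := Ω ⊕ ℕ) with h | ⟨q, h₁, h₂⟩
  · exact absurd (Finite.of_injective (Sum.inr : ℕ → Ω ⊕ ℕ) Sum.inr_injective)
      (Infinite.not_finite)
  · have hq : IsRelabeling q := IsRelabeling.of_equiv q h₁ h₂
    refine ⟨PMat.hat (D := D) q hq * (sumBiprod D Ω ℕ).i0, (sumBiprod D Ω ℕ).p0 * PMat.hatT (D := D) q hq, ?_⟩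
    have h := PMat.hatT_mul_hat (D := D) q hq
    rw [PMat.mul_assoc, PMat.mul_mul_of_eq h, PMat.one_mul, Biprod.p0_i0]

/-- The fixed base absorbs every idempotent: transport `a` to `ℕ`, then use the embedding into its
regularization. -/
theorem exists_isIso_gBase {a : PMat D Ω Ω} (ha : a * a = a) :
    ∃ u v, IsIso (gBase D) a u v := by
  obtain ⟨s, t, hts⟩ := exists_isometry D Ω
  have q := fun N : PMat D Ω Ω => PMat.mul_mul_of_eq hts N
  have q' := fun N : PMat D Ω ℕ => PMat.mul_mul_of_eq hts N
  have qa := fun N : PMat D Ω ℕ => PMat.mul_mul_of_eq ha N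
  have h1 : IsIso (s * a * t) a s t := ⟨hts, by simp [hts], by simp [q']⟩
  exact ⟨_, _, (isIso_reg (a := s * a * t) (by simp [q', qa])).trans h1⟩

/-- Quantifying over all realizing isometries lets the induction go through, since intermediate
pairs live over unrelated index sets. One stabilization suffices for the whole chain. -/
theorem Eqv.hom {β : Biprod D GIdx GIdx Θ} {x : PPair D Ω} {y : PPair D Ω'} (h : Eqv x y) :
    ∀ {u : PMat D GIdx Ω} {v : PMat D Ω GIdx} {u' : PMat D GIdx Ω'} {v' : PMat D Ω' GIdx},
      IsIso (gBase D) x.a u v → IsIso (gBase D) y.a u' v' →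
      Hom β (gBase D) (gBase D + u * (x.b - x.a) * v) (gBase D + u' * (y.b - y.a) * v') := by
  induction h with
  | symm _ ih => exact fun h h' => (ih h' h).symm
  | @trans _ _ _ _ _ _ _ y _ _ _ ih ih' =>
    intro u v u' v' h h'
    obtain ⟨w, z, hw⟩ := exists_isIso_gBase y.aa
    exact (ih h hw).trans (ih' hw h')
  | @ext Ω Ω' _ _ x y w z hxy =>
    intro u v u' v' h h'
    -- Realizing the extension `y` by `u'` is the same as realizing `x` by `u' * w`.
    have h2 := Hom.of_isIso (β := β) gBase_mul_self x.bb x.aa x.cong h (h'.trans hxy.iso)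
    have e : u' * (y.b - y.a) * v' = (u' * w) * (x.b - x.a) * (z * v') := by
      rw [hxy.eq]; simp
    rwa [e]
  | @unit Ω _ x y g g' hg ha hb =>
    intro u v u' v' h h'
    have h2 := Hom.of_isIso (β := β) gBase_mul_self x.bb x.aa x.cong h (ha ▸ h')
    have h3 := Hom.of_unit (β := β) hg hb h'
    rw [ha] at h2 ⊢
    exact h2.trans h3

theorem Eqv.hom_of_base {β : Biprod D GIdx GIdx Θ} {x y : PPair D GIdx} (h : Eqv x y)
    (hx : x.a = gBase D) (hy : y.a = gBase D) : Hom β (gBase D) x.b y.b := by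
  have := h.hom (β := β) (u := 1) (v := 1) (u' := 1) (v' := 1) (hx ▸ .one) (hy ▸ .one)
  simpa [hx, hy] using this

end Pairs

/-! ### Ring identities for pairs up to stable equivalence. -/

section Algebra

variable {𝔄 : Type u} [NonUnitalCommRing 𝔄] [TopologicalSpace 𝔄] [PolymetricRing 𝔄]
  [IsSeqComplete 𝔄] [T2Space 𝔄] {X : Type v} {D : PolyData X (Plus 𝔄)}
  {Ω Ω' Ω'' Ξ Ξ' Θ Θ' : Type} [SPG Ω] [SPG Ω'] [SPG Ω''] [SPG Ξ] [SPG Ξ'] [SPG Θ] [SPG Θ']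

open Biprod

theorem Eqv.of_iso {x : PPair D Ω} {y : PPair D Θ} {u : PMat D Θ Ω} {v : PMat D Ω Θ}
    (hvu : v * u = 1) (huv : u * v = 1) (ha : y.a * u = u * x.a) (hb : y.b * u = u * x.b) :
    Eqv x y := by
  refine .ext (u := u) (v := v) ⟨⟨hvu, ha, ?_⟩, ?_⟩
  · calc v * y.a = v * (y.a * u) * v := by simp [huv]
      _ = x.a * v := by rw [ha, PMat.mul_mul_of_eq hvu, PMat.one_mul]
  · rw [PMat.mul_sub, ← ha, ← hb]
    simp [huv]

/-- Pairs whose terms are conjugated by two units that agree modulo rapidly decreasing matrices. -/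
theorem Eqv.of_units {x y : PPair D Ω} {w w' z z' : PMat D Ω Ω} (hw : w * w' = 1)
    (hw' : w' * w = 1) (hz : z * z' = 1) (hz' : z' * z = 1) (hc : w.Cong z)
    (hb : w * x.b = y.b * w) (ha : z * x.a = y.a * z) : Eqv x y := by
  have q := fun N : PMat D Ω Ω => PMat.mul_mul_of_eq hz N
  have q' := fun N : PMat D Ω Ω => PMat.mul_mul_of_eq hz' N
  have p := fun N : PMat D Ω Ω => PMat.mul_mul_of_eq hw N
  have p' := fun N : PMat D Ω Ω => PMat.mul_mul_of_eq hw' N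
  have yb := fun N : PMat D Ω Ω => PMat.mul_mul_of_eq y.bb N
  simp only [PMat.one_mul] at q q' p p'
  have hxa : x.a = z' * (y.a * z) := by rw [← ha, q']
  -- Transporting `y` back along `z` gives a pair with base `x.a`. The correction `z' * w` lies in
  -- `1 + 𝒦` and carries `x.b` to its leading term.
  let m : PPair D Ω :=
    { b := z' * (y.b * z)
      a := x.a
      bb := by simp [q, yb]
      aa := x.aa
      cong := by
        rw [hxa]
        exact (PMat.Cong.refl _).mul (y.cong.mul (.refl _)) }
  have h1 : Eqv x m := by
    refine .unit (g := z' * w) (g' := w' * z) ⟨by simp [p, hz'], by simp [q, hw'], ?_, ?_⟩ rfl ?_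
    · rw [← hz']
      exact (PMat.Cong.refl _).mul hc
    · rw [← hw']
      exact (PMat.Cong.refl _).mul hc.symm
    · change z' * w * x.b = z' * (y.b * z) * (z' * w)
      simp [q, hb]
  refine h1.trans (.of_iso (u := z) (v := z') hz' hz ha.symm ?_)
  change y.b * z = z * (z' * (y.b * z))
  rw [q]

/-- The trivial pair of an idempotent. -/
def PPair.triv (f : PMat D Ω Ω) (hf : f * f = f) : PPair D Ω := ⟨f, f, hf, hf, .refl f⟩

/-- The direct sum of pairs. -/
noncomputable def PPair.osum (x : PPair D Ω) (y : PPair D Ξ) : PPair D (Ω ⊕ Ξ) where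
  b := blk (sumBiprod D Ω Ξ) (sumBiprod D Ω Ξ) x.b 0 0 y.b
  a := blk (sumBiprod D Ω Ξ) (sumBiprod D Ω Ξ) x.a 0 0 y.a
  bb := by simp [blk_mul]
  aa := by simp [blk_mul]
  cong := blk_cong x.cong (.refl _) (.refl _) y.cong

/-- The pair with complementary terms. -/
noncomputable def PPair.inv (x : PPair D Ω) : PPair D Ω where
  b := 1 - x.b
  a := 1 - x.a
  bb := by simp
  aa := by simp
  cong := (PMat.Cong.refl _).sub x.cong

theorem Eqv.osum_left {x : PPair D Ω} {x' : PPair D Ω'} (h : Eqv x x') (y : PPair D Ξ) :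
    Eqv (x.osum y) (x'.osum y) := by
  induction h with
  | symm _ ih => exact ih.symm
  | trans _ _ ih ih' => exact ih.trans ih'
  | @ext Ω Ω' _ _ x x' u v h =>
    refine .ext (u := blk (sumBiprod D Ω' Ξ) (sumBiprod D Ω Ξ) u 0 0 1)
      (v := blk (sumBiprod D Ω Ξ) (sumBiprod D Ω' Ξ) v 0 0 1) ⟨⟨?_, ?_, ?_⟩, ?_⟩
    · simp [blk_mul, h.iso.inv_mul, blk_one]
    · simp [PPair.osum, blk_mul, h.iso.mul_eq]
    · simp [PPair.osum, blk_mul, h.iso.eq_mul]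
    · simp only [PPair.osum, h.eq, blk_mul, blk_sub, blk_add]
      congr 1 <;> simp
  | @unit Ω _ x x' g g' hg ha hb =>
    let β := sumBiprod D Ω Ξ
    refine .unit (g := blk β β g 0 0 1) (g' := blk β β g' 0 0 1) ⟨?_, ?_, ?_, ?_⟩ ?_ ?_
    · simp [blk_mul, hg.mul_inv, blk_one]
    · simp [blk_mul, hg.inv_mul, blk_one]
    · rw [← blk_one (β := β)]
      exact blk_cong hg.cong (.refl _) (.refl _) (.refl _)
    · rw [← blk_one (β := β)]
      exact blk_cong hg.cong_inv (.refl _) (.refl _) (.refl _)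
    · simp [PPair.osum, ha]
    · simp [PPair.osum, blk_mul, hb, β]

theorem Eqv.osum_comm (x : PPair D Ω) (y : PPair D Ξ) : Eqv (x.osum y) (y.osum x) := by
  refine .of_iso (u := blk (sumBiprod D Ξ Ω) (sumBiprod D Ω Ξ) 0 1 1 0)
    (v := blk (sumBiprod D Ω Ξ) (sumBiprod D Ξ Ω) 0 1 1 0) ?_ ?_ ?_ ?_ <;>
  simp [PPair.osum, blk_mul, blk_one]

theorem Eqv.osum_right (x : PPair D Ω) {y : PPair D Ξ} {y' : PPair D Ξ'} (h : Eqv y y') :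
    Eqv (x.osum y) (x.osum y') :=
  ((osum_comm x y).trans (h.osum_left x)).trans (osum_comm y' x)

theorem Eqv.osum {x : PPair D Ω} {x' : PPair D Ω'} {y : PPair D Ξ} {y' : PPair D Ξ'}
    (h : Eqv x x') (h' : Eqv y y') : Eqv (x.osum y) (x'.osum y') :=
  (h.osum_left y).trans (h'.osum_right x')

theorem Eqv.osum_assoc (x : PPair D Ω) (y : PPair D Ξ) (z : PPair D Θ) :
    Eqv ((x.osum y).osum z) (x.osum (y.osum z)) := by
  let β := sumBiprod D Ω Ξ
  let β' := sumBiprod D Ξ Θ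
  refine .of_iso
    (u := blk (sumBiprod D Ω (Ξ ⊕ Θ)) (sumBiprod D (Ω ⊕ Ξ) Θ) β.p0 0 (β'.i0 * β.p1) β'.i1)
    (v := blk (sumBiprod D (Ω ⊕ Ξ) Θ) (sumBiprod D Ω (Ξ ⊕ Θ)) β.i0 (β.i1 * β'.p0) 0 β'.p1)
    ?_ ?_ ?_ ?_
  · rw [blk_mul, ← blk_one (β := sumBiprod D (Ω ⊕ Ξ) Θ)]
    congr 1 <;> simp [β.total, β']
  · rw [blk_mul, ← blk_one (β := sumBiprod D Ω (Ξ ⊕ Θ))]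
    congr 1 <;> simp [β'.total, β]
  · simp only [PPair.osum, blk_mul]
    congr 1 <;> simp [β, β', blk]
  · simp only [PPair.osum, blk_mul]
    congr 1 <;> simp [β, β', blk]

theorem Eqv.osum_triv (x : PPair D Ω) (f : PMat D Ξ Ξ) (hf : f * f = f) :
    Eqv (x.osum (.triv f hf)) x := by
  refine .symm (.ext (u := (sumBiprod D Ω Ξ).i0) (v := (sumBiprod D Ω Ξ).p0) ⟨⟨?_, ?_, ?_⟩, ?_⟩)
  · simp
  · simp [PPair.osum, blk]
  · simp [PPair.osum, blk]
  · simp only [PPair.osum, blk, PPair.triv, PMat.mul_sub, PMat.sub_mul, PMat.mul_assoc]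
    abel

/-- Both are equivalent to the direct sum of the two. -/
theorem Eqv.triv (f : PMat D Ω Ω) (hf : f * f = f) (f' : PMat D Ξ Ξ) (hf' : f' * f' = f') :
    Eqv (PPair.triv f hf) (PPair.triv f' hf') :=
  ((osum_triv (.triv f hf) f' hf').symm.trans (osum_comm _ _)).trans (osum_triv _ f hf)

/-- The partial switch of an idempotent `c` is an involution conjugating `c ⊕ (1 - c)` into `0 ⊕ 1`.
The switches of `x.b` and `x.a` agree modulo rapidly decreasing matrices, so `Eqv.of_units` applies.
-/
theorem Eqv.osum_inv (x : PPair D Ω) (f : PMat D Ξ Ξ) (hf : f * f = f) :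
    Eqv (x.osum x.inv) (.triv f hf) := by
  let β := sumBiprod D Ω Ω
  have hsq : ∀ {c : PMat D Ω Ω}, c * c = c →
      blk β β (1 - c) c c (1 - c) * blk β β (1 - c) c c (1 - c) = 1 := fun hc => by
    rw [blk_mul, ← blk_one (β := β)]
    congr 1 <;> simp [hc]
  have hconj : ∀ {c : PMat D Ω Ω}, c * c = c →
      blk β β (1 - c) c c (1 - c) * blk β β c 0 0 (1 - c) =
        blk β β 0 0 0 1 * blk β β (1 - c) c c (1 - c) := fun hc => by
    rw [blk_mul, blk_mul]
    congr 1 <;> simp [hc]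
  have h0 : (blk β β 0 0 0 1 : PMat D (Ω ⊕ Ω) (Ω ⊕ Ω)) * blk β β 0 0 0 1 = blk β β 0 0 0 1 := by
    simp [blk_mul]
  refine .trans (y := .triv _ h0) (.of_units (hsq x.bb) (hsq x.bb) (hsq x.aa) (hsq x.aa) ?_
    (hconj x.bb) (hconj x.aa)) (.triv _ _ _ _)
  have h1 : (1 - x.b).Cong (1 - x.a) := (PMat.Cong.refl _).sub x.cong
  exact blk_cong h1 x.cong x.cong h1

theorem Eqv.inv {x : PPair D Ω} {x' : PPair D Ω'} (h : Eqv x x') : Eqv x.inv x'.inv := by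
  induction h with
  | symm _ ih => exact ih.symm
  | trans _ _ ih ih' => exact ih.trans ih'
  | @ext Ω Ω' _ _ x x' u v h =>
    refine .ext (u := u) (v := v) ⟨⟨h.iso.inv_mul, ?_, ?_⟩, ?_⟩
    · simp [PPair.inv, h.iso.mul_eq]
    · simp [PPair.inv, h.iso.eq_mul]
    · simp only [PPair.inv, h.eq, PMat.mul_sub, PMat.sub_mul]
      abel
  | @unit Ω _ x x' g g' hg ha hb =>
    exact .unit hg (by simp [PPair.inv, ha]) (by simp [PPair.inv, hb])

/-- The partial isometry `w`, `w'` makes the idempotents `b` and `b'` equivalent. -/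
structure IsMvN (w : PMat D Ω' Ω) (w' : PMat D Ω Ω') (b : PMat D Ω Ω) (b' : PMat D Ω' Ω') :
    Prop where
  inv_mul : w' * w = b
  mul_inv : w * w' = b'
  mul_eq : w * b = w
  eq_mul : b * w' = w'

theorem IsMvN.mul_eq' {w : PMat D Ω' Ω} {w' : PMat D Ω Ω'} {b : PMat D Ω Ω} {b' : PMat D Ω' Ω'}
    (h : IsMvN w w' b b') : b' * w = w := by
  rw [← h.mul_inv, PMat.mul_assoc, h.inv_mul, h.mul_eq]

theorem IsMvN.symm {w : PMat D Ω' Ω} {w' : PMat D Ω Ω'} {b : PMat D Ω Ω} {b' : PMat D Ω' Ω'}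
    (h : IsMvN w w' b b') : IsMvN w' w b' b where
  inv_mul := h.mul_inv
  mul_inv := h.inv_mul
  mul_eq := by rw [← h.mul_inv, ← PMat.mul_assoc, h.inv_mul, h.eq_mul]
  eq_mul := h.mul_eq'

theorem IsMvN.trans {w : PMat D Ω' Ω} {w' : PMat D Ω Ω'} {b : PMat D Ω Ω} {b' : PMat D Ω' Ω'}
    {z : PMat D Ω'' Ω'} {z' : PMat D Ω' Ω''} {b'' : PMat D Ω'' Ω''}
    (h : IsMvN w w' b b') (h' : IsMvN z z' b' b'') : IsMvN (z * w) (w' * z') b b'' where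
  inv_mul := by rw [PMat.mul_assoc, PMat.mul_mul_of_eq h'.inv_mul, h.mul_eq', h.inv_mul]
  mul_inv := by rw [PMat.mul_assoc, PMat.mul_mul_of_eq h.mul_inv, h'.eq_mul, h'.mul_inv]
  mul_eq := by rw [PMat.mul_assoc, h.mul_eq]
  eq_mul := by rw [← PMat.mul_assoc, h.eq_mul]

/-- Pairs whose terms are equivalent through partial isometries that agree modulo rapidly decreasing
matrices. -/
theorem Eqv.of_isMvN {x : PPair D Ω} {y : PPair D Ξ} {w z : PMat D Ξ Ω} {w' z' : PMat D Ω Ξ}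
    (hw : IsMvN w w' x.b y.b) (hz : IsMvN z z' x.a y.a) (hc : w.Cong z) (hc' : w'.Cong z') :
    Eqv x y := by
  have h0 : (0 : PMat D Ξ Ξ) * (0 : PMat D Ξ Ξ) = 0 := by simp
  have h0' : (0 : PMat D Ω Ω) * (0 : PMat D Ω Ω) = 0 := by simp
  let β := sumBiprod D Ω Ξ
  -- A Murray–von Neumann equivalence becomes a conjugation after doubling: this involution carries
  -- `b ⊕ 0` to `0 ⊕ b'`.
  have hsq : ∀ {b : PMat D Ω Ω} {b' : PMat D Ξ Ξ} {w : PMat D Ξ Ω} {w' : PMat D Ω Ξ},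
      b * b = b → b' * b' = b' → IsMvN w w' b b' →
      blk β β (1 - b) w' w (1 - b') * blk β β (1 - b) w' w (1 - b') = 1 := by
    intro b b' w w' hb hb' h
    rw [blk_mul, ← blk_one (β := β)]
    congr 1 <;> simp [hb, hb', h.inv_mul, h.mul_inv, h.mul_eq, h.eq_mul, h.symm.mul_eq,
      h.symm.eq_mul]
  have hconj : ∀ {b : PMat D Ω Ω} {b' : PMat D Ξ Ξ} {w : PMat D Ξ Ω} {w' : PMat D Ω Ξ},
      b * b = b → b' * b' = b' → IsMvN w w' b b' →
      blk β β (1 - b) w' w (1 - b') * blk β β b 0 0 0 =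
        blk β β 0 0 0 b' * blk β β (1 - b) w' w (1 - b') := by
    intro b b' w w' hb hb' h
    rw [blk_mul, blk_mul]
    congr 1 <;> simp [hb, hb', h.mul_eq, h.symm.eq_mul]
  have h1 : Eqv (x.osum (.triv (0 : PMat D Ξ Ξ) h0)) ((PPair.triv (0 : PMat D Ω Ω) h0').osum y) :=
    .of_units (hsq x.bb y.bb hw) (hsq x.bb y.bb hw) (hsq x.aa y.aa hz) (hsq x.aa y.aa hz)
      (blk_cong ((PMat.Cong.refl _).sub x.cong) hc' hc ((PMat.Cong.refl _).sub y.cong))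
      (hconj x.bb y.bb hw) (hconj x.aa y.aa hz)
  exact ((osum_triv x _ h0).symm.trans h1).trans ((osum_comm _ _).trans (osum_triv y _ h0'))

/-! Tensor products -/

open _root_.Polymetric.PMat (ten)

/-- The left product of pairs. -/
noncomputable def PPair.prodL (x : PPair D Ω) (y : PPair D Ξ) : PPair D (Ω × Ξ) where
  b := ten x.b y.b + ten (1 - x.b) y.a
  a := ten x.a y.b + ten (1 - x.a) y.a
  bb := by simp
  aa := by simp
  cong := by
    have h := PMat.Rapid.tens x.cong y.cong
    -- A tensor product is known to be rapidly decreasing when both factors are; the difference of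
    -- the two terms has exactly this form.
    have e : ten x.b y.b + ten (1 - x.b) y.a - (ten x.a y.b + ten (1 - x.a) y.a) =
        ten (x.b - x.a) (y.b - y.a) := by
      simp only [PMat.sub_tens, PMat.tens_sub]
      abel
    rwa [PMat.Cong, e]

/-- The right product of pairs. -/
noncomputable def PPair.prodR (x : PPair D Ω) (y : PPair D Ξ) : PPair D (Ω × Ξ) where
  b := ten x.b y.b + ten x.a (1 - y.b)
  a := ten x.b y.a + ten x.a (1 - y.a)
  bb := by simp
  aa := by simp
  cong := by
    have h := PMat.Rapid.tens x.cong y.cong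
    have e : ten x.b y.b + ten x.a (1 - y.b) - (ten x.b y.a + ten x.a (1 - y.a)) =
        ten (x.b - x.a) (y.b - y.a) := by
      simp only [PMat.sub_tens, PMat.tens_sub]
      abel
    rwa [PMat.Cong, e]

theorem Eqv.prodR_left {x : PPair D Ω} {x' : PPair D Ω'} (h : Eqv x x') (y : PPair D Ξ) :
    Eqv (x.prodR y) (x'.prodR y) := by
  induction h with
  | symm _ ih => exact ih.symm
  | trans _ _ ih ih' => exact ih.trans ih'
  | @ext Ω Ω' _ _ x x' u v h =>
    have r1 := h.iso.inv_mul
    have r2 := h.iso.mul_eq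
    have r3 := h.iso.eq_mul
    have q1 := fun N : PMat D Ω Ω' => PMat.mul_mul_of_eq r1 N
    simp only [PMat.one_mul] at q1
    refine .ext (u := ten u 1) (v := ten v 1) ⟨⟨?_, ?_, ?_⟩, ?_⟩
    · simp [r1]
    · simp [PPair.prodR, h.eq, r1, r2]
    · simp [PPair.prodR, h.eq, r3, q1]
    · simp [PPair.prodR, h.eq]
      abel
  | @unit Ω _ x x' g g' hg ha hb =>
    -- The unit `g` acts only on the part cut out by `y.b`, respectively `y.a`. The two resulting
    -- units differ by `(g - 1) ⊗ (y.b - y.a)`.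
    have hinv : ∀ {g g' : PMat D Ω Ω} {d : PMat D Ξ Ξ}, d * d = d → g * g' = 1 →
        (ten g d + ten 1 (1 - d)) * (ten g' d + ten 1 (1 - d)) = 1 := by
      intro g g' d hd h
      rw [← PMat.tens_one_one]
      simp [hd, h]
    refine .of_units (hinv y.bb hg.mul_inv) (hinv y.bb hg.inv_mul) (hinv y.aa hg.mul_inv)
      (hinv y.aa hg.inv_mul) ?_ ?_ ?_
    · have h := PMat.Rapid.tens hg.cong y.cong
      have e : ten g y.b + ten 1 (1 - y.b) - (ten g y.a + ten 1 (1 - y.a)) =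
          ten (g - 1) (y.b - y.a) := by
        simp only [PMat.sub_tens, PMat.tens_sub]
        abel
      rwa [PMat.Cong, e]
    · simp [PPair.prodR, hb, ha]
    · simp [PPair.prodR, hb, ha]

/-- Four tensor idempotents are regrouped: the two off-diagonal ones trade places between the
copies, while the others stay. -/
theorem isMvN_tens {b b₁ a a₁ : PMat D Ω Ω} {d d₁ c c₁ : PMat D Ξ Ξ} (hb : b * b = b)
    (hb₁ : b₁ * b₁ = b₁) (hbb : b * b₁ = 0) (hbb' : b₁ * b = 0) (ha : a * a = a)
    (ha₁ : a₁ * a₁ = a₁) (haa : a * a₁ = 0) (haa' : a₁ * a = 0) (hd : d * d = d)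
    (hd₁ : d₁ * d₁ = d₁) (hdd : d * d₁ = 0) (hdd' : d₁ * d = 0) (hc : c * c = c)
    (hc₁ : c₁ * c₁ = c₁) (hcc : c * c₁ = 0) (hcc' : c₁ * c = 0) (β : Biprod D (Ω × Ξ) (Ω × Ξ) Θ) :
    IsMvN (blk β β (ten b d) (ten a d₁) (ten b₁ c) (ten a₁ c₁))
      (blk β β (ten b d) (ten b₁ c) (ten a d₁) (ten a₁ c₁))
      (blk β β (ten b d + ten b₁ c) 0 0 (ten a d₁ + ten a₁ c₁))
      (blk β β (ten b d + ten a d₁) 0 0 (ten b₁ c + ten a₁ c₁)) := by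
  constructor <;> rw [blk_mul] <;> congr 1 <;> simp [*]

theorem PMat.Cong.of_sub_eq {A B R : PMat D Ω Ω'} (h : A - B = R) (hR : R.Rapid) : A.Cong B := by
  rwa [PMat.Cong, h]

/-- After adding the trivial pairs `fL` and `fR`, the leading terms consist of the same four
summands, and one regrouping suffices. The base terms are linked by three regroupings, between which
`d` is exchanged for `c` and then `a` for `b` inside sums that do not depend on them. Modulo rapidly
decreasing matrices the composite is the single regrouping of the leading terms. -/
theorem Eqv.prodL_prodR (x : PPair D Ω) (y : PPair D Ξ) : Eqv (x.prodL y) (x.prodR y) := by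
  obtain ⟨b, a, hb, ha, hab⟩ := x
  obtain ⟨d, c, hd, hc, hcd⟩ := y
  have hb₁ : (1 - b) * (1 - b) = 1 - b := by simp [hb]
  have hb₂ : b * (1 - b) = 0 := by simp [hb]
  have hb₃ : (1 - b) * b = 0 := by simp [hb]
  have ha₁ : (1 - a) * (1 - a) = 1 - a := by simp [ha]
  have ha₂ : a * (1 - a) = 0 := by simp [ha]
  have ha₃ : (1 - a) * a = 0 := by simp [ha]
  have hd₁ : (1 - d) * (1 - d) = 1 - d := by simp [hd]
  have hd₂ : d * (1 - d) = 0 := by simp [hd]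
  have hd₃ : (1 - d) * d = 0 := by simp [hd]
  have hc₁ : (1 - c) * (1 - c) = 1 - c := by simp [hc]
  have hc₂ : c * (1 - c) = 0 := by simp [hc]
  have hc₃ : (1 - c) * c = 0 := by simp [hc]
  let β := sumBiprod D (Ω × Ξ) (Ω × Ξ)
  have m0 := isMvN_tens hb hb₁ hb₂ hb₃ ha ha₁ ha₂ ha₃ hd hd₁ hd₂ hd₃ hc hc₁ hc₂ hc₃ β
  have m1 := isMvN_tens ha ha₁ ha₂ ha₃ ha ha₁ ha₂ ha₃ hd hd₁ hd₂ hd₃ hc hc₁ hc₂ hc₃ β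
  have m2 := (isMvN_tens ha ha₁ ha₂ ha₃ ha ha₁ ha₂ ha₃ hc hc₁ hc₂ hc₃ hc hc₁ hc₂ hc₃ β).symm
  have m3 := isMvN_tens hb hb₁ hb₂ hb₃ ha ha₁ ha₂ ha₃ hc hc₁ hc₂ hc₃ hc hc₁ hc₂ hc₃ β
  -- Both sides are `a ⊗ 1`; likewise both sides of `e2` are `1 ⊗ c`.
  have e1 : ten a d + ten a (1 - d) = ten a c + ten a (1 - c) := by simp
  have e2 : ten a c + ten (1 - a) c = ten b c + ten (1 - b) c := by simp
  rw [e1] at m1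
  rw [e2] at m2
  have m := (m1.trans m2).trans m3
  have fL : (ten a (1 - d) + ten (1 - a) (1 - c)) * (ten a (1 - d) + ten (1 - a) (1 - c)) =
      ten a (1 - d) + ten (1 - a) (1 - c) := by simp [ha, hd, hc]
  have fR : (ten (1 - b) c + ten (1 - a) (1 - c)) * (ten (1 - b) c + ten (1 - a) (1 - c)) =
      ten (1 - b) c + ten (1 - a) (1 - c) := by simp [ha, hb, hc]
  have r1 : (a - b * a).Rapid :=
    (by simpa [ha] using hab.symm.mul (.refl a) : a.Cong (b * a))
  have r2 : (a - a * b).Rapid :=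
    (by simpa [ha] using (PMat.Cong.refl a).mul hab.symm : a.Cong (a * b))
  have r3 : (b - b * a).Rapid :=
    (by simpa [hb] using (PMat.Cong.refl b).mul hab : b.Cong (b * a))
  have r4 : (b - a * b).Rapid :=
    (by simpa [hb] using hab.mul (.refl b) : b.Cong (a * b))
  have s1 : (d - c * d).Rapid :=
    (by simpa [hd] using hcd.mul (.refl d) : d.Cong (c * d))
  have s2 : (c - c * d).Rapid :=
    (by simpa [hc] using (PMat.Cong.refl c).mul hcd.symm : c.Cong (c * d))
  have s3 : (d - d * c).Rapid :=
    (by simpa [hd] using (PMat.Cong.refl d).mul hcd : d.Cong (d * c))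
  have s4 : (c - d * c).Rapid :=
    (by simpa [hc] using hcd.symm.mul (.refl c) : c.Cong (d * c))
  have qa := PMat.mul_mul_of_eq ha b
  have qc := PMat.mul_mul_of_eq hc d
  have qc' := PMat.mul_mul_of_eq hd c
  have key : Eqv (PPair.osum (.prodL ⟨b, a, hb, ha, hab⟩ ⟨d, c, hd, hc, hcd⟩) (.triv _ fL))
      (PPair.osum (.prodR ⟨b, a, hb, ha, hab⟩ ⟨d, c, hd, hc, hcd⟩) (.triv _ fR)) := by
    refine .of_isMvN m0 m ?_ ?_
    · rw [blk_mul, blk_mul]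
      -- Each remainder is written as a sum of tensors in which both factors are rapidly decreasing;
      -- a single such factor would not suffice.
      refine blk_cong
        (.of_sub_eq (R := -ten (a - b * a) (d - c * d) + ten (b - b * a) (d - c)) ?_
          ((r1.tens s1).neg.add (r3.tens hcd)))
        (.of_sub_eq (R := ten (a - b * a) (c - c * d)) ?_ (r1.tens s2))
        (.of_sub_eq (R := ten (a - b * a) (c - c * d)) ?_ (r1.tens s2))
        (.of_sub_eq (R := -ten (a - b * a) (c - c * d)) ?_ (r1.tens s2).neg) <;>
      simp [ha, hc, qc] <;> abel
    · rw [blk_mul, blk_mul]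
      refine blk_cong
        (.of_sub_eq (R := -ten (a - a * b) (d - d * c) + ten (b - a * b) (d - c)) ?_
          ((r2.tens s3).neg.add (r4.tens hcd)))
        (.of_sub_eq (R := ten (a - a * b) (c - d * c)) ?_ (r2.tens s4))
        (.of_sub_eq (R := ten (a - a * b) (c - d * c)) ?_ (r2.tens s4))
        (.of_sub_eq (R := -ten (a - a * b) (c - d * c)) ?_ (r2.tens s4).neg) <;>
      simp [ha, hc] <;> abel
  exact ((Eqv.osum_triv _ _ fL).symm.trans key).trans (.osum_triv _ _ fR)

omit [T2Space 𝔄] in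
theorem PMat.hat_mul_eq_mul_hat (e : Ω ≃ Ω') (f : Ξ ≃ Ξ') (he : IsRelabeling e)
    (hf : IsRelabeling f) {M : PMat D Ω Ξ} {N : PMat D Ω' Ξ'}
    (h : ∀ x i j, M.val x i j = N.val x (e i) (f j)) : PMat.hat (D := D) e he * M = N * PMat.hat (D := D) f hf :=
  PMat.ext' fun x => by
    funext i j
    obtain ⟨i, rfl⟩ := e.surjective i
    exact (hat_mmul e.injective _ i j).trans ((h x i j).trans (mmul_hat f _ _ j).symm)

theorem Eqv.of_equiv (e : Ω ≃ Ω') (he : IsRelabeling e) {x : PPair D Ω} {y : PPair D Ω'}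
    (ha : ∀ t i j, x.a.val t i j = y.a.val t (e i) (e j))
    (hb : ∀ t i j, x.b.val t i j = y.b.val t (e i) (e j)) : Eqv x y :=
  .of_iso (PMat.hatT_mul_hat e he) (PMat.hat_mul_hatT e he)
    (PMat.hat_mul_eq_mul_hat e e he he ha).symm (PMat.hat_mul_eq_mul_hat e e he he hb).symm

omit [T2Space 𝔄] [IsSeqComplete 𝔄] in
theorem PMat.ten_val_swap (A : PMat D Ω Ω') (B : PMat D Ξ Ξ') (t : X) (i : Ω × Ξ) (j : Ω' × Ξ') :
    (ten A B).val t i j = (ten B A).val t i.swap j.swap :=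
  mul_comm (A.val t i.1 j.1) (B.val t i.2 j.2)

theorem Eqv.prodL_swap (x : PPair D Ω) (y : PPair D Ξ) : Eqv (x.prodL y) (y.prodR x) := by
  refine .of_equiv (Equiv.prodComm Ω Ξ) (.of_equiv_size _ fun ω => Nat.add_comm _ _) ?_ ?_
  · intro t i j
    exact congrArg₂ (· + ·) (PMat.ten_val_swap x.a y.b t i j) (PMat.ten_val_swap (1 - x.a) y.a t i j)
  · intro t i j
    exact congrArg₂ (· + ·) (PMat.ten_val_swap x.b y.b t i j) (PMat.ten_val_swap (1 - x.b) y.a t i j)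

theorem Eqv.prodL_comm (x : PPair D Ω) (y : PPair D Ξ) : Eqv (x.prodL y) (y.prodL x) :=
  (prodL_swap x y).trans (prodL_prodR y x).symm

/-- Invariance in the first variable passes through the right product by `prodL_prodR`, in the
second through the swap. -/
theorem Eqv.prodL {x : PPair D Ω} {x' : PPair D Ω'} {y : PPair D Ξ} {y' : PPair D Ξ'}
    (h : Eqv x x') (h' : Eqv y y') : Eqv (x.prodL y) (x'.prodL y') := by
  have h1 : Eqv (x.prodL y) (x'.prodL y) :=
    ((prodL_prodR x y).trans (h.prodR_left y)).trans (prodL_prodR x' y).symm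
  have h2 : Eqv (x'.prodL y) (x'.prodL y') :=
    ((prodL_swap x' y).trans (h'.prodR_left x')).trans (prodL_swap x' y').symm
  exact h1.trans h2

omit [T2Space 𝔄] [IsSeqComplete 𝔄] in
theorem PMat.ten_val_assoc (A : PMat D Ω Ω) (B : PMat D Ξ Ξ) (C : PMat D Θ Θ) (t : X)
    (i j : (Ω × Ξ) × Θ) : (ten (ten A B) C).val t i j =
      (ten A (ten B C)).val t (Equiv.prodAssoc Ω Ξ Θ i) (Equiv.prodAssoc Ω Ξ Θ j) :=
  _root_.mul_assoc (A.val t i.1.1 j.1.1) (B.val t i.1.2 j.1.2) (C.val t i.2 j.2)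

/-- The left product is strictly associative up to rebracketing indices, since the complement of `b
⊗ d + (1 - b) ⊗ c` is `b ⊗ (1 - d) + (1 - b) ⊗ (1 - c)`. -/
theorem Eqv.prodL_assoc (x : PPair D Ω) (y : PPair D Ξ) (z : PPair D Θ) :
    Eqv ((x.prodL y).prodL z) (x.prodL (y.prodL z)) := by
  have key : ∀ (b : PMat D Ω Ω) (d c : PMat D Ξ Ξ) (k h : PMat D Θ Θ) (t : X)
      (i j : (Ω × Ξ) × Θ),
      (ten (ten b d + ten (1 - b) c) k + ten (1 - (ten b d + ten (1 - b) c)) h).val t i j =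
      (ten b (ten d k + ten (1 - d) h) + ten (1 - b) (ten c k + ten (1 - c) h)).val t
        (Equiv.prodAssoc Ω Ξ Θ i) (Equiv.prodAssoc Ω Ξ Θ j) := by
    intro b d c k h t i j
    have e1 : ten (ten b d + ten (1 - b) c) k + ten (1 - (ten b d + ten (1 - b) c)) h =
        (ten (ten b d) k + ten (ten b (1 - d)) h) +
          (ten (ten (1 - b) c) k + ten (ten (1 - b) (1 - c)) h) := by
      rw [← PMat.tens_one_one]
      simp
      abel
    rw [e1, PMat.tens_add, PMat.tens_add]
    exact congrArg₂ (· + ·)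
      (congrArg₂ (· + ·) (PMat.ten_val_assoc b d k t i j) (PMat.ten_val_assoc b (1 - d) h t i j))
      (congrArg₂ (· + ·) (PMat.ten_val_assoc (1 - b) c k t i j)
        (PMat.ten_val_assoc (1 - b) (1 - c) h t i j))
  refine .of_equiv (Equiv.prodAssoc Ω Ξ Θ) (.of_equiv_size _ fun ω => (Nat.add_assoc _ _ _).symm) ?_ ?_
  · exact key x.a y.b y.a z.b z.a
  · exact key x.b y.b y.a z.b z.a

/-- Both terms of the right product are linear in the first pair, so this is an exact identification
of blocks. -/
theorem Eqv.osum_prodR (x : PPair D Ω) (y : PPair D Ω') (z : PPair D Ξ) :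
    Eqv ((x.osum y).prodR z) ((x.prodR z).osum (y.prodR z)) := by
  let β := sumBiprod D Ω Ω'
  let γ := sumBiprod D (Ω × Ξ) (Ω' × Ξ)
  refine .of_iso (u := γ.i0 * ten β.p0 (1 : PMat D Ξ Ξ) + γ.i1 * ten β.p1 (1 : PMat D Ξ Ξ))
    (v := ten β.i0 (1 : PMat D Ξ Ξ) * γ.p0 + ten β.i1 (1 : PMat D Ξ Ξ) * γ.p1) ?_ ?_ ?_ ?_
  · simp only [PMat.add_mul, PMat.mul_add, PMat.mul_assoc, p0_i0_mul, p0_i1_mul, p1_i0_mul,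
      p1_i1_mul, PMat.mul_zero, PMat.tens_mul_tens, PMat.mul_one, add_zero, zero_add]
    rw [← PMat.add_tens, β.total, PMat.tens_one_one]
  · simp [γ.total]
  · simp [PPair.osum, PPair.prodR, blk, γ, β]
    abel
  · simp [PPair.osum, PPair.prodR, blk, γ, β]
    abel

theorem Eqv.osum_prodL (x : PPair D Ω) (y : PPair D Ω') (z : PPair D Ξ) :
    Eqv ((x.osum y).prodL z) ((x.prodL z).osum (y.prodL z)) :=
  ((prodL_prodR _ z).trans (osum_prodR x y z)).trans
    ((prodL_prodR x z).osum (prodL_prodR y z)).symm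

theorem Eqv.prodL_osum (x : PPair D Ω) (y : PPair D Ξ) (z : PPair D Ξ') :
    Eqv (x.prodL (y.osum z)) ((x.prodL y).osum (x.prodL z)) :=
  ((prodL_comm x _).trans (osum_prodL y z x)).trans ((prodL_comm y x).osum (prodL_comm z x))

end Algebra

/-! ### Entries of a matrix moved by relabelings on both sides. -/

section Entries

variable {R : Type u} [Ring R] [TopologicalSpace R] {Ω Ω' Θ Θ' : Type}

theorem hat_mmul_hatT_apply {r : Ω → Θ} {s : Ω' → Θ'} (hr : r.Injective) (hs : s.Injective)
    (M : Matrix Ω Ω' R) (i : Ω) (j : Ω') :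
    (hat r ⬝ₘ M ⬝ₘ (hat s).transpose) (r i) (s j) = M i j :=
  (mmul_hatT hs _ _ j).trans (hat_mmul hr M i j)

theorem hat_mmul_hatT_of_left {r : Ω → Θ} {s : Ω' → Θ'} (hs : s.Injective) (M : Matrix Ω Ω' R)
    {i : Θ} (hi : i ∉ Set.range r) (j : Θ') : (hat r ⬝ₘ M ⬝ₘ (hat s).transpose) i j = 0 := by
  by_cases hj : j ∈ Set.range s
  · obtain ⟨j, rfl⟩ := hj
    exact (mmul_hatT hs _ _ j).trans (hat_mmul_of_notMem M hi j)
  · exact mmul_hatT_of_notMem _ i hj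

theorem hat_mmul_hatT_of_right {r : Ω → Θ} {s : Ω' → Θ'} (M : Matrix Ω Ω' R)
    (i : Θ) {j : Θ'} (hj : j ∉ Set.range s) : (hat r ⬝ₘ M ⬝ₘ (hat s).transpose) i j = 0 :=
  mmul_hatT_of_notMem _ i hj

end Entries

/-! ### Comparison of the abstract pairs with the concrete Grassmannian. -/

section Links

variable {𝔄 : Type u} [NonUnitalCommRing 𝔄] [TopologicalSpace 𝔄] [PolymetricRing 𝔄]
  [IsSeqComplete 𝔄] {X : Type v} {D : PolyData X (Plus 𝔄)}
  {Ω Ω' Ω'' Ξ Ξ' Θ Θ' : Type} [SPG Ω] [SPG Ω'] [SPG Ω''] [SPG Ξ] [SPG Ξ'] [SPG Θ] [SPG Θ']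

open Biprod

theorem val_blk_sum (A : PMat D Ω Ω) (B : PMat D Ω Ξ) (C : PMat D Ξ Ω) (E : PMat D Ξ Ξ) (t : X) :
    (blk (sumBiprod D Ω Ξ) (sumBiprod D Ω Ξ) A B C E).val t =
      Matrix.fromBlocks (A.val t) (B.val t) (C.val t) (E.val t) := by
  have hl := Sum.inl_injective (α := Ω) (β := Ξ)
  have hr := Sum.inr_injective (α := Ω) (β := Ξ)
  have nl : ∀ i : Ω, (Sum.inl i : Ω ⊕ Ξ) ∉ Set.range (Sum.inr : Ξ → Ω ⊕ Ξ) := by simp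
  have nr : ∀ i : Ξ, (Sum.inr i : Ω ⊕ Ξ) ∉ Set.range (Sum.inl : Ω → Ω ⊕ Ξ) := by simp
  funext i j
  simp only [blk, sumBiprod, PMat.val_add, PMat.val_mul, PMat.hat, PMat.hatT, Matrix.add_apply]
  rcases i with i | i <;> rcases j with j | j
  · rw [hat_mmul_hatT_apply hl hl, hat_mmul_hatT_of_right _ _ (nl j),
      hat_mmul_hatT_of_left hl _ (nl i), hat_mmul_hatT_of_left hr _ (nl i)]
    simp
  · rw [hat_mmul_hatT_of_right _ _ (nr j), hat_mmul_hatT_apply hl hr,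
      hat_mmul_hatT_of_left hl _ (nl i), hat_mmul_hatT_of_left hr _ (nl i)]
    simp
  · rw [hat_mmul_hatT_of_left hl _ (nr i), hat_mmul_hatT_of_left hr _ (nr i),
      hat_mmul_hatT_apply hr hl, hat_mmul_hatT_of_right _ _ (nl j)]
    simp
  · rw [hat_mmul_hatT_of_left hl _ (nr i), hat_mmul_hatT_of_left hr _ (nr i),
      hat_mmul_hatT_of_right _ _ (nr j), hat_mmul_hatT_apply hr hr]
    simp

theorem val_blk_fin (A B C E : PMat D Ω Ω) (t : X) (i j : Fin 2 × Ω) :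
    (blk (finBiprod D Ω) (finBiprod D Ω) A B C E).val t i j =
      if i.1 = 0 then (if j.1 = 0 then A.val t i.2 j.2 else B.val t i.2 j.2)
      else (if j.1 = 0 then C.val t i.2 j.2 else E.val t i.2 j.2) := by
  have hl : Function.Injective fun i : Ω => ((0 : Fin 2), i) := Prod.mk_right_injective _
  have hr : Function.Injective fun i : Ω => ((1 : Fin 2), i) := Prod.mk_right_injective _
  have nl : ∀ i : Ω, ((0 : Fin 2), i) ∉ Set.range fun i : Ω => ((1 : Fin 2), i) := by simp
  have nr : ∀ i : Ω, ((1 : Fin 2), i) ∉ Set.range fun i : Ω => ((0 : Fin 2), i) := by simp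
  simp only [blk, finBiprod, PMat.val_add, PMat.val_mul, PMat.hat, PMat.hatT, Matrix.add_apply]
  rcases fin_two_cover i with ⟨i, rfl⟩ | ⟨i, rfl⟩ <;>
    rcases fin_two_cover j with ⟨j, rfl⟩ | ⟨j, rfl⟩
  · rw [hat_mmul_hatT_apply hl hl, hat_mmul_hatT_of_right _ _ (nl j),
      hat_mmul_hatT_of_left hl _ (nl i), hat_mmul_hatT_of_left hr _ (nl i)]
    simp
  · rw [hat_mmul_hatT_of_right _ _ (nr j), hat_mmul_hatT_apply hl hr,
      hat_mmul_hatT_of_left hl _ (nl i), hat_mmul_hatT_of_left hr _ (nl i)]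
    simp
  · rw [hat_mmul_hatT_of_left hl _ (nr i), hat_mmul_hatT_of_left hr _ (nr i),
      hat_mmul_hatT_apply hr hl, hat_mmul_hatT_of_right _ _ (nl j)]
    simp
  · rw [hat_mmul_hatT_of_left hl _ (nr i), hat_mmul_hatT_of_left hr _ (nr i),
      hat_mmul_hatT_of_right _ _ (nr j), hat_mmul_hatT_apply hr hr]
    simp

theorem fin_two_ne_zero {i : Fin 2} (h : i ≠ 0) : i = 1 := by omega

theorem val_blk_diag (A E : PMat D Ω Ω) (t : X) :
    (blk (finBiprod D Ω) (finBiprod D Ω) A 0 0 E).val t = diag2 (A.val t) (E.val t) := by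
  funext i j
  rw [val_blk_fin, diag2]
  by_cases hi : i.1 = 0 <;> by_cases hj : j.1 = 0
  · simp [hi, hj]
  · simp [hi, hj, PMat.val_zero, Ne.symm hj]
  · simp [hi, hj, PMat.val_zero]
  · simp [fin_two_ne_zero hi, fin_two_ne_zero hj]

theorem val_blk_sw (a : PMat D Ω Ω) (t : X) :
    (blk (finBiprod D Ω) (finBiprod D Ω) (1 - a) a a (1 - a)).val t = sw (a.val t) := by
  funext i j
  rw [val_blk_fin, sw]
  by_cases hi : i.1 = 0 <;> by_cases hj : j.1 = 0
  · simp [hi, hj, PMat.val_sub, PMat.val_one]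
  · simp [hi, hj, Ne.symm hj]
  · simp [hi, hj]
  · simp [fin_two_ne_zero hi, fin_two_ne_zero hj, PMat.val_sub, PMat.val_one]

theorem val_gBase (t : X) : (gBase D).val t = (MPair.reg0 ℕ (Plus 𝔄)).base :=
  val_blk_diag 0 1 t

/-- The value of a pair of matrix valued maps. -/
def PPair.at (x : PPair D Ω) (t : X) : MPair Ω (Plus 𝔄) := ⟨x.b.val t, x.a.val t⟩

theorem PPair.at_inv (x : PPair D Ω) [T2Space 𝔄] (t : X) : x.inv.at t = (x.at t).inv := rfl

variable [T2Space 𝔄]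

theorem PPair.at_osum (x : PPair D Ω) (y : PPair D Ξ) (t : X) :
    (x.osum y).at t = (x.at t).osum (y.at t) :=
  MPair.ext (val_blk_sum _ _ _ _ t) (val_blk_sum _ _ _ _ t)

/-- The two products of pairs. -/
noncomputable def PPair.prod : MPair.Side → PPair D Ω → PPair D Ξ → PPair D (Ω × Ξ)
  | .left => PPair.prodL
  | .right => PPair.prodR

theorem PPair.at_prod (s : MPair.Side) (x : PPair D Ω) (y : PPair D Ξ) (t : X) :
    (x.prod s y).at t = MPair.oprod s (x.at t) (y.at t) := by
  cases s <;> rfl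

theorem Eqv.prod_prodL (s : MPair.Side) (x : PPair D Ω) (y : PPair D Ξ) :
    Eqv (x.prod s y) (x.prodL y) := by
  cases s
  · exact .refl _
  · exact (prodL_prodR x y).symm

/-- Relabeling of pairs. -/
noncomputable def PPair.relabel (r : Ω → Ω') (hr : IsRelabeling r) (x : PPair D Ω) : PPair D Ω' where
  b := PMat.hat r hr * x.b * PMat.hatT r hr
  a := PMat.hat r hr * x.a * PMat.hatT r hr
  bb := by
    have h := fun N : PMat D Ω Ω' => PMat.mul_mul_of_eq (PMat.hatT_mul_hat (D := D) r hr) N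
    have h' := fun N : PMat D Ω Ω' => PMat.mul_mul_of_eq x.bb N
    simp only [PMat.mul_assoc, h, PMat.one_mul, h']
  aa := by
    have h := fun N : PMat D Ω Ω' => PMat.mul_mul_of_eq (PMat.hatT_mul_hat (D := D) r hr) N
    have h' := fun N : PMat D Ω Ω' => PMat.mul_mul_of_eq x.aa N
    simp only [PMat.mul_assoc, h, PMat.one_mul, h']
  cong := ((PMat.Cong.refl _).mul x.cong).mul (.refl _)

theorem PPair.at_relabel (r : Ω → Ω') (hr : IsRelabeling r) (x : PPair D Ω) (t : X) :
    (x.relabel r hr).at t = (x.at t).relabelPair r := rfl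

theorem Eqv.relabel (r : Ω → Ω') (hr : IsRelabeling r) (x : PPair D Ω) :
    Eqv (x.relabel r hr) x := by
  have h := PMat.hatT_mul_hat (D := D) r hr
  have h' := fun N : PMat D Ω Ω' => PMat.mul_mul_of_eq h N
  refine .symm (.ext (u := PMat.hat r hr) (v := PMat.hatT r hr) ⟨⟨h, ?_, ?_⟩, ?_⟩)
  · simp [PPair.relabel]
  · simp only [PPair.relabel, PMat.mul_assoc, h', PMat.one_mul]
  · simp [PPair.relabel]

/-- The regularization of pairs. -/
noncomputable def PPair.reg (x : PPair D Ω) : PPair D (Fin 2 × Ω) :=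
  let β := finBiprod D Ω
  have hS : blk β β (1 - x.a) x.a x.a (1 - x.a) * blk β β (1 - x.a) x.a x.a (1 - x.a) = 1 := by
    rw [blk_mul, ← blk_one (β := β)]
    congr 1 <;> simp
  { b := blk β β (1 - x.a) x.a x.a (1 - x.a) * blk β β x.b 0 0 (1 - x.a) *
      blk β β (1 - x.a) x.a x.a (1 - x.a)
    a := blk β β 0 0 0 1
    bb := by
      have h' := fun N : PMat D (Fin 2 × Ω) (Fin 2 × Ω) => PMat.mul_mul_of_eq hS N
      have h2 : blk β β x.b 0 0 (1 - x.a) * blk β β x.b 0 0 (1 - x.a) =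
        blk β β x.b 0 0 (1 - x.a) := by simp [blk_mul]
      have h2' := fun N : PMat D (Fin 2 × Ω) (Fin 2 × Ω) => PMat.mul_mul_of_eq h2 N
      simp only [PMat.mul_assoc, h', PMat.one_mul, h2']
    aa := by simp [blk_mul]
    cong := by
      -- With `x.a` in place of `x.b`, the same conjugation by the switch yields exactly the base
      -- term.
      have h2 : blk β β (1 - x.a) x.a x.a (1 - x.a) * blk β β x.a 0 0 (1 - x.a) *
          blk β β (1 - x.a) x.a x.a (1 - x.a) = blk β β 0 0 0 1 := by
        rw [blk_mul, blk_mul]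
        congr 1 <;> simp
      rw [← h2]
      exact ((PMat.Cong.refl _).mul (blk_cong x.cong (.refl _) (.refl _) (.refl _))).mul (.refl _) }

theorem PPair.at_reg (x : PPair D Ω) (t : X) : (x.reg).at t = (x.at t).reg := by
  refine MPair.ext ?_ (val_blk_diag 0 1 t)
  have h1 := val_blk_sw x.a t
  have h2 := val_blk_diag x.b (1 - x.a) t
  simp only [PPair.at, PPair.reg, PMat.val_mul, h1, h2, MPair.reg]
  rfl

/-- Both terms of the regularization come from adding `1 - x.a` and applying the switch of `x.a`;
the switch restricted to the first copy is `regIn`. -/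
theorem Eqv.reg (x : PPair D Ω) : Eqv x.reg x := by
  refine .symm (.ext (u := regIn (finBiprod D Ω) x.a) (v := regOut (finBiprod D Ω) x.a)
    ⟨isIso_reg x.aa, ?_⟩)
  have qb := PMat.mul_mul_of_eq x.bb x.a
  have qa := fun N : PMat D Ω (Fin 2 × Ω) => PMat.mul_mul_of_eq x.aa N
  simp only [PPair.reg, blk_mul]
  simp [blk, regIn, regOut, qa]
  abel

/-! The operations of the Grassmannian -/

/-- The sum in the Grassmannian. -/
noncomputable def PPair.add (θ : GIdx ⊕ GIdx → ℕ) (hθ : IsRelabeling θ) (x y : PPair D GIdx) :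
    PPair D GIdx := ((x.osum y).relabel θ hθ).reg

/-- The negative in the Grassmannian. -/
noncomputable def PPair.neg (θ : GIdx → ℕ) (hθ : IsRelabeling θ) (x : PPair D GIdx) :
    PPair D GIdx := (x.inv.relabel θ hθ).reg

/-- The product in the Grassmannian. -/
noncomputable def PPair.mul (s : MPair.Side) (θ : GIdx × GIdx → ℕ) (hθ : IsRelabeling θ)
    (x y : PPair D GIdx) : PPair D GIdx := ((x.prod s y).relabel θ hθ).reg

/-- The zero element of the Grassmannian. -/
noncomputable def PPair.zero (D : PolyData X (Plus 𝔄)) : PPair D GIdx := .triv _ gBase_mul_self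

theorem PPair.at_add (θ : GIdx ⊕ GIdx → ℕ) (hθ : IsRelabeling θ) (x y : PPair D GIdx) (t : X) :
    (x.add θ hθ y).at t = gAdd θ (x.at t) (y.at t) := by
  rw [PPair.add, at_reg, at_relabel, at_osum, gAdd]

theorem PPair.at_neg (θ : GIdx → ℕ) (hθ : IsRelabeling θ) (x : PPair D GIdx) (t : X) :
    (x.neg θ hθ).at t = gNeg θ (x.at t) := by
  rw [PPair.neg, at_reg, at_relabel, at_inv, gNeg]

theorem PPair.at_mul (s : MPair.Side) (θ : GIdx × GIdx → ℕ) (hθ : IsRelabeling θ)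
    (x y : PPair D GIdx) (t : X) : (x.mul s θ hθ y).at t = gMul s θ (x.at t) (y.at t) := by
  rw [PPair.mul, at_reg, at_relabel, at_prod, gMul]

theorem PPair.at_zero (t : X) : (PPair.zero D).at t = gZero 𝔄 :=
  MPair.ext (val_gBase t) (val_gBase t)

theorem Eqv.add_osum (θ : GIdx ⊕ GIdx → ℕ) (hθ : IsRelabeling θ) (x y : PPair D GIdx) :
    Eqv (x.add θ hθ y) (x.osum y) := (Eqv.reg _).trans (Eqv.relabel θ hθ _)

theorem Eqv.neg_inv (θ : GIdx → ℕ) (hθ : IsRelabeling θ) (x : PPair D GIdx) :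
    Eqv (x.neg θ hθ) x.inv := (Eqv.reg _).trans (Eqv.relabel θ hθ _)

theorem Eqv.mul_prodL (s : MPair.Side) (θ : GIdx × GIdx → ℕ) (hθ : IsRelabeling θ)
    (x y : PPair D GIdx) : Eqv (x.mul s θ hθ y) (x.prodL y) :=
  ((Eqv.reg _).trans (Eqv.relabel θ hθ _)).trans (Eqv.prod_prodL s x y)

theorem PPair.isGrass_at (x : PPair D GIdx) (hx : x.a = gBase D) (t : X) :
    IsGrass 𝔄 (x.at t) where
  base_eq := by rw [← val_gBase (D := D) t, ← hx]; rfl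
  idem := congrArg (fun M : PMat D GIdx GIdx => M.val t) x.bb
  rapid := x.cong t

theorem strongHomotopic_of_eqv {X : Type u} {D : PolyData X (Plus 𝔄)} {x y : PPair D GIdx}
    (h : Eqv x y) (hx : x.a = gBase D) (hy : y.a = gBase D) {f₁ f₂ : X → MPair GIdx (Plus 𝔄)}
    (h₁ : ∀ t, x.at t = f₁ t) (h₂ : ∀ t, y.at t = f₂ t) : StrongHomotopic D f₁ f₂ := by
  -- The symmetric form is used because the homotopy has to conjugate the second map into the first.
  obtain ⟨g, g', hg, hc⟩ := h.symm.hom_of_base (β := finBiprod D GIdx) hy hx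
  refine ⟨fun t => ⟨g.val t, g'.val t, hg.cong t, hg.cong_inv t,
    congrArg (fun M : PMat D SIdx SIdx => M.val t) hg.mul_inv,
    congrArg (fun M : PMat D SIdx SIdx => M.val t) hg.inv_mul⟩, g.poly, g'.poly, fun t => ?_⟩
  have hstab : ∀ z : PPair D GIdx,
      (blk (finBiprod D GIdx) (finBiprod D GIdx) z.b 0 0 (gBase D)).val t = stab (z.at t) := by
    intro z
    rw [val_blk_diag, val_gBase]
    rfl
  have hc' : g * blk (finBiprod D GIdx) (finBiprod D GIdx) y.b 0 0 (gBase D) * g' =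
      blk (finBiprod D GIdx) (finBiprod D GIdx) x.b 0 0 (gBase D) := by
    rw [hc, PMat.mul_assoc, hg.mul_inv, PMat.mul_one]
  have := congrArg (fun M : PMat D SIdx SIdx => M.val t) hc'
  simp only [PMat.val_mul, hstab, h₁, h₂] at this
  exact this

/-- A variable with values in the Grassmannian. -/
noncomputable def PPair.var (f : X → Grass 𝔄) (hf : (fun t => (f t).1.lead) ∈ D.small) :
    PPair D GIdx where
  b := ⟨fun t => (f t).1.lead, .small _ hf, fun t => by
    have h1 := (f t).2.rapid.tame.add ((gBase D).tame t)
    rwa [val_gBase, (f t).2.base_eq, sub_add_cancel] at h1⟩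
  a := gBase D
  bb := PMat.ext' fun t => (f t).2.idem
  aa := gBase_mul_self
  cong := fun t => by
    have h1 := (f t).2.rapid
    rw [(f t).2.base_eq, ← val_gBase (D := D) t] at h1
    exact h1

theorem PPair.at_var (f : X → Grass 𝔄) (hf : (fun t => (f t).1.lead) ∈ D.small) (t : X) :
    (PPair.var f hf).at t = (f t).1 :=
  MPair.ext rfl ((val_gBase t).trans (f t).2.base_eq.symm)

/-- Conjugate points are equivalent. -/
theorem Eqv.of_conjugates (p : X → HomotopicPair 𝔄)
    (h₁ : (fun t => (p t).fst.1.lead) ∈ D.small) (h₂ : (fun t => (p t).snd.1.lead) ∈ D.small)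
    (h₃ : (fun t => (p t).unit.val) ∈ D.big) (h₄ : (fun t => (p t).unit.inv) ∈ D.big) :
    Eqv (PPair.var (D := D) (fun t => (p t).fst) h₁) (PPair.var (fun t => (p t).snd) h₂) := by
  let β := finBiprod D GIdx
  -- The given unit acts on stabilized points, so the chain runs through the stabilizations, which
  -- are extensions.
  let st : PPair D GIdx → PPair D SIdx := fun x =>
    { b := blk β β x.b 0 0 (gBase D)
      a := blk β β x.a 0 0 (gBase D)
      bb := by simp [blk_mul, gBase_mul_self]
      aa := by simp [blk_mul, gBase_mul_self]
      cong := blk_cong x.cong (.refl _) (.refl _) (.refl _) }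
  have hst : ∀ x : PPair D GIdx, Eqv x (st x) := by
    intro x
    refine .ext (u := β.i0) (v := β.p0) ⟨⟨β.p0_i0, ?_, ?_⟩, ?_⟩
    · simp [st, blk]
    · simp [st, blk]
    · simp only [st, blk, PMat.mul_sub, PMat.sub_mul, PMat.mul_assoc]
      abel
  have htame : ∀ {M : Matrix SIdx SIdx (Plus 𝔄)}, IsRapid 𝔄 (M - idm) → IsTame M := by
    intro M hM
    have h := hM.tame.add (hat_tame (isRelabeling_id (Ω := SIdx)))
    rwa [← idm, sub_add_cancel] at h
  let g : PMat D SIdx SIdx := ⟨fun t => (p t).unit.val, .big _ h₃, fun t => htame (p t).unit.val_rapid⟩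
  let g' : PMat D SIdx SIdx := ⟨fun t => (p t).unit.inv, .big _ h₄, fun t => htame (p t).unit.inv_rapid⟩
  have hg : IsKUnit g g' :=
    ⟨PMat.ext' fun t => (p t).unit.val_inv, PMat.ext' fun t => (p t).unit.inv_val,
      fun t => (p t).unit.val_rapid, fun t => (p t).unit.inv_rapid⟩
  let x := PPair.var (D := D) (fun t => (p t).fst) h₁
  let y := PPair.var (D := D) (fun t => (p t).snd) h₂
  have hconj : g * (st y).b * g' = (st x).b := PMat.ext' fun t => by
    have h := (p t).conj
    have e : ∀ f : X → Grass 𝔄, ∀ hf, ((st (PPair.var f hf)).b).val t = stab (f t).1 := by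
      intro f hf
      refine (val_blk_diag _ _ t).trans ?_
      rw [val_gBase]
      rfl
    change g.val t ⬝ₘ (st y).b.val t ⬝ₘ g'.val t = (st x).b.val t
    rw [e, e]
    exact h
  have hxy : Eqv (st y) (st x) := by
    refine .unit hg rfl ?_
    rw [← hconj, PMat.mul_assoc, hg.inv_mul, PMat.mul_one]
  exact (hst x).trans (hxy.symm.trans (hst y).symm)

/-! The unit element -/

open _root_.Polymetric.PMat (ten)

/-- The pair `⟨e, 0⟩` of `1 × 1` matrices. -/
noncomputable def PPair.scalar (e : 𝔄) (he : ∀ x, e * x = x) (h : (e : Plus 𝔄) ∈ D.scalar) : PPair D Unit :=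
  have hr : IsRapid 𝔄 (fun _ _ : Unit => (e : Plus 𝔄)) :=
    ⟨fun _ _ => Unitization.fst_inr ℤ e, fun p _ k => ⟨p e, fun _ _ => by simp [size]⟩⟩
  { b := ⟨fun _ => fun _ _ => (e : Plus 𝔄), .scalar _ h, fun _ => hr.tame⟩
    a := 0
    bb := PMat.ext' fun t => by
      funext i j
      refine (tsum_eq_single () fun k hk => absurd (Subsingleton.elim k ()) hk).trans ?_
      change (e : Plus 𝔄) * e = e
      rw [← Unitization.inr_mul, he]
    aa := by simp
    cong := fun t => by
      rw [PMat.val_sub, PMat.val_zero, sub_zero]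
      exact hr }

/-- The unit `1` of `𝔄⁺` differs from `e`, but `1 - e` annihilates `𝔄`, where the entries of `A`
lie. -/
theorem ten_one_sub_scalar (e : 𝔄) (he : ∀ x, e * x = x) (h : (e : Plus 𝔄) ∈ D.scalar)
    {A : PMat D Ω Ω} (hA : A.Rapid) : ten A (1 - (PPair.scalar e he h).b) = 0 :=
  PMat.ext' fun t => by
    funext i j
    have h1 : (1 - (PPair.scalar e he h).b).val t i.2 j.2 = 1 - (e : Plus 𝔄) := by
      change (idm : Matrix Unit Unit (Plus 𝔄)) i.2 j.2 - (e : Plus 𝔄) = _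
      simp [idm, hat]
    have h2 : A.val t i.1 j.1 = ((A.val t i.1 j.1).snd : Plus 𝔄) :=
      Unitization.ext ((hA t).1 _ _) rfl
    change A.val t i.1 j.1 * (1 - (PPair.scalar e he h).b).val t i.2 j.2 = 0
    rw [h1, h2, mul_sub, mul_one, ← Unitization.inr_mul, mul_comm, he, sub_self]

/-- The product is `⟨b ⊗ e, a ⊗ e⟩`. Since `(b - a) ⊗ (1 - e) = 0`, adding the orthogonal idempotent
`a ⊗ (1 - e)` to both terms gives `⟨b ⊗ 1, a ⊗ 1⟩`, which is `x` up to relabeling. -/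
theorem Eqv.prodL_scalar (x : PPair D Ω) (e : 𝔄) (he : ∀ x, e * x = x)
    (h : (e : Plus 𝔄) ∈ D.scalar) : Eqv (x.prodL (.scalar e he h)) x := by
  have h0 := ten_one_sub_scalar e he h x.cong
  set y := PPair.scalar (D := D) e he h
  have hya : y.a = 0 := rfl
  have hyr : y.b.Rapid := by
    have := y.cong
    rwa [PMat.Cong, hya, sub_zero] at this
  let x' : PPair D (Ω × Unit) :=
    { b := ten x.b 1
      a := ten x.a 1
      bb := by simp
      aa := by simp
      cong := by
        have h1 := PMat.Rapid.tens x.cong hyr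
        have h2 : ten x.b (1 : PMat D Unit Unit) - ten x.a 1 = ten (x.b - x.a) y.b := by
          rw [PMat.tens_sub, sub_eq_zero, PMat.sub_tens] at h0
          exact h0
        rwa [PMat.Cong, h2] }
  have hx : Eqv x x' := by
    have h1 : ∀ (A : PMat D Ω Ω) (t : X) (i j : Ω),
        A.val t i j = (ten A (1 : PMat D Unit Unit)).val t (i, ()) (j, ()) := by
      intro A t i j
      change A.val t i j = A.val t i j * (idm : Matrix Unit Unit (Plus 𝔄)) () ()
      simp [idm, hat]
    exact .of_equiv (Equiv.prodPUnit Ω).symm (.of_equiv_size _ fun ω => rfl) (h1 x.a) (h1 x.b)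
  have hf : ten x.a (1 - y.b) * ten x.a (1 - y.b) = ten x.a (1 - y.b) := by simp
  let β := sumBiprod D (Ω × Unit) (Ω × Unit)
  -- For orthogonal idempotents the external direct sum is Murray–von Neumann equivalent to the
  -- internal sum.
  have hm : ∀ {b : PMat D Ω Ω}, b * b = b → IsMvN (ten b y.b * β.p0 + ten x.a (1 - y.b) * β.p1)
      (β.i0 * ten b y.b + β.i1 * ten x.a (1 - y.b))
      (blk β β (ten b y.b) 0 0 (ten x.a (1 - y.b))) (ten b y.b + ten x.a (1 - y.b)) := by
    intro b hb
    have e1 : (1 - y.b) * (1 - y.b) = 1 - y.b := by simp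
    have e2 : y.b * (1 - y.b) = 0 := by simp
    have e3 : (1 - y.b) * y.b = 0 := by simp
    generalize 1 - y.b = d at e1 e2 e3
    constructor <;> simp [blk, hb, e1, e2, e3]
  have hb : (x.prodL y).b = ten x.b y.b := by simp [PPair.prodL, hya]
  have ha : (x.prodL y).a = ten x.a y.b := by simp [PPair.prodL, hya]
  have hb' : x'.b = ten x.b y.b + ten x.a (1 - y.b) := by
    rw [PMat.sub_tens, sub_eq_zero] at h0
    rw [← h0, ← PMat.tens_add, add_sub_cancel]
  have ha' : x'.a = ten x.a y.b + ten x.a (1 - y.b) := by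
    rw [← PMat.tens_add, add_sub_cancel]
  have hc : (ten x.b y.b).Cong (ten x.a y.b) := by
    have := PMat.Rapid.tens x.cong hyr
    rwa [PMat.sub_tens] at this
  have key : Eqv ((x.prodL y).osum (.triv _ hf)) x' := by
    have m1 := hm x.bb
    have m2 := hm x.aa
    rw [← hb', ← hb] at m1
    rw [← ha', ← ha] at m2
    refine .of_isMvN m1 m2 ?_ ?_
    · rw [ha, hb]
      exact (hc.mul (.refl _)).add (.refl _)
    · rw [ha, hb]
      exact ((PMat.Cong.refl _).mul hc).add (.refl _)
  exact ((osum_triv _ _ hf).symm.trans key).trans hx.symm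

end Links

/-! ### The ring identities, compatibility and unit for the Grassmannian. -/

section HRing

variable {𝔄 : Type u} [NonUnitalCommRing 𝔄] [TopologicalSpace 𝔄] [PolymetricRing 𝔄] [T2Space 𝔄]
  [IsSeqComplete 𝔄]

/-- The `i`-th variable, for the data consisting of `n` variables. -/
noncomputable def PPair.coord {n : ℕ} (i : Fin n) : PPair (varData 𝔄 n) GIdx :=
  .var (fun t => t i) ⟨i, rfl⟩

theorem PPair.at_coord {n : ℕ} (i : Fin n) (t : Fin n → Grass 𝔄) :
    (PPair.coord i).at t = (t i).1 := PPair.at_var _ _ t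

/-- The first point of the `i`-th pair of homotopic points. -/
noncomputable def PPair.fstCoord {n : ℕ} (i : Fin n) : PPair (compatData 𝔄 n) GIdx :=
  .var (fun t => (t i).fst) (Or.inl ⟨i, rfl⟩)

/-- The second point of the `i`-th pair of homotopic points. -/
noncomputable def PPair.sndCoord {n : ℕ} (i : Fin n) : PPair (compatData 𝔄 n) GIdx :=
  .var (fun t => (t i).snd) (Or.inr ⟨i, rfl⟩)

theorem PPair.at_fstCoord {n : ℕ} (i : Fin n) (t : Fin n → HomotopicPair 𝔄) :
    (PPair.fstCoord i).at t = (t i).fst.1 := PPair.at_var _ _ t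

theorem PPair.at_sndCoord {n : ℕ} (i : Fin n) (t : Fin n → HomotopicPair 𝔄) :
    (PPair.sndCoord i).at t = (t i).snd.1 := PPair.at_var _ _ t

theorem Eqv.fstCoord_sndCoord {n : ℕ} (i : Fin n) :
    Eqv (PPair.fstCoord (𝔄 := 𝔄) i) (PPair.sndCoord i) :=
  .of_conjugates _ _ _ (Or.inl ⟨i, rfl⟩) (Or.inr ⟨i, rfl⟩)

section Operations

variable {X : Type v} {D : PolyData X (Plus 𝔄)} (s : MPair.Side)
  {θ₁ : GIdx ⊕ GIdx → ℕ} (hθ₁ : IsRelabeling θ₁) {θ₂ : GIdx → ℕ} (hθ₂ : IsRelabeling θ₂)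
  {θ₃ : GIdx × GIdx → ℕ} (hθ₃ : IsRelabeling θ₃) (x y z : PPair D GIdx)

theorem Eqv.add {x x' y y' : PPair D GIdx} (h : Eqv x x') (h' : Eqv y y') :
    Eqv (x.add θ₁ hθ₁ y) (x'.add θ₁ hθ₁ y') :=
  ((add_osum θ₁ hθ₁ x y).trans (h.osum h')).trans (add_osum θ₁ hθ₁ x' y').symm

theorem Eqv.neg {x x' : PPair D GIdx} (h : Eqv x x') : Eqv (x.neg θ₂ hθ₂) (x'.neg θ₂ hθ₂) :=
  ((neg_inv θ₂ hθ₂ x).trans h.inv).trans (neg_inv θ₂ hθ₂ x').symm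

theorem Eqv.mul {x x' y y' : PPair D GIdx} (h : Eqv x x') (h' : Eqv y y') :
    Eqv (x.mul s θ₃ hθ₃ y) (x'.mul s θ₃ hθ₃ y') :=
  ((mul_prodL s θ₃ hθ₃ x y).trans (h.prodL h')).trans (mul_prodL s θ₃ hθ₃ x' y').symm

theorem Eqv.add_assoc :
    Eqv ((x.add θ₁ hθ₁ y).add θ₁ hθ₁ z) (x.add θ₁ hθ₁ (y.add θ₁ hθ₁ z)) :=
  (((add_osum θ₁ hθ₁ _ z).trans ((add_osum θ₁ hθ₁ x y).osum_left z)).trans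
    (osum_assoc x y z)).trans
    ((add_osum θ₁ hθ₁ x _).trans ((add_osum θ₁ hθ₁ y z).osum_right x)).symm

theorem Eqv.add_comm : Eqv (x.add θ₁ hθ₁ y) (y.add θ₁ hθ₁ x) :=
  ((add_osum θ₁ hθ₁ x y).trans (osum_comm x y)).trans (add_osum θ₁ hθ₁ y x).symm

theorem Eqv.add_zero : Eqv (x.add θ₁ hθ₁ (.zero D)) x :=
  (add_osum θ₁ hθ₁ x _).trans (osum_triv x _ _)

theorem Eqv.add_neg : Eqv (x.add θ₁ hθ₁ (x.neg θ₂ hθ₂)) (.zero D) :=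
  ((add_osum θ₁ hθ₁ x _).trans ((neg_inv θ₂ hθ₂ x).osum_right x)).trans (osum_inv x _ _)

theorem Eqv.mul_assoc :
    Eqv ((x.mul s θ₃ hθ₃ y).mul s θ₃ hθ₃ z) (x.mul s θ₃ hθ₃ (y.mul s θ₃ hθ₃ z)) :=
  (((mul_prodL s θ₃ hθ₃ _ z).trans ((mul_prodL s θ₃ hθ₃ x y).prodL (.refl z))).trans
    (prodL_assoc x y z)).trans
    ((mul_prodL s θ₃ hθ₃ x _).trans ((Eqv.refl x).prodL (mul_prodL s θ₃ hθ₃ y z))).symm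

theorem Eqv.mul_comm : Eqv (x.mul s θ₃ hθ₃ y) (y.mul s θ₃ hθ₃ x) :=
  ((mul_prodL s θ₃ hθ₃ x y).trans (prodL_comm x y)).trans (mul_prodL s θ₃ hθ₃ y x).symm

theorem Eqv.mul_add :
    Eqv (x.mul s θ₃ hθ₃ (y.add θ₁ hθ₁ z))
      ((x.mul s θ₃ hθ₃ y).add θ₁ hθ₁ (x.mul s θ₃ hθ₃ z)) :=
  (((mul_prodL s θ₃ hθ₃ x _).trans ((Eqv.refl x).prodL (add_osum θ₁ hθ₁ y z))).trans
    (prodL_osum x y z)).trans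
    ((add_osum θ₁ hθ₁ _ _).trans
      ((mul_prodL s θ₃ hθ₃ x y).osum (mul_prodL s θ₃ hθ₃ x z))).symm

theorem Eqv.add_mul :
    Eqv ((x.add θ₁ hθ₁ y).mul s θ₃ hθ₃ z)
      ((x.mul s θ₃ hθ₃ z).add θ₁ hθ₁ (y.mul s θ₃ hθ₃ z)) :=
  ((mul_comm s hθ₃ _ z).trans (mul_add s hθ₁ hθ₃ z x y)).trans
    ((mul_comm s hθ₃ z x).add hθ₁ (mul_comm s hθ₃ z y))

end Operations

theorem isStrongPolyHRing (s : MPair.Side)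
    (θ₁ : GIdx ⊕ GIdx → ℕ) (hθ₁ : IsRelabeling θ₁) (θ₂ : GIdx → ℕ) (hθ₂ : IsRelabeling θ₂)
    (θ₃ : GIdx × GIdx → ℕ) (hθ₃ : IsRelabeling θ₃) :
    IsStrongPolyHRing 𝔄 (gAdd θ₁) (gNeg θ₂) (gZero 𝔄) (gMul s θ₃) where
  add_mem x y hx hy := by
    -- Closure follows by evaluating the universal expression in two variables at the given points.
    have h := PPair.isGrass_at ((PPair.coord (𝔄 := 𝔄) (n := 2) 0).add θ₁ hθ₁ (.coord 1)) rfl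
      ![⟨x, hx⟩, ⟨y, hy⟩]
    simpa [PPair.at_add, PPair.at_coord] using h
  neg_mem x hx := by
    have h := PPair.isGrass_at ((PPair.coord (𝔄 := 𝔄) (n := 1) 0).neg θ₂ hθ₂) rfl ![⟨x, hx⟩]
    simpa [PPair.at_neg, PPair.at_coord] using h
  zero_mem := by
    have h := PPair.isGrass_at (PPair.zero (varData 𝔄 0)) rfl ![]
    simpa [PPair.at_zero] using h
  mul_mem x y hx hy := by
    have h := PPair.isGrass_at ((PPair.coord (𝔄 := 𝔄) (n := 2) 0).mul s θ₃ hθ₃ (.coord 1)) rfl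
      ![⟨x, hx⟩, ⟨y, hy⟩]
    simpa [PPair.at_mul, PPair.at_coord] using h
  add_assoc := strongHomotopic_of_eqv (.add_assoc hθ₁ (.coord 0) (.coord 1) (.coord 2)) rfl rfl
    (fun t => by simp [PPair.at_add, PPair.at_coord])
    (fun t => by simp [PPair.at_add, PPair.at_coord])
  add_comm := strongHomotopic_of_eqv (.add_comm hθ₁ (.coord 0) (.coord 1)) rfl rfl
    (fun t => by simp [PPair.at_add, PPair.at_coord])
    (fun t => by simp [PPair.at_add, PPair.at_coord])
  add_zero := strongHomotopic_of_eqv (.add_zero hθ₁ (.coord 0)) rfl rfl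
    (fun t => by simp [PPair.at_add, PPair.at_coord, PPair.at_zero])
    (fun t => by simp [PPair.at_coord])
  zero_add := strongHomotopic_of_eqv
    ((Eqv.add_comm hθ₁ (.zero _) (.coord 0)).trans (.add_zero hθ₁ (.coord 0))) rfl rfl
    (fun t => by simp [PPair.at_add, PPair.at_coord, PPair.at_zero])
    (fun t => by simp [PPair.at_coord])
  add_neg := strongHomotopic_of_eqv (.add_neg hθ₁ hθ₂ (.coord 0)) rfl rfl
    (fun t => by simp [PPair.at_add, PPair.at_neg, PPair.at_coord])
    (fun t => by simp [PPair.at_zero])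
  neg_add := strongHomotopic_of_eqv
    ((Eqv.add_comm hθ₁ (PPair.neg θ₂ hθ₂ (.coord 0)) (.coord 0)).trans
      (.add_neg hθ₁ hθ₂ (.coord 0))) rfl rfl
    (fun t => by simp [PPair.at_add, PPair.at_neg, PPair.at_coord])
    (fun t => by simp [PPair.at_zero])
  mul_assoc := strongHomotopic_of_eqv (.mul_assoc s hθ₃ (.coord 0) (.coord 1) (.coord 2)) rfl rfl
    (fun t => by simp [PPair.at_mul, PPair.at_coord])
    (fun t => by simp [PPair.at_mul, PPair.at_coord])
  mul_comm := strongHomotopic_of_eqv (.mul_comm s hθ₃ (.coord 0) (.coord 1)) rfl rfl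
    (fun t => by simp [PPair.at_mul, PPair.at_coord])
    (fun t => by simp [PPair.at_mul, PPair.at_coord])
  mul_add := strongHomotopic_of_eqv (.mul_add s hθ₁ hθ₃ (.coord 0) (.coord 1) (.coord 2)) rfl rfl
    (fun t => by simp [PPair.at_add, PPair.at_mul, PPair.at_coord])
    (fun t => by simp [PPair.at_add, PPair.at_mul, PPair.at_coord])
  add_mul := strongHomotopic_of_eqv (.add_mul s hθ₁ hθ₃ (.coord 0) (.coord 1) (.coord 2)) rfl rfl
    (fun t => by simp [PPair.at_add, PPair.at_mul, PPair.at_coord])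
    (fun t => by simp [PPair.at_add, PPair.at_mul, PPair.at_coord])
  add_compat := strongHomotopic_of_eqv
    (.add hθ₁ (.fstCoord_sndCoord 0) (.fstCoord_sndCoord 1)) rfl rfl
    (fun t => by simp [PPair.at_add, PPair.at_fstCoord])
    (fun t => by simp [PPair.at_add, PPair.at_sndCoord])
  neg_compat := strongHomotopic_of_eqv (.neg hθ₂ (.fstCoord_sndCoord 0)) rfl rfl
    (fun t => by simp [PPair.at_neg, PPair.at_fstCoord])
    (fun t => by simp [PPair.at_neg, PPair.at_sndCoord])
  mul_compat := strongHomotopic_of_eqv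
    (.mul s hθ₃ (.fstCoord_sndCoord 0) (.fstCoord_sndCoord 1)) rfl rfl
    (fun t => by simp [PPair.at_mul, PPair.at_fstCoord])
    (fun t => by simp [PPair.at_mul, PPair.at_sndCoord])

theorem isStrongPolyUnit (s : MPair.Side) (θ₃ : GIdx × GIdx → ℕ) (hθ₃ : IsRelabeling θ₃)
    (θ₄ : Unit → ℕ) (hθ₄ : IsRelabeling θ₄) (e : 𝔄) (he : ∀ x, e * x = x) :
    IsStrongPolyUnit e (gMul s θ₃) (gOne θ₄ e) := by
  let c : PPair (varScalarData 𝔄 e) Unit := .scalar e he rfl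
  let o : PPair (varScalarData 𝔄 e) GIdx := (c.relabel θ₄ hθ₄).reg
  let x : PPair (varScalarData 𝔄 e) GIdx := .var (fun t => t 0) ⟨0, rfl⟩
  have at_o : ∀ t, o.at t = gOne θ₄ e := fun t => PPair.at_reg _ t
  have at_x : ∀ t, x.at t = (t 0).1 := fun t => PPair.at_var _ _ t
  have ho : Eqv o c := (Eqv.reg _).trans (Eqv.relabel θ₄ hθ₄ c)
  have hxo : Eqv (x.mul s θ₃ hθ₃ o) x :=
    ((Eqv.mul_prodL s θ₃ hθ₃ x o).trans ((Eqv.refl x).prodL ho)).trans (.prodL_scalar x e he rfl)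
  refine ⟨?_, ?_, ?_⟩
  -- The pair `o` is constant, so any point serves for the evaluation; zero supplies one.
  · have h := PPair.isGrass_at o rfl fun _ => ⟨(PPair.zero (varData 𝔄 0)).at ![],
      PPair.isGrass_at _ rfl _⟩
    rwa [at_o] at h
  · exact strongHomotopic_of_eqv hxo rfl rfl (fun t => by simp [PPair.at_mul, at_o, at_x]) at_x
  · exact strongHomotopic_of_eqv ((Eqv.mul_comm s hθ₃ o x).trans hxo) rfl rfl
      (fun t => by simp [PPair.at_mul, at_o, at_x]) at_x

end HRing

end Polymetric

theorem mainTheorem1 {𝔄 : Type u} [NonUnitalCommRing 𝔄] [TopologicalSpace 𝔄]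
    [PolymetricRing 𝔄] [T2Space 𝔄] (hcomplete : SeqComplete 𝔄) (s : MPair.Side)
    (θ₁ : GIdx ⊕ GIdx → ℕ) (hθ₁ : IsRelabeling θ₁)
    (θ₂ : GIdx → ℕ) (hθ₂ : IsRelabeling θ₂)
    (θ₃ : GIdx × GIdx → ℕ) (hθ₃ : IsRelabeling θ₃)
    (θ₄ : Unit → ℕ) (hθ₄ : IsRelabeling θ₄) :
    IsStrongPolyHRing 𝔄 (gAdd θ₁) (gNeg θ₂) (gZero 𝔄) (gMul s θ₃) ∧
      ∀ e : 𝔄, (∀ x, e * x = x) → IsStrongPolyUnit e (gMul s θ₃) (gOne θ₄ e) := by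
  have : IsSeqComplete 𝔄 := ⟨hcomplete⟩
  exact ⟨isStrongPolyHRing s θ₁ hθ₁ θ₂ hθ₂ θ₃ hθ₃, isStrongPolyUnit s θ₃ hθ₃ θ₄ hθ₄⟩
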